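/- **Setting.** Let $\Sigma$ be a finite alphabet. A graph has a finite vertex set, a finite multiset of $\Sigma$-labelled directed edges, and two distinct designated vertices, its source and its target; isomorphic graphs are identified. $G_1\circ G_2$ glues the target of $G_1$ to the source of $G_2$; $G_1\parallel G_2$ glues the two sources and glues the two targets. The $a$-bridge is a single $a$-labelled edge from source to target. SP-graphs are the closure of the bridges under $\circ$ and $\parallel$; they form an algebra $\mathbf{SP}$ over the signature $\{\circ,\parallel\}\uplus\Sigma$. An SP-graph is atomic if it is not of the form $G_1\circ G_2$ with SP-graphs $G_1,G_2$; a P-graph is an atomic SP-graph that is not a bridge, and all other SP-graphs are S-graphs. A set $L$ of SP-graphs is recognized by a finite algebra $B$ over this signature with accepting set $F\subseteq B$ if $L=h^{-1}(F)$ for some homomorphism $h:\mathbf{SP}\to B$; it is recognizable if such $B$, $F$ exist. **Grammars.** A grammar $\Gamma$ has finitely many nonterminals, partitioned into $\mathcal P\uplus\mathcal S$, finitely many rules $x\to t$ with $x$ a nonterminal and $t$ a term over the signature and the nonterminals, and a set of axioms (nonterminals). $\Rightarrow^*$ denotes derivation, and $L(\Gamma)$ is the set of values of the ground terms derived from axioms.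 $\Gamma$ is regular if each rule has one of the forms (with $p,p_i\in\mathcal P$; $s,s_i\in\mathcal S$; $a\in\Sigma$): (A) $p\to p\parallel s^{\ell}$, $\ell\ge1$; (B) $p\to s_1^{\ell_1}\parallel\dots\parallel s_k^{\ell_k}$, with $k\geq 1$, distinct $s_i$, $\ell_i\ge1$, $\sum_i\ell_i\ge2$; (C) $s\to p\circ s_1$; (D) $s\to p_1\circ p_2$; (E) $p\to a$; (F) $s\to a$. Here $s^\ell$ is the $\ell$-fold $\parallel$-composition, and in (A), (B) bracketing and order are irrelevant. $\Gamma$ is alternative if each rule has one of the forms (A), (B), (C), (D), (F), or is a rule $p\to s$ such that, apart from right-hand sides of rules $p'\to s$, the nonterminal $s$ occurs in exactly one rule, of the form $s\to a$. For an alternative grammar the rules $p\to s$ are counted among the rules of type (B). For $p\in\mathcal P$, a nonterminal $s\in\mathcal S$ is periodic for $p$ if there is a rule $p\to p\parallel s^\ell$ (its period is $\ell$), and bounded for $p$ if $s$ occurs in a rule of type (B) with left-hand side $p$ (its bound is one plus the largest exponent of $s$ in such a rule). $\Gamma$ is in normal form if for all $p,s$ there is at most one rule $p\to p\parallel s^\ell$,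 and no $s$ occurring in a rule of type (B) with left-hand side $p$ is periodic for $p$. **Terms.** For $p\in\mathcal P$ let $T_p$ be the idempotent commutative semiring generated by the nonterminals that are bounded or periodic for $p$, with the additional axioms $s^{\mathrm{bound}_p(s)}=0$ for bounded $s$ and $s^{\mathrm{period}_p(s)}=1$ for periodic $s$. Every term equals in $T_p$ a unique sum of distinct monomials to which no additional axiom applies, its normal form $\mathrm{nf}_p$. Write $m\in t$ if the monomial $m$ is a summand of the normal form $t$, and $p\leadsto m$ if there is a rule $p\to s_1^{\ell_1}\parallel\dots\parallel s_k^{\ell_k}$ of type (B) with $m=s_1^{\ell_1}\cdots s_k^{\ell_k}$. **Profiles.** A view of a P-graph $G$ is a monomial $s_1\cdots s_n$ such that $G$ is the value of $t_1\parallel\dots\parallel t_n$ for ground terms with $s_i\Rightarrow^* t_i$. Put $h(G)=\langle h_p(G)\rangle_{p\in\mathcal P}$, where $h_p(G)$ is the normal form in $T_p$ of the sum of those views of $G$ all of whose variables are bounded or periodic for $p$. A view of an S-graph $G$ is a pair $(s,q)\in\mathcal S\times(\mathcal S\uplus\mathcal P\uplus\{\bot\})$ such that $s$ derives a term which equals,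 up to associativity of $\circ$, $t\circ q$ (or $t$, if $q=\bot$), for a ground term $t$ with value $G$; $h(G)$ is the set of all views of $G$. **Operations on profiles.** Let $x,y$ be profiles, i.e. tuples of normal forms or subsets of $\mathcal S\times(\mathcal S\uplus\mathcal P\uplus\{\bot\})$. If $x$ is a tuple, $\mathrm{par}(x)=x$ and $\mathrm{seq}(x)=\{(s,q): q \in \mathcal P\uplus\mathcal S,\ \exists p\in\mathcal P,\ s\Rightarrow^* p\circ q,\ p\leadsto m\in x_p \text{ for some } m\}$. If $x$ is a relation, $\mathrm{seq}(x)=x$ and $\mathrm{par}(x)_p=\mathrm{nf}_p\big(\sum\{s: (s,\bot)\in x,\ s \text{ bounded or periodic for } p\}\big)$. Put $$a^A=\{(s,\bot): s\to a\}\cup\{(s,q): q \in \mathcal P\uplus\mathcal S,\ \exists p\in\mathcal P,\ s'\in\mathcal S,\ s\Rightarrow^* p\circ q,\ p\to s',\ s'\to a\},$$ $$x\parallel^A y=\big\langle \mathrm{nf}_p(\mathrm{par}(x)_p\cdot\mathrm{par}(y)_p)\big\rangle_{p},$$ $$x\circ^A y=\mathrm{seq}(x);\mathrm{seq}(y)\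 \cup\ \{(s,\bot): \exists p,m,\ (s,p)\in\mathrm{seq}(x),\ y\text{ is a tuple},\ p\leadsto m\in y_p\},$$ where $;$ is composition of relations, through elements of $\mathcal S$. **Theorem.** (1) Let $\Gamma$ be an alternative grammar in normal form. The set $A=\{h(G): G\in\mathbf{SP}\}$ is finite and closed under these operations, so it is a finite algebra; $h$ is a homomorphism from $\mathbf{SP}$ to $A$; and $L(\Gamma)=h^{-1}(h(L(\Gamma)))$. Hence $L(\Gamma)$ is recognized by $A$ with accepting set $h(L(\Gamma))$, and is recognizable. (2) For every regular grammar $\Gamma$ with nonterminals $\mathcal P\uplus\mathcal S$ there is an alternative grammar in normal form, with nonterminals $\mathcal P\uplus\mathcal S'$ for some finite set $\mathcal S'$, which has the same language, so that (1) applies to it. In particular $L(\Gamma)$ is recognizable. -/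

import Mathlib

universe u v w

/-! ## Graphs with a source and a target, and their compositions -/

/-- A finite graph with `α`-labelled edges, in which parallel edges (even with the same label) are
allowed, together with two distinct designated vertices, the source and the target. -/
structure SPG.Graph (α : Type u) where
  V : Type
  finite_V : Finite V
  E : Multiset (V × α × V)
  src : V
  tgt : V
  src_ne_tgt : src ≠ tgt

namespace SPG

/-- The action of a map of vertices on edges. -/
def mapEdge {α : Type u} {V W : Type} (f : V → W) (e : V × α × V) : W × α × W :=
  (f e.1, e.2.1, f e.2.2)

namespace Graph

variable {α : Type u}

/-- Isomorphism, i.e. renaming of vertices. -/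
def Iso (G H : Graph α) : Prop :=
  ∃ e : G.V ≃ H.V, G.E.map (mapEdge e) = H.E ∧ e G.src = H.src ∧ e G.tgt = H.tgt

theorem Iso.refl (G : Graph α) : G.Iso G :=
  ⟨Equiv.refl _, by
    have : (mapEdge (Equiv.refl G.V) : G.V × α × G.V → G.V × α × G.V) = id := by
      funext x; rfl
    rw [this, Multiset.map_id], rfl, rfl⟩

theorem Iso.symm {G H : Graph α} : G.Iso H → H.Iso G := by
  rintro ⟨e, hE, hs, ht⟩
  refine ⟨e.symm, ?_, by rw [← hs]; simp, by rw [← ht]; simp⟩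
  rw [← hE, Multiset.map_map]
  have : ((mapEdge e.symm : H.V × α × H.V → G.V × α × G.V) ∘ mapEdge e) = id := by
    funext x; simp [mapEdge]
  rw [this, Multiset.map_id]

theorem Iso.trans {G H K : Graph α} : G.Iso H → H.Iso K → G.Iso K := by
  rintro ⟨e, hE, hs, ht⟩ ⟨e', hE', hs', ht'⟩
  refine ⟨e.trans e', ?_, by simp [hs, hs'], by simp [ht, ht']⟩
  rw [← hE', ← hE, Multiset.map_map]
  rfl

instance setoid (α : Type u) : Setoid (Graph α) where
  r := Iso
  iseqv := ⟨Iso.refl, Iso.symm, Iso.trans⟩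

/-- The `a`-bridge: two vertices and one `a`-labelled edge from the source to the target. -/
def bridge (a : α) : Graph α where
  V := Bool
  finite_V := inferInstance
  E := {(false, a, true)}
  src := false
  tgt := true
  src_ne_tgt := by decide

open Classical in
/-- The position of the vertices of `H` in `G ∘ H`: the source of `H` is joined with the target
of `G`, the other vertices are kept apart from those of `G`. -/
noncomputable def serEmb (G H : Graph α) (v : H.V) : G.V ⊕ {v : H.V // v ≠ H.src} :=
  if h : v = H.src then Sum.inl G.tgt else Sum.inr ⟨v, h⟩

/-- Serial composition. -/
noncomputable def ser (G H : Graph α) : Graph α where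
  V := G.V ⊕ {v : H.V // v ≠ H.src}
  finite_V := by
    have := G.finite_V
    have := H.finite_V
    infer_instance
  E := G.E.map (mapEdge Sum.inl) + H.E.map (mapEdge (serEmb G H))
  src := Sum.inl G.src
  tgt := Sum.inr ⟨H.tgt, H.src_ne_tgt.symm⟩
  src_ne_tgt := by simp

open Classical in
/-- The position of the vertices of `H` in `G ∥ H`: the source and the target of `H` are joined
with those of `G`, the other vertices are kept apart from those of `G`. -/
noncomputable def parEmb (G H : Graph α) (v : H.V) :
    G.V ⊕ {v : H.V // v ≠ H.src ∧ v ≠ H.tgt} :=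
  if h : v = H.src then Sum.inl G.src
  else if h' : v = H.tgt then Sum.inl G.tgt
  else Sum.inr ⟨v, h, h'⟩

/-- Parallel composition. -/
noncomputable def par (G H : Graph α) : Graph α where
  V := G.V ⊕ {v : H.V // v ≠ H.src ∧ v ≠ H.tgt}
  finite_V := by
    have := G.finite_V
    have := H.finite_V
    infer_instance
  E := G.E.map (mapEdge Sum.inl) + H.E.map (mapEdge (parEmb G H))
  src := Sum.inl G.src
  tgt := Sum.inl G.tgt
  src_ne_tgt := by simpa using G.src_ne_tgt

theorem ser_congr {G G' H H' : Graph α} (hG : G.Iso G') (hH : H.Iso H') :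
    (ser G H).Iso (ser G' H') := by
  obtain ⟨e, hE, hs, ht⟩ := hG
  obtain ⟨f, fE, fs, ft⟩ := hH
  have key : ∀ v : H.V, v ≠ H.src ↔ f v ≠ H'.src := fun v => by
    rw [← fs, f.injective.ne_iff]
  let g := f.subtypeEquiv (p := fun v => v ≠ H.src) (q := fun v => v ≠ H'.src) key
  refine ⟨Equiv.sumCongr e g, ?_, ?_, ?_⟩
  · have h1 : (mapEdge (Equiv.sumCongr e g) ∘ mapEdge Sum.inl :
        G.V × α × G.V → _) = mapEdge Sum.inl ∘ mapEdge e := by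
      funext x; simp [mapEdge]
    have h0 : ∀ v, Equiv.sumCongr e g (serEmb G H v) = serEmb G' H' (f v) := by
      intro v
      by_cases h : v = H.src
      · subst h; simp [serEmb, fs, ht]
      · have h' := (key v).1 h
        simp [serEmb, h, h', g]
    have h2 : (mapEdge (Equiv.sumCongr e g) ∘ mapEdge (serEmb G H) :
        H.V × α × H.V → _) = mapEdge (serEmb G' H') ∘ mapEdge f := by
      funext x
      simp only [mapEdge, Function.comp, h0]
    have h3 : (G.E.map (mapEdge Sum.inl) + H.E.map (mapEdge (serEmb G H))).map
          (mapEdge (Equiv.sumCongr e g)) =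
        G'.E.map (mapEdge Sum.inl) + H'.E.map (mapEdge (serEmb G' H')) := by
      rw [Multiset.map_add, Multiset.map_map, Multiset.map_map, h1, h2, ← hE, ← fE,
        Multiset.map_map, Multiset.map_map]
    exact h3
  · change Sum.inl (e G.src) = Sum.inl G'.src
    rw [hs]
  · change Sum.inr _ = Sum.inr _
    congr 1
    exact Subtype.ext ft

theorem par_congr {G G' H H' : Graph α} (hG : G.Iso G') (hH : H.Iso H') :
    (par G H).Iso (par G' H') := by
  obtain ⟨e, hE, hs, ht⟩ := hG
  obtain ⟨f, fE, fs, ft⟩ := hH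
  have key : ∀ v : H.V, (v ≠ H.src ∧ v ≠ H.tgt) ↔ (f v ≠ H'.src ∧ f v ≠ H'.tgt) := fun v => by
    rw [← fs, ← ft, f.injective.ne_iff, f.injective.ne_iff]
  let g := f.subtypeEquiv (p := fun v => v ≠ H.src ∧ v ≠ H.tgt) (q := fun v => v ≠ H'.src ∧ v ≠ H'.tgt) key
  refine ⟨Equiv.sumCongr e g, ?_, ?_, ?_⟩
  · have h1 : (mapEdge (Equiv.sumCongr e g) ∘ mapEdge Sum.inl :
        G.V × α × G.V → _) = mapEdge Sum.inl ∘ mapEdge e := by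
      funext x; simp [mapEdge]
    have h0 : ∀ v, Equiv.sumCongr e g (parEmb G H v) = parEmb G' H' (f v) := by
      intro v
      by_cases h : v = H.src
      · subst h; simp [parEmb, fs, hs]
      · by_cases h' : v = H.tgt
        · subst h'
          have : H'.tgt ≠ H'.src := H'.src_ne_tgt.symm
          simp [parEmb, ft, ht, h, this]
        · have h'' := (key v).1 ⟨h, h'⟩
          simp [parEmb, h, h', h''.1, h''.2, g]
    have h2 : (mapEdge (Equiv.sumCongr e g) ∘ mapEdge (parEmb G H) :
        H.V × α × H.V → _) = mapEdge (parEmb G' H') ∘ mapEdge f := by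
      funext x
      simp only [mapEdge, Function.comp, h0]
    have h3 : (G.E.map (mapEdge Sum.inl) + H.E.map (mapEdge (parEmb G H))).map
          (mapEdge (Equiv.sumCongr e g)) =
        G'.E.map (mapEdge Sum.inl) + H'.E.map (mapEdge (parEmb G' H')) := by
      rw [Multiset.map_add, Multiset.map_map, Multiset.map_map, h1, h2, ← hE, ← fE,
        Multiset.map_map, Multiset.map_map]
    exact h3
  · change Sum.inl (e G.src) = Sum.inl G'.src
    rw [hs]
  · change Sum.inl (e G.tgt) = Sum.inl G'.tgt
    rw [ht]

end Graph

/-- Graphs up to isomorphism. -/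
def GraphClass (α : Type u) : Type (max 1 u) := Quotient (Graph.setoid α)

namespace GraphClass

variable {α : Type u}

def bridge (a : α) : GraphClass α := Quotient.mk (Graph.setoid α) (Graph.bridge a)

noncomputable def ser : GraphClass α → GraphClass α → GraphClass α :=
  Quotient.map₂ Graph.ser fun _ _ h _ _ h' => Graph.ser_congr h h'

noncomputable def par : GraphClass α → GraphClass α → GraphClass α :=
  Quotient.map₂ Graph.par fun _ _ h _ _ h' => Graph.par_congr h h'

/-- Series-parallel graphs: the closure of the bridges under the two compositions. -/
inductive IsSP : GraphClass α → Prop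
  | bridge (a : α) : IsSP (bridge a)
  | ser {G H : GraphClass α} : IsSP G → IsSP H → IsSP (ser G H)
  | par {G H : GraphClass α} : IsSP G → IsSP H → IsSP (par G H)

end GraphClass

/-! ## Algebras over the signature of SP-graphs, and recognizability -/

/-- An (arbitrary) algebra over the signature consisting of the binary symbols `∘` and `∥` and of
one constant for each label. -/
class SPAlgebra (α : Type u) (A : Type v) where
  bridge : α → A
  ser : A → A → A
  par : A → A → A

/-- Homomorphisms of algebras over this signature. -/
structure SPHom (α : Type u) (A : Type v) (B : Type w) [SPAlgebra α A] [SPAlgebra α B] where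
  toFun : A → B
  map_bridge : ∀ a : α, toFun (SPAlgebra.bridge a) = SPAlgebra.bridge a
  map_ser : ∀ x y : A, toFun (SPAlgebra.ser α x y) = SPAlgebra.ser α (toFun x) (toFun y)
  map_par : ∀ x y : A, toFun (SPAlgebra.par α x y) = SPAlgebra.par α (toFun x) (toFun y)

/-- A subset of an algebra that is closed under the operations. -/
structure SPSubalgebra (α : Type u) (A : Type v) [SPAlgebra α A] where
  carrier : Set A
  bridge_mem : ∀ a : α, SPAlgebra.bridge a ∈ carrier
  ser_mem : ∀ x ∈ carrier, ∀ y ∈ carrier, SPAlgebra.ser α x y ∈ carrier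
  par_mem : ∀ x ∈ carrier, ∀ y ∈ carrier, SPAlgebra.par α x y ∈ carrier

/-- The algebra on the carrier whose operations are the restrictions of those of `A`. -/
instance SPSubalgebra.instSPAlgebra {α : Type u} {A : Type v} [SPAlgebra α A]
    (B : SPSubalgebra α A) : SPAlgebra α B.carrier where
  bridge a := ⟨SPAlgebra.bridge a, B.bridge_mem a⟩
  ser x y := ⟨SPAlgebra.ser α x.1 y.1, B.ser_mem x.1 x.2 y.1 y.2⟩
  par x y := ⟨SPAlgebra.par α x.1 y.1, B.par_mem x.1 x.2 y.1 y.2⟩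

/-- `L` is recognized by the finite algebra `B` with accepting set `F`, through `h`. -/
def RecognizedBy {α : Type u} {A : Type v} {B : Type w} [SPAlgebra α A] [SPAlgebra α B]
    (L : Set A) (h : SPHom α A B) (F : Set B) : Prop :=
  Finite B ∧ L = h.toFun ⁻¹' F

/-- `L` is recognizable: some finite algebra recognizes it. -/
def Recognizable (α : Type u) {A : Type v} [SPAlgebra α A] (L : Set A) : Prop :=
  ∃ (B : Type u) (_ : SPAlgebra α B) (h : SPHom α A B) (F : Set B), RecognizedBy L h F

/-- The SP-graphs (up to isomorphism). -/
def SPGraph (α : Type u) : Type (max 1 u) := {G : GraphClass α // GraphClass.IsSP G}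

/-- The algebra of SP-graphs. -/
noncomputable instance SPGraph.instSPAlgebra (α : Type u) : SPAlgebra α (SPGraph α) where
  bridge a := ⟨GraphClass.bridge a, .bridge a⟩
  ser G H := ⟨GraphClass.ser G.1 H.1, .ser G.2 H.2⟩
  par G H := ⟨GraphClass.par G.1 H.1, .par G.2 H.2⟩

namespace SPGraph

variable {α : Type u}

/-- An SP-graph is atomic if it is not a serial composition. -/
def IsAtomic (G : SPGraph α) : Prop := ¬ ∃ G₁ G₂ : SPGraph α, G = SPAlgebra.ser α G₁ G₂

/-- P-graphs are the atomic SP-graphs that are not bridges; the other SP-graphs are S-graphs. -/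
def IsPGraph (G : SPGraph α) : Prop := G.IsAtomic ∧ ¬ ∃ a : α, G = SPAlgebra.bridge a

end SPGraph

/-! ## Grammars -/

/-- Terms over the signature of SP-graphs, with variables (nonterminals) from `N`. -/
inductive Term (α : Type u) (N : Type v) : Type (max u v)
  | nt : N → Term α N
  | label : α → Term α N
  | ser : Term α N → Term α N → Term α N
  | par : Term α N → Term α N → Term α N

namespace Term

variable {α : Type u} {N : Type v}

/-- `t.HasValue x`: the term `t` is ground (has no nonterminals) and evaluates to `x`. -/
inductive HasValue {A : Type w} [SPAlgebra α A] : Term α N → A → Prop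
  | label (a : α) : HasValue (.label a) (SPAlgebra.bridge a)
  | ser {t u : Term α N} {x y : A} :
      HasValue t x → HasValue u y → HasValue (.ser t u) (SPAlgebra.ser α x y)
  | par {t u : Term α N} {x y : A} :
      HasValue t x → HasValue u y → HasValue (.par t u) (SPAlgebra.par α x y)

/-- The nonterminal `x` occurs in the term. -/
def Occurs (x : N) : Term α N → Prop
  | .nt y => x = y
  | .label _ => False
  | .ser t u => t.Occurs x ∨ u.Occurs x
  | .par t u => t.Occurs x ∨ u.Occurs x

/-- The term is a parallel composition (with any bracketing and order) of nonterminals, in which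
each nonterminal `x` has `m x` occurrences. -/
inductive ParOf : Term α N → (N →₀ ℕ) → Prop
  | nt (x : N) : ParOf (.nt x) (Finsupp.single x 1)
  | par {t u : Term α N} {m n : N →₀ ℕ} : ParOf t m → ParOf u n → ParOf (.par t u) (m + n)

/-- Equality of terms up to the associativity law for `∘`. -/
inductive AssocEq : Term α N → Term α N → Prop
  | assoc (t u v : Term α N) : AssocEq (.ser (.ser t u) v) (.ser t (.ser u v))
  | refl (t : Term α N) : AssocEq t t
  | symm {t u : Term α N} : AssocEq t u → AssocEq u t
  | trans {t u v : Term α N} : AssocEq t u → AssocEq u v → AssocEq t v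
  | ser {t t' u u' : Term α N} :
      AssocEq t t' → AssocEq u u' → AssocEq (.ser t u) (.ser t' u')
  | par {t t' u u' : Term α N} :
      AssocEq t t' → AssocEq u u' → AssocEq (.par t u) (.par t' u')

end Term

/-- A grammar over SP-terms: a finite set of rules and a set of initial nonterminals. -/
structure Grammar (α : Type u) (N : Type v) where
  rules : Set (N × Term α N)
  finite_rules : rules.Finite
  initial : Set N

namespace Grammar

section General

variable {α : Type u} {N : Type v} (Γ : Grammar α N)

/-- One derivation step: one occurrence of a nonterminal is replaced by the right-hand side of a
rule. -/
inductive Step : Term α N → Term α N → Prop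
  | rule {x : N} {t : Term α N} : (x, t) ∈ Γ.rules → Step (.nt x) t
  | ser_left {t t' : Term α N} (u : Term α N) : Step t t' → Step (.ser t u) (.ser t' u)
  | ser_right (t : Term α N) {u u' : Term α N} : Step u u' → Step (.ser t u) (.ser t u')
  | par_left {t t' : Term α N} (u : Term α N) : Step t t' → Step (.par t u) (.par t' u)
  | par_right (t : Term α N) {u u' : Term α N} : Step u u' → Step (.par t u) (.par t u')

/-- Derivations: finite, possibly empty, sequences of steps. -/
def Derives : Term α N → Term α N → Prop := Relation.ReflTransGen Γ.Step

/-- There is a complete derivation from `x` of a ground term with value `G`. -/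
def Generates (x : N) (G : SPGraph α) : Prop := ∃ t, Γ.Derives (.nt x) t ∧ t.HasValue G

/-- The language of a grammar. -/
def lang : Set (SPGraph α) := {G | ∃ x ∈ Γ.initial, Γ.Generates x G}

end General

section Regular

/-! In what follows the nonterminals are partitioned into `P` and `S`. -/

variable {α : Type u} {P : Type v} {S : Type w} (Γ : Grammar α (P ⊕ S))

/-- The grammar has a rule `p → p ∥ s^ℓ`, with `ℓ ≥ 1`. -/
def RuleA (p : P) (s : S) (l : ℕ) : Prop :=
  1 ≤ l ∧ ∃ t, (Sum.inl p, t) ∈ Γ.rules ∧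
    t.ParOf (Finsupp.single (Sum.inl p) 1 + Finsupp.single (Sum.inr s) l)

/-- The grammar has a rule `p → s₁^ℓ₁ ∥ ⋯ ∥ sₖ^ℓₖ` whose right-hand side corresponds to the
monomial `m = s₁^ℓ₁ ⋯ sₖ^ℓₖ`. In an alternative grammar, this includes the rules `p → s`. -/
def RuleB (p : P) (m : S →₀ ℕ) : Prop :=
  ∃ t, (Sum.inl p, t) ∈ Γ.rules ∧ t.ParOf (m.mapDomain Sum.inr)

/-- Each of the rules has one of the forms (A) `p → p ∥ s^ℓ` with `ℓ ≥ 1`,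
(B) `p → s₁^ℓ₁ ∥ ⋯ ∥ sₖ^ℓₖ` with `ℓ₁ + ⋯ + ℓₖ ≥ 2`, (C) `s → p ∘ s₁`, (D) `s → p₁ ∘ p₂`,
(E) `p → a`, (F) `s → a`. -/
def IsRegular : Prop :=
  ∀ r ∈ Γ.rules,
    (∃ (p : P) (s : S) (l : ℕ), 1 ≤ l ∧ r.1 = Sum.inl p ∧
      r.2.ParOf (Finsupp.single (Sum.inl p) 1 + Finsupp.single (Sum.inr s) l)) ∨
    (∃ (p : P) (m : S →₀ ℕ), 2 ≤ m.degree ∧ r.1 = Sum.inl p ∧ r.2.ParOf (m.mapDomain Sum.inr)) ∨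
    (∃ (s : S) (p : P) (s₁ : S), r = (Sum.inr s, .ser (.nt (Sum.inl p)) (.nt (Sum.inr s₁)))) ∨
    (∃ (s : S) (p₁ p₂ : P), r = (Sum.inr s, .ser (.nt (Sum.inl p₁)) (.nt (Sum.inl p₂)))) ∨
    (∃ (p : P) (a : α), r = (Sum.inl p, .label a)) ∨
    (∃ (s : S) (a : α), r = (Sum.inr s, .label a))

/-- Apart from right-hand sides of rules `p → s`, the nonterminal `s` occurs in exactly one rule,
of the form `s → a`. -/
def IsBridgeNonterminal (s : S) : Prop :=
  ∃ a : α, (Sum.inr s, .label a) ∈ Γ.rules ∧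
    ∀ r ∈ Γ.rules, (r.1 = Sum.inr s ∨ r.2.Occurs (Sum.inr s)) →
      r = (Sum.inr s, .label a) ∨ ∃ p : P, r = (Sum.inl p, .nt (Sum.inr s))

/-- Alternative grammars: in comparison with regular grammars, rules `p → a` are replaced by rules
`p → s`, where `s` occurs otherwise in a single rule `s → a`. -/
def IsAlternative : Prop :=
  ∀ r ∈ Γ.rules,
    (∃ (p : P) (s : S) (l : ℕ), 1 ≤ l ∧ r.1 = Sum.inl p ∧
      r.2.ParOf (Finsupp.single (Sum.inl p) 1 + Finsupp.single (Sum.inr s) l)) ∨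
    (∃ (p : P) (m : S →₀ ℕ), 2 ≤ m.degree ∧ r.1 = Sum.inl p ∧ r.2.ParOf (m.mapDomain Sum.inr)) ∨
    (∃ (s : S) (p : P) (s₁ : S), r = (Sum.inr s, .ser (.nt (Sum.inl p)) (.nt (Sum.inr s₁)))) ∨
    (∃ (s : S) (p₁ p₂ : P), r = (Sum.inr s, .ser (.nt (Sum.inl p₁)) (.nt (Sum.inl p₂)))) ∨
    (∃ (p : P) (s : S), r = (Sum.inl p, .nt (Sum.inr s)) ∧ Γ.IsBridgeNonterminal s) ∨
    (∃ (s : S) (a : α), r = (Sum.inr s, .label a))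

/-- `s` is periodic for `p`. -/
def Periodic (p : P) (s : S) : Prop := ∃ l, Γ.RuleA p s l

/-- `s` is bounded for `p`. -/
def Bounded (p : P) (s : S) : Prop := ∃ m, Γ.RuleB p m ∧ m s ≠ 0

/-- Normal form: for all `p`, `s` there is at most one rule `p → p ∥ s^ℓ`, and all nonterminals
in the right-hand side of a rule `p → s₁^ℓ₁ ∥ ⋯ ∥ sₖ^ℓₖ` are bounded and not periodic for `p`. -/
def IsNormal : Prop :=
  (∀ p s l l', Γ.RuleA p s l → Γ.RuleA p s l' → l = l') ∧
  (∀ p m, Γ.RuleB p m → ∀ s, m s ≠ 0 → Γ.Bounded p s ∧ ¬ Γ.Periodic p s)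

/-- The period of `s` for `p`: the exponent `ℓ` in the rule `p → p ∥ s^ℓ`. -/
noncomputable def period (p : P) (s : S) : ℕ := sInf {l | Γ.RuleA p s l}

/-- The bound of `s` for `p`: one plus the largest exponent of `s` in a rule
`p → s₁^ℓ₁ ∥ ⋯ ∥ sₖ^ℓₖ`. -/
noncomputable def bound (p : P) (s : S) : ℕ := sSup {l | ∃ m, Γ.RuleB p m ∧ l = m s} + 1

/-! ## The term algebras and normal forms of terms

Terms built from `+`, `·`, `0`, `1` are taken up to the laws of commutative semirings, i.e. they
are polynomials with coefficients in `ℕ`; monomials are their exponent vectors `S →₀ ℕ`. -/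

/-- The additional laws of the term algebra of `p`: idempotency of `+`, `s ^ bound = 0` for the
bounded and `s ^ period = 1` for the periodic nonterminals. -/
inductive TermRel (p : P) : MvPolynomial S ℕ → MvPolynomial S ℕ → Prop
  | idem : TermRel p (1 + 1) 1
  | bounded {s : S} : Γ.Bounded p s → TermRel p (MvPolynomial.X s ^ Γ.bound p s) 0
  | periodic {s : S} : Γ.Periodic p s → TermRel p (MvPolynomial.X s ^ Γ.period p s) 1

/-- The equational theory of the term algebra of `p`. -/
noncomputable def termCon (p : P) : RingCon (MvPolynomial S ℕ) := ringConGen (Γ.TermRel p)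

/-- The term algebra of `p`, an idempotent commutative semiring. -/
abbrev TermAlg (p : P) : Type w := (Γ.termCon p).Quotient

/-- A monomial is reduced if no law of the form `s ^ bound = 0` or `s ^ period = 1` applies. -/
def IsReduced (p : P) (m : S →₀ ℕ) : Prop :=
  ∀ s, (Γ.Bounded p s → m s < Γ.bound p s) ∧ (Γ.Periodic p s → m s < Γ.period p s)

/-- `m'` is the normal form of the monomial `m` (there is none if `m` is equal to `0`): it is
reduced and obtained from `m` by removing periods of periodic nonterminals. -/
def IsMonomialNF (p : P) (m m' : S →₀ ℕ) : Prop :=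
  Γ.IsReduced p m' ∧
    ∀ s, (Γ.Periodic p s → m' s ≡ m s [MOD Γ.period p s]) ∧ (¬ Γ.Periodic p s → m' s = m s)

/-- The normal form of a sum of monomials, as the set of reduced monomials occurring in it. -/
def nf (p : P) (T : Set (S →₀ ℕ)) : Set (S →₀ ℕ) := {m' | ∃ m ∈ T, Γ.IsMonomialNF p m m'}

variable {Γ}

theorem period_pos {p : P} {s : S} (h : Γ.Periodic p s) : 0 < Γ.period p s :=
  (Nat.sInf_mem (s := {l | Γ.RuleA p s l}) h).1

theorem IsNormal.not_periodic (hΓ : Γ.IsNormal) {p : P} {s : S} (h : Γ.Bounded p s) :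
    ¬ Γ.Periodic p s := by
  obtain ⟨m, hm, hs⟩ := h
  exact (hΓ.2 p m hm s hs).2

theorem nf_union (p : P) (T U : Set (S →₀ ℕ)) : Γ.nf p (T ∪ U) = Γ.nf p T ∪ Γ.nf p U := by
  ext m'
  simp only [nf, Set.mem_ofPred_eq, Set.mem_union]
  constructor
  · rintro ⟨m, h | h, hm⟩
    · exact Or.inl ⟨m, h, hm⟩
    · exact Or.inr ⟨m, h, hm⟩
  · rintro (⟨m, h, hm⟩ | ⟨m, h, hm⟩)
    · exact ⟨m, Or.inl h, hm⟩
    · exact ⟨m, Or.inr h, hm⟩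

/-- A monomial to which no law `s ^ bound = 0` applies has a normal form. -/
theorem exists_isMonomialNF (hΓ : Γ.IsNormal) (p : P) (m : S →₀ ℕ)
    (hm : ∀ s, Γ.Bounded p s → m s < Γ.bound p s) : ∃ m', Γ.IsMonomialNF p m m' := by
  classical
  refine ⟨Finsupp.onFinset m.support
    (fun s => if Γ.Periodic p s then m s % Γ.period p s else m s) ?_, ?_, ?_⟩
  · intro s hs
    rw [Finsupp.mem_support_iff]
    intro h0
    simp [h0] at hs
  · intro s
    simp only [Finsupp.onFinset_apply]
    refine ⟨fun h => ?_, fun h => ?_⟩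
    · rw [if_neg (hΓ.not_periodic h)]
      exact hm s h
    · rw [if_pos h]
      exact Nat.mod_lt _ (period_pos h)
  · intro s
    simp only [Finsupp.onFinset_apply]
    refine ⟨fun h => ?_, fun h => ?_⟩
    · rw [if_pos h]
      exact Nat.mod_modEq _ _
    · rw [if_neg h]

theorem isMonomialNF_add (hΓ : Γ.IsNormal) (p : P) (m n k : S →₀ ℕ) :
    Γ.IsMonomialNF p (m + n) k ↔ ∃ m', Γ.IsMonomialNF p m m' ∧ Γ.IsMonomialNF p (m' + n) k := by
  constructor
  · rintro ⟨hr, hk⟩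
    obtain ⟨m', hm'⟩ := exists_isMonomialNF hΓ p m fun s hs => by
      have h1 := (hr s).1 hs
      rw [(hk s).2 (hΓ.not_periodic hs)] at h1
      exact lt_of_le_of_lt (by simp) h1
    refine ⟨m', hm', hr, fun s => ⟨fun h => ?_, fun h => ?_⟩⟩
    · exact ((hk s).1 h).trans (Nat.ModEq.add_right _ ((hm'.2 s).1 h).symm)
    · rw [(hk s).2 h]
      simp [(hm'.2 s).2 h]
  · rintro ⟨m', hm', hr, hk⟩
    refine ⟨hr, fun s => ⟨fun h => ?_, fun h => ?_⟩⟩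
    · exact ((hk s).1 h).trans (Nat.ModEq.add_right _ ((hm'.2 s).1 h))
    · rw [(hk s).2 h]
      simp [(hm'.2 s).2 h]

theorem nf_image2_add (hΓ : Γ.IsNormal) (p : P) (T U : Set (S →₀ ℕ)) :
    Γ.nf p (Set.image2 (· + ·) T U) = Γ.nf p (Set.image2 (· + ·) (Γ.nf p T) U) := by
  ext k
  constructor
  · rintro ⟨_, ⟨m, hm, n, hn, rfl⟩, hk⟩
    obtain ⟨m', h1, h2⟩ := (isMonomialNF_add hΓ p m n k).1 hk
    exact ⟨m' + n, ⟨m', ⟨m, hm, h1⟩, n, hn, rfl⟩, h2⟩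
  · rintro ⟨_, ⟨m', ⟨m, hm, h1⟩, n, hn, rfl⟩, hk⟩
    exact ⟨m + n, ⟨m, hm, n, hn, rfl⟩, (isMonomialNF_add hΓ p m n k).2 ⟨m', h1, hk⟩⟩

theorem support_add_nat (t u : MvPolynomial S ℕ) :
    ((t + u).support : Set (S →₀ ℕ)) =
      (t.support : Set (S →₀ ℕ)) ∪ (u.support : Set (S →₀ ℕ)) := by
  ext m
  simp only [Finset.mem_coe, MvPolynomial.mem_support_iff, MvPolynomial.coeff_add, Set.mem_union]
  omega

theorem support_mul_nat (t u : MvPolynomial S ℕ) :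
    ((t * u).support : Set (S →₀ ℕ)) =
      Set.image2 (· + ·) (t.support : Set (S →₀ ℕ)) u.support := by
  classical
  ext m
  simp only [Finset.mem_coe, MvPolynomial.mem_support_iff, MvPolynomial.coeff_mul, ne_eq,
    Finset.sum_eq_zero_iff, Set.mem_image2, mul_eq_zero, not_forall,
    not_or]
  constructor
  · rintro ⟨⟨a, b⟩, h, h1, h2⟩
    exact ⟨a, h1, b, h2, Finset.HasAntidiagonal.mem_antidiagonal.1 h⟩
  · rintro ⟨a, h1, b, h2, h⟩
    exact ⟨⟨a, b⟩, Finset.HasAntidiagonal.mem_antidiagonal.2 h, h1, h2⟩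

/-- Equality of normal forms, as a congruence. -/
theorem nf_eq_of_termCon (hΓ : Γ.IsNormal) (p : P) {t u : MvPolynomial S ℕ}
    (h : Γ.termCon p t u) : Γ.nf p t.support = Γ.nf p u.support := by
  classical
  have hcomm : ∀ T U : Set (S →₀ ℕ), Set.image2 (· + ·) T U = Set.image2 (· + ·) U T :=
    fun T U => Set.image2_comm fun a b => add_comm a b
  let c : RingCon (MvPolynomial S ℕ) :=
    { r := fun t u => Γ.nf p t.support = Γ.nf p u.support
      iseqv := ⟨fun _ => rfl, fun h => h.symm, fun h h' => h.trans h'⟩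
      add' := by
        intro a b a' b' h h'
        change Γ.nf p _ = Γ.nf p _ at h
        change Γ.nf p _ = Γ.nf p _ at h'
        rw [support_add_nat, support_add_nat, nf_union, nf_union, h, h']
      mul' := by
        intro a b a' b' h h'
        change Γ.nf p _ = Γ.nf p _ at h
        change Γ.nf p _ = Γ.nf p _ at h'
        rw [support_mul_nat, support_mul_nat, nf_image2_add hΓ, h, ← nf_image2_add hΓ,
          hcomm, nf_image2_add hΓ, h', ← nf_image2_add hΓ, hcomm] }
  have hle : ringConGen (Γ.TermRel p) ≤ c := by
    refine RingCon.ringConGen_le.2 ?_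
    intro t u htu
    change Γ.nf p t.support = Γ.nf p u.support
    induction htu with
    | idem => rw [support_add_nat, Set.union_self]
    | @bounded s hs =>
      rw [MvPolynomial.support_X_pow, MvPolynomial.support_zero]
      ext k
      simp only [nf, Finset.coe_singleton, Finset.coe_empty, Set.mem_singleton_iff, exists_eq_left,
        Set.mem_ofPred_eq, Set.mem_empty_iff_false, false_and, exists_false, iff_false]
      rintro ⟨hr, hk⟩
      have h1 := (hr s).1 hs
      rw [(hk s).2 (hΓ.not_periodic hs)] at h1
      simp at h1
    | @periodic s hs =>
      have h1 : (1 : MvPolynomial S ℕ).support = {0} := by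
        rw [← MvPolynomial.C_1, MvPolynomial.support_C, if_neg one_ne_zero]
      rw [MvPolynomial.support_X_pow, h1]
      ext k
      simp only [nf, Finset.coe_singleton, Set.mem_singleton_iff, exists_eq_left,
        Set.mem_ofPred_eq, IsMonomialNF]
      refine and_congr_right fun _ => forall_congr' fun s' => ?_
      by_cases hss : s = s'
      · subst hss
        simp [hs, Nat.ModEq]
      · simp [Finsupp.single_eq_of_ne' hss]
  exact hle h

/-- Normal forms are adequate: two terms are equal in the term algebra of `p` iff they have the
same normal form. -/
theorem termAlg_eq_iff (hΓ : Γ.IsNormal) (p : P) (t u : MvPolynomial S ℕ) :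
    ((t : Γ.TermAlg p) = (u : Γ.TermAlg p)) ↔ Γ.nf p t.support = Γ.nf p u.support := by
  classical
  refine ⟨fun h => nf_eq_of_termCon hΓ p ((RingCon.eq _).1 h), fun h => ?_⟩
  let q : MvPolynomial S ℕ →+* Γ.TermAlg p := (Γ.termCon p).mk'
  have hrel : ∀ {a b}, Γ.TermRel p a b → q a = q b := fun hab =>
    (RingCon.eq _).2 (RingConGen.Rel.of _ _ hab)
  have hidem : ∀ x : Γ.TermAlg p, x + x = x := fun x => by
    have h1 := hrel (TermRel.idem (Γ := Γ) (p := p))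
    rw [map_add, map_one] at h1
    calc x + x = (1 + 1) * x := by ring
      _ = x := by rw [h1, one_mul]
  let M : (S →₀ ℕ) → Γ.TermAlg p := fun m => q (MvPolynomial.monomial m 1)
  have hM : ∀ m n, M (m + n) = M m * M n := fun m n => by
    simp only [M, ← map_mul, MvPolynomial.monomial_mul, one_mul]
  have hMpow : ∀ s k, M (Finsupp.single s k) = q (MvPolynomial.X s) ^ k := fun s k => by
    simp only [M, ← map_pow, MvPolynomial.X_pow_eq_monomial]
  -- monomials without normal form vanish
  have hzero : ∀ m, (¬ ∃ m', Γ.IsMonomialNF p m m') → M m = 0 := by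
    intro m hm
    have : ¬ ∀ s, Γ.Bounded p s → m s < Γ.bound p s := fun h' =>
      hm (exists_isMonomialNF hΓ p m h')
    push Not at this
    obtain ⟨s, hs, hle⟩ := this
    have hd : m = Finsupp.single s (Γ.bound p s) + (m - Finsupp.single s (Γ.bound p s)) := by
      rw [add_tsub_cancel_of_le]
      rwa [Finsupp.single_le_iff]
    rw [hd, hM, hMpow, ← map_pow, hrel (TermRel.bounded hs), map_zero, zero_mul]
  -- monomials are equal to their normal form
  have hnf : ∀ m m', Γ.IsMonomialNF p m m' → M m = M m' := by
    intro m m' hm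
    have hle : m' ≤ m := by
      intro s
      by_cases hs : Γ.Periodic p s
      · have h1 := (hm.2 s).1 hs
        have h2 := (hm.1 s).2 hs
        rw [Nat.ModEq, Nat.mod_eq_of_lt h2] at h1
        rw [h1]
        exact Nat.mod_le _ _
      · exact ((hm.2 s).2 hs).le
    have hone : M (m - m') = 1 := by
      have h1 : ∀ s, M (Finsupp.single s ((m - m') s)) = 1 := by
        intro s
        by_cases hs : Γ.Periodic p s
        · have h2 : Γ.period p s ∣ (m - m') s :=
            (Nat.modEq_iff_dvd' (hle s)).1 ((hm.2 s).1 hs)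
          obtain ⟨k, hk⟩ := h2
          rw [hk, hMpow, pow_mul, ← map_pow, hrel (TermRel.periodic hs), map_one, one_pow]
        · have h2 : (m - m') s = 0 := by
            simp [(hm.2 s).2 hs]
          rw [h2, hMpow, pow_zero]
      have h3 : ∀ d : S →₀ ℕ, M d = d.prod fun s k => M (Finsupp.single s k) := by
        intro d
        simp only [hMpow]
        change q (MvPolynomial.monomial d 1) = _
        rw [MvPolynomial.monomial_eq, map_mul, map_one, map_one, one_mul, Finsupp.prod, map_prod]
        simp [Finsupp.prod]
      rw [h3]
      exact Finset.prod_eq_one fun s _ => h1 s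
    rw [← add_tsub_cancel_of_le hle, hM, hone, mul_one]
  -- a term absorbs its monomials
  have hsm : ∀ (t : MvPolynomial S ℕ), q t = ∑ m ∈ t.support, M m := by
    have hnat : ∀ (n : ℕ) (x : Γ.TermAlg p), n ≠ 0 → n • x = x := by
      intro n x hn
      induction n with
      | zero => exact absurd rfl hn
      | succ k ih =>
        by_cases hk : k = 0
        · simp [hk]
        · rw [succ_nsmul, ih hk, hidem]
    intro t
    conv_lhs => rw [t.as_sum, map_sum]
    refine Finset.sum_congr rfl fun m hm => ?_
    have h1 : MvPolynomial.monomial m (t.coeff m) =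
        t.coeff m • (MvPolynomial.monomial m 1 : MvPolynomial S ℕ) := by
      rw [MvPolynomial.smul_monomial, smul_eq_mul, mul_one]
    rw [h1, map_nsmul, hnat _ _ (MvPolynomial.mem_support_iff.1 hm)]
  have habs : ∀ (u : MvPolynomial S ℕ), ∀ m ∈ u.support, M m + q u = q u := by
    intro u m hm
    rw [hsm, ← Finset.add_sum_erase _ _ hm, ← add_assoc, hidem]
  have hle : ∀ t u : MvPolynomial S ℕ, Γ.nf p t.support = Γ.nf p u.support →
      q t + q u = q u := by
    intro t u h
    have h1 : ∀ m ∈ t.support, M m + q u = q u := by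
      intro m hm
      by_cases hex : ∃ m', Γ.IsMonomialNF p m m'
      · obtain ⟨m', hm'⟩ := hex
        have h2 : m' ∈ Γ.nf p u.support := h ▸ ⟨m, hm, hm'⟩
        obtain ⟨n, hn, hn'⟩ := h2
        rw [hnf m m' hm', ← hnf n m' hn']
        exact habs u n hn
      · rw [hzero m hex, zero_add]
    rw [hsm t]
    have h2 : ∀ F : Finset (S →₀ ℕ), F ⊆ t.support → (∑ m ∈ F, M m) + q u = q u := by
      intro F
      induction F using Finset.induction_on with
      | empty => intro _; simp
      | insert a F ha ih =>
        intro hF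
        rw [Finset.sum_insert ha, add_assoc, ih fun x hx => hF (Finset.mem_insert_of_mem hx),
          h1 a (hF (Finset.mem_insert_self _ _))]
    exact h2 _ subset_rfl
  change q t = q u
  rw [← hle t u h, add_comm, hle u t h.symm]

/-! ## Profiles of SP-graphs, and the algebra of profiles -/

variable (Γ)

/-- The nonterminals that may occur in terms of the term algebra of `p`. -/
def IsVar (p : P) (s : S) : Prop := Γ.Bounded p s ∨ Γ.Periodic p s

/-- `G = t₁ ∥ ⋯ ∥ tₙ`, `n ≥ 1`, for complete derivations from `sᵢ` of ground terms `tᵢ`, where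
`m = s₁ ⋯ sₙ`. For a P-graph `G` (then `n ≥ 2`) the monomial `m` is called a view of `G`. -/
inductive IsParView : SPGraph α → (S →₀ ℕ) → Prop
  | single {s : S} {G : SPGraph α} :
      Γ.Generates (Sum.inr s) G → IsParView G (Finsupp.single s 1)
  | par {G H : SPGraph α} {m n : S →₀ ℕ} :
      IsParView G m → IsParView H n → IsParView (SPAlgebra.par α G H) (m + n)

/-- The `p`-profile of a P-graph: the normal form of the sum of its views. -/
def parProfile (p : P) (G : SPGraph α) : Set (S →₀ ℕ) :=
  Γ.nf p {m | Γ.IsParView G m ∧ ∀ s, m s ≠ 0 → Γ.IsVar p s}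

/-- Views of S-graphs; `none` stands for `⊥`. There is a derivation from `s` of a term that
equals, up to associativity of `∘`, `t ∘ q` (or `t`, if `q = ⊥`), for a ground term `t` with
value `G`. -/
def IsSerView (G : SPGraph α) (s : S) : Option (P ⊕ S) → Prop
  | some q => ∃ w t, Γ.Derives (.nt (Sum.inr s)) w ∧ w.AssocEq (.ser t (.nt q)) ∧ t.HasValue G
  | none => ∃ w t, Γ.Derives (.nt (Sum.inr s)) w ∧ w.AssocEq t ∧ t.HasValue G

/-- The profile of an S-graph: the set of its views. -/
def serProfile (G : SPGraph α) : Set (S × Option (P ⊕ S)) := {v | Γ.IsSerView G v.1 v.2}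

/-- Tuples of terms in normal form (first summand), and relations between `S` and
`P ⊎ S ⊎ {⊥}` (second summand). -/
def Profile (_ : Grammar α (P ⊕ S)) : Type (max v w) :=
  (P → Set (S →₀ ℕ)) ⊕ Set (S × Option (P ⊕ S))

open Classical in
/-- The profile of an SP-graph. -/
noncomputable def profile (G : SPGraph α) : Γ.Profile :=
  if G.IsPGraph then Sum.inl fun p => Γ.parProfile p G else Sum.inr (Γ.serProfile G)

/-- Conversion of a profile to a tuple of terms in normal form. -/
def toPar : Γ.Profile → P → Set (S →₀ ℕ)
  | Sum.inl t => t
  | Sum.inr r => fun p =>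
      Γ.nf p {m | ∃ s, (s, none) ∈ r ∧ Γ.IsVar p s ∧ m = Finsupp.single s 1}

/-- Conversion of a profile to a relation. -/
def toSer : Γ.Profile → Set (S × Option (P ⊕ S))
  | Sum.inl t => {v | ∃ p q, v.2 = some q ∧
      Γ.Derives (.nt (Sum.inr v.1)) (.ser (.nt (Sum.inl p)) (.nt q)) ∧
      ∃ m ∈ t p, Γ.RuleB p m}
  | Sum.inr r => r

/-- The interpretation of the label `a`. -/
def profileBridge (a : α) : Γ.Profile :=
  Sum.inr ({v | v.2 = none ∧ (Sum.inr v.1, .label a) ∈ Γ.rules} ∪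
    {v | ∃ (p : P) (q : P ⊕ S) (s : S), v.2 = some q ∧
      Γ.Derives (.nt (Sum.inr v.1)) (.ser (.nt (Sum.inl p)) (.nt q)) ∧
      (Sum.inl p, .nt (Sum.inr s)) ∈ Γ.rules ∧ (Sum.inr s, .label a) ∈ Γ.rules})

/-- The interpretation of `∥`: componentwise multiplication of terms. -/
def profilePar (x y : Γ.Profile) : Γ.Profile :=
  Sum.inl fun p => Γ.nf p (Set.image2 (· + ·) (Γ.toPar x p) (Γ.toPar y p))

/-- The interpretation of `∘`: composition of relations, together with the pairs `(s, ⊥)` for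
which `(s, p)` belongs to the first relation and `y` is a tuple whose `p`-th component contains a
monomial `m` with a rule from `p`. -/
def profileSer (x y : Γ.Profile) : Γ.Profile :=
  Sum.inr ({v | ∃ s' : S, (v.1, some (Sum.inr s')) ∈ Γ.toSer x ∧ (s', v.2) ∈ Γ.toSer y} ∪
    {v | v.2 = none ∧ ∃ (p : P) (t : P → Set (S →₀ ℕ)),
      (v.1, some (Sum.inl p)) ∈ Γ.toSer x ∧ y = Sum.inl t ∧ ∃ m ∈ t p, Γ.RuleB p m})

instance instSPAlgebraProfile : SPAlgebra α Γ.Profile where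
  bridge := Γ.profileBridge
  ser := Γ.profileSer
  par := Γ.profilePar

end Regular

end Grammar

end SPG

/-!
# Recognizability of the languages of regular grammars for series-parallel graphs

The profile of a graph records which parts of derivations the graph can fill. That profiles of
compositions can be computed from the profiles of the components rests on two facts about graphs.

* For parallel composition all graphs satisfy Riesz refinement
  (`GraphClass.exists_refinement`), and bridges and serial compositions are irreducible
  (`SPGraph.eq_one_or_eq_one_of_not_isPGraph`). Hence the components generated by the
  nonterminals of a view of `G ∥ H` distribute among `G` and `H` (`ParYields.split`), and views of
  `G ∥ H` are products of views of `G` and of `H`.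
* For serial composition SP-graphs satisfy Levi's lemma (`SPGraph.ser_eq_ser`), as the first factor
  of a composition is closed under predecessors. Hence views of `G ∘ H` are compositions of views
  of the factors (`IsAlternative.serView_ser_iff`).

Both are proved with graphs realized inside one ambient set of vertices (`Rep`), where compositions
are unions and common refinements are intersections.

The two kinds of profiles are linked by `yields_inl_iff`: whether `p` generates `G` depends only on
the `p`-profile of `G`. Indeed, a derivation from `p` replaces `p` by rules of type (A) and finally by
one of type (B); the former multiply the view by powers `s ^ period`, which the normal form removes.
So taking profiles is a homomorphism, whose image is finite because reduced monomials have bounded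
exponents, and the language is saturated because profiles determine the generating nonterminals.

A regular grammar is turned into an alternative one in normal form by giving each rule `p → t` its
own copies of the nonterminals in `S` (`toAlternative`): a copy then occurs in at most one rule of
type (A) or (B), while all copies generate the same graphs.
-/

namespace SPG

/-! ### Realizing graphs inside an ambient set of vertices -/

section Realization

variable {α : Type*} {W W' : Type} {A B : Set W} {E F : Multiset (W × α × W)} {s t c : W}
  {x y z : GraphClass α}

theorem map_mapEdge_mapEdge {V : Type} (f : V → W) (g : W → W') (M : Multiset (V × α × V)) :
    (M.map (mapEdge f)).map (mapEdge g) = M.map (mapEdge (g ∘ f)) := by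
  rw [Multiset.map_map]; rfl

theorem mapEdge_injective {V : Type} {f : V → W} (hf : Function.Injective f) :
    Function.Injective (mapEdge (α := α) f) := by
  rintro ⟨a, b, c⟩ ⟨a', b', c'⟩ h
  simp only [mapEdge, Prod.mk.injEq] at h
  rw [hf h.1, h.2.1, hf h.2.2]

/-- `Rep A E s t x`: the isomorphism class `x` is the class of the graph with vertex set `A ⊆ W`,
edges `E`, source `s` and target `t`. Several graphs that overlap inside one `W` can be compared
and recombined without handling isomorphisms. -/
def Rep (A : Set W) (E : Multiset (W × α × W)) (s t : W) (x : GraphClass α) : Prop :=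
  ∃ G : Graph α, Quotient.mk (Graph.setoid α) G = x ∧ ∃ f : G.V → W, Function.Injective f ∧
    Set.range f = A ∧ G.E.map (mapEdge f) = E ∧ f G.src = s ∧ f G.tgt = t

theorem rep_mk_iff {G : Graph α} :
    Rep A E s t (Quotient.mk (Graph.setoid α) G) ↔ ∃ f : G.V → W, Function.Injective f ∧
      Set.range f = A ∧ G.E.map (mapEdge f) = E ∧ f G.src = s ∧ f G.tgt = t := by
  constructor
  · rintro ⟨H, hH, f, hf, hA, hE, hs, ht⟩
    obtain ⟨e, eE, es, et⟩ := Graph.Iso.symm (Quotient.exact hH)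
    refine ⟨f ∘ e, hf.comp e.injective, ?_, ?_, ?_, ?_⟩
    · rw [Set.range_comp, e.surjective.range_eq, Set.image_univ, hA]
    · rw [← map_mapEdge_mapEdge, eE, hE]
    · simp [es, hs]
    · simp [et, ht]
  · exact fun h => ⟨G, rfl, h⟩

theorem Rep.exists_self (x : GraphClass α) :
    ∃ (W : Type) (A : Set W) (E : Multiset (W × α × W)) (s t : W), Rep A E s t x := by
  induction x using Quotient.inductionOn with
  | h G => exact ⟨G.V, _, _, _, _, rep_mk_iff.2 ⟨id, Function.injective_id, rfl, rfl, rfl, rfl⟩⟩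

/-- Two realizations of the same class correspond by an injective map of vertices. -/
theorem Rep.exists_map {A' : Set W'} {E' : Multiset (W' × α × W')} {s' t' : W'}
    (h : Rep A E s t x) (h' : Rep A' E' s' t' x) :
    ∃ φ : W → W', Set.InjOn φ A ∧ φ '' A = A' ∧ E.map (mapEdge φ) = E' ∧ φ s = s' ∧ φ t = t' := by
  obtain ⟨G, rfl, f, hf, rfl, rfl, rfl, rfl⟩ := h
  obtain ⟨g, hg, rfl, rfl, rfl, rfl⟩ := rep_mk_iff.1 h'
  have : Nonempty W' := ⟨g G.src⟩
  refine ⟨Function.extend f g fun _ => Classical.arbitrary _, ?_, ?_, ?_, ?_, ?_⟩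
  · rintro _ ⟨a, rfl⟩ _ ⟨b, rfl⟩ hab
    rw [hf.extend_apply, hf.extend_apply] at hab
    rw [hg hab]
  · rw [← Set.range_comp]
    congr 1
    funext a
    exact hf.extend_apply _ _ _
  · rw [map_mapEdge_mapEdge]
    congr 2
    funext a
    exact hf.extend_apply _ _ _
  · exact hf.extend_apply _ _ _
  · exact hf.extend_apply _ _ _

theorem Rep.unique (h : Rep A E s t x) (h' : Rep A E s t y) : x = y := by
  obtain ⟨G, rfl, f, hf, hA, hE, hs, ht⟩ := h
  obtain ⟨H, rfl, g, hg, gA, gE, gs, gt⟩ := h'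
  let e : G.V ≃ H.V := (Equiv.ofInjective f hf).trans
    ((Equiv.setCongr (hA.trans gA.symm)).trans (Equiv.ofInjective g hg).symm)
  have he : ∀ v, g (e v) = f v := fun v => by
    have := Equiv.apply_ofInjective_symm hg (Equiv.setCongr (hA.trans gA.symm)
      (Equiv.ofInjective f hf v))
    exact this
  refine Quotient.sound ⟨e, ?_, hg ?_, hg ?_⟩
  · apply Multiset.map_injective (mapEdge_injective hg)
    rw [map_mapEdge_mapEdge, gE, ← hE]
    congr 2
    funext v
    exact he v
  · rw [he, hs, gs]
  · rw [he, ht, gt]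

theorem Rep.src_mem (h : Rep A E s t x) : s ∈ A := by
  obtain ⟨G, -, f, -, rfl, -, rfl, -⟩ := h
  exact ⟨_, rfl⟩

theorem Rep.tgt_mem (h : Rep A E s t x) : t ∈ A := by
  obtain ⟨G, -, f, -, rfl, -, -, rfl⟩ := h
  exact ⟨_, rfl⟩

theorem Rep.src_ne_tgt (h : Rep A E s t x) : s ≠ t := by
  obtain ⟨G, -, f, hf, -, -, rfl, rfl⟩ := h
  exact hf.ne G.src_ne_tgt

theorem Rep.finite (h : Rep A E s t x) : A.Finite := by
  obtain ⟨G, -, f, hf, rfl, -, -, -⟩ := h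
  have := G.finite_V
  exact Set.finite_range f

theorem Rep.edge_mem (h : Rep A E s t x) {e : W × α × W} (he : e ∈ E) : e.1 ∈ A ∧ e.2.2 ∈ A := by
  obtain ⟨G, -, f, -, rfl, rfl, -, -⟩ := h
  obtain ⟨e, -, rfl⟩ := Multiset.mem_map.1 he
  exact ⟨⟨_, rfl⟩, ⟨_, rfl⟩⟩

theorem Rep.exists_of_finite (hA : A.Finite) (hs : s ∈ A) (ht : t ∈ A) (hst : s ≠ t)
    (hE : ∀ e ∈ E, e.1 ∈ A ∧ e.2.2 ∈ A) : ∃ x : GraphClass α, Rep A E s t x := by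
  let G : Graph α :=
    { V := A
      finite_V := hA
      E := E.pmap (fun e h => (⟨e.1, h.1⟩, e.2.1, ⟨e.2.2, h.2⟩)) hE
      src := ⟨s, hs⟩
      tgt := ⟨t, ht⟩
      src_ne_tgt := fun h => hst (congrArg Subtype.val h) }
  refine ⟨Quotient.mk _ G, G, rfl, Subtype.val, Subtype.val_injective, Subtype.range_val, ?_,
    rfl, rfl⟩
  change (E.pmap _ hE).map _ = E
  rw [Multiset.map_pmap]
  exact (Multiset.pmap_eq_map _ id _ _).trans (Multiset.map_id _)

theorem Graph.serEmb_injective (G H : Graph α) : Function.Injective (Graph.serEmb G H) := by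
  intro a b h
  unfold Graph.serEmb at h
  split_ifs at h with h1 h2 h2
  · rw [h1, h2]
  · simpa using h

theorem Graph.parEmb_injective (G H : Graph α) : Function.Injective (Graph.parEmb G H) := by
  intro a b h
  have hne := G.src_ne_tgt
  unfold Graph.parEmb at h
  split_ifs at h with h1 h2 h3 h4 h5 h6 <;> simp_all

theorem Graph.map_edges_ser (G H : Graph α) (k : (Graph.ser G H).V → W) :
    (Graph.ser G H).E.map (mapEdge k) = G.E.map (mapEdge fun v => k (Sum.inl v)) +
      H.E.map (mapEdge fun v => k (Graph.serEmb G H v)) :=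
  (Multiset.map_add _ _ _).trans
    (congrArg₂ _ (Multiset.map_map _ _ _) (Multiset.map_map _ _ _))

theorem Graph.map_edges_par (G H : Graph α) (k : (Graph.par G H).V → W) :
    (Graph.par G H).E.map (mapEdge k) = G.E.map (mapEdge fun v => k (Sum.inl v)) +
      H.E.map (mapEdge fun v => k (Graph.parEmb G H v)) :=
  (Multiset.map_add _ _ _).trans
    (congrArg₂ _ (Multiset.map_map _ _ _) (Multiset.map_map _ _ _))

theorem Rep.ser (h : Rep A E s c x) (h' : Rep B F c t y) (hAB : A ∩ B = {c}) :
    Rep (A ∪ B) (E + F) s t (GraphClass.ser x y) := by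
  obtain ⟨G, rfl, f, hf, rfl, rfl, rfl, hc⟩ := h
  obtain ⟨H, rfl, g, hg, rfl, rfl, hc', rfl⟩ := h'
  let k : (Graph.ser G H).V → W := Sum.elim f fun v => g v.1
  have hk : ∀ v, k (Graph.serEmb G H v) = g v := by
    intro v
    unfold Graph.serEmb
    split_ifs with h1
    · simp [k, h1, hc, hc']
    · rfl
  refine ⟨Graph.ser G H, rfl, k, ?_, ?_, ?_, rfl, rfl⟩
  · have hne : ∀ a (b : {v : H.V // v ≠ H.src}), f a ≠ g b.1 := by
      intro a b hab
      have : f a ∈ Set.range f ∩ Set.range g := ⟨⟨a, rfl⟩, ⟨b.1, hab.symm⟩⟩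
      rw [hAB] at this
      exact b.2 (hg (by rw [← hab, hc', Set.mem_singleton_iff.1 this]))
    exact Function.Injective.sumElim hf (hg.comp Subtype.val_injective) hne
  · refine (Set.Sum.elim_range f _).trans ?_
    refine Set.Subset.antisymm (Set.union_subset_union_right _ ?_)
      (Set.union_subset Set.subset_union_left ?_)
    · rintro _ ⟨v, rfl⟩; exact ⟨v.1, rfl⟩
    · rintro _ ⟨v, rfl⟩
      by_cases hv : v = H.src
      · exact Or.inl ⟨G.tgt, by rw [hv, hc, hc']⟩
      · exact Or.inr ⟨⟨v, hv⟩, rfl⟩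
  · rw [Graph.map_edges_ser, funext hk]
    rfl

theorem Rep.par (h : Rep A E s t x) (h' : Rep B F s t y) (hAB : A ∩ B = {s, t}) :
    Rep (A ∪ B) (E + F) s t (GraphClass.par x y) := by
  obtain ⟨G, rfl, f, hf, rfl, rfl, hs, ht⟩ := h
  obtain ⟨H, rfl, g, hg, rfl, rfl, hs', ht'⟩ := h'
  let k : (Graph.par G H).V → W := Sum.elim f fun v => g v.1
  have hk : ∀ v, k (Graph.parEmb G H v) = g v := by
    intro v
    unfold Graph.parEmb
    split_ifs with h1 h2
    · simp [k, h1, hs, hs']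
    · simp [k, h2, ht, ht']
    · rfl
  refine ⟨Graph.par G H, rfl, k, ?_, ?_, ?_, hs, ht⟩
  · have hne : ∀ a (b : {v : H.V // v ≠ H.src ∧ v ≠ H.tgt}), f a ≠ g b.1 := by
      intro a b hab
      have : f a ∈ Set.range f ∩ Set.range g := ⟨⟨a, rfl⟩, ⟨b.1, hab.symm⟩⟩
      rw [hAB] at this
      rcases this with h1 | h1
      · exact b.2.1 (hg (by rw [← hab, hs', h1]))
      · exact b.2.2 (hg (by rw [← hab, ht', h1]))
    exact Function.Injective.sumElim hf (hg.comp Subtype.val_injective) hne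
  · refine (Set.Sum.elim_range f _).trans ?_
    refine Set.Subset.antisymm (Set.union_subset_union_right _ ?_)
      (Set.union_subset Set.subset_union_left ?_)
    · rintro _ ⟨v, rfl⟩; exact ⟨v.1, rfl⟩
    · rintro _ ⟨v, rfl⟩
      by_cases hv : v = H.src
      · exact Or.inl ⟨G.src, by rw [hv, hs, hs']⟩
      · by_cases hv' : v = H.tgt
        · exact Or.inl ⟨G.tgt, by rw [hv', ht, ht']⟩
        · exact Or.inr ⟨⟨v, hv, hv'⟩, rfl⟩
  · rw [Graph.map_edges_par, funext hk]
    rfl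

/-- A realization of a serial composition splits into realizations of the factors. -/
theorem Rep.ser_inv (h : Rep A E s t (GraphClass.ser x y)) :
    ∃ (c : W) (A₁ A₂ : Set W) (E₁ E₂ : Multiset (W × α × W)), Rep A₁ E₁ s c x ∧
      Rep A₂ E₂ c t y ∧ A₁ ∪ A₂ = A ∧ A₁ ∩ A₂ = {c} ∧ E₁ + E₂ = E := by
  induction x using Quotient.inductionOn with | h G =>
  induction y using Quotient.inductionOn with | h H =>
  obtain ⟨k, hk, rfl, rfl, rfl, rfl⟩ := (rep_mk_iff (G := Graph.ser G H)).1 h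
  have hinl : Function.Injective (Sum.inl : G.V → (Graph.ser G H).V) := Sum.inl_injective
  have hsrc : Graph.serEmb G H H.src = Sum.inl G.tgt := by simp [Graph.serEmb]
  have hinr : ∀ v : {v : H.V // v ≠ H.src}, Graph.serEmb G H v.1 = Sum.inr v := fun v => by
    simp [Graph.serEmb, v.2]
  refine ⟨k (Sum.inl G.tgt), _, _, _, _,
    rep_mk_iff.2 ⟨fun v => k (Sum.inl v), hk.comp hinl, rfl, rfl, rfl, rfl⟩,
    rep_mk_iff.2 ⟨fun v => k (Graph.serEmb G H v), hk.comp (Graph.serEmb_injective G H), rfl, rfl,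
      congrArg k hsrc, congrArg k (hinr ⟨H.tgt, H.src_ne_tgt.symm⟩)⟩,
    ?_, ?_, (Graph.map_edges_ser G H k).symm⟩
  · refine Set.Subset.antisymm ?_ ?_
    · rintro _ (⟨v, rfl⟩ | ⟨v, rfl⟩) <;> exact ⟨_, rfl⟩
    · rintro _ ⟨v | v, rfl⟩
      · exact Or.inl ⟨v, rfl⟩
      · exact Or.inr ⟨v.1, congrArg k (hinr v)⟩
  · refine Set.Subset.antisymm ?_ ?_
    · rintro _ ⟨⟨v, rfl⟩, ⟨w, hw⟩⟩
      have h1 : Graph.serEmb G H w = Sum.inl v := hk hw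
      unfold Graph.serEmb at h1
      split_ifs at h1 with h2
      exact congrArg k h1.symm
    · rintro _ rfl
      exact ⟨⟨G.tgt, rfl⟩, ⟨H.src, congrArg k hsrc⟩⟩

/-- A realization of a parallel composition splits into realizations of the components. -/
theorem Rep.par_inv (h : Rep A E s t (GraphClass.par x y)) :
    ∃ (A₁ A₂ : Set W) (E₁ E₂ : Multiset (W × α × W)), Rep A₁ E₁ s t x ∧
      Rep A₂ E₂ s t y ∧ A₁ ∪ A₂ = A ∧ A₁ ∩ A₂ = {s, t} ∧ E₁ + E₂ = E := by
  induction x using Quotient.inductionOn with | h G =>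
  induction y using Quotient.inductionOn with | h H =>
  obtain ⟨k, hk, rfl, rfl, rfl, rfl⟩ := (rep_mk_iff (G := Graph.par G H)).1 h
  have hinl : Function.Injective (Sum.inl : G.V → (Graph.par G H).V) := Sum.inl_injective
  have hsrc : Graph.parEmb G H H.src = Sum.inl G.src := by simp [Graph.parEmb]
  have htgt : Graph.parEmb G H H.tgt = Sum.inl G.tgt := by
    simp [Graph.parEmb, H.src_ne_tgt.symm]
  have hinr : ∀ v : {v : H.V // v ≠ H.src ∧ v ≠ H.tgt},
      Graph.parEmb G H v.1 = Sum.inr v := fun v => by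
    simp [Graph.parEmb, v.2]
  refine ⟨_, _, _, _,
    rep_mk_iff.2 ⟨fun v => k (Sum.inl v), hk.comp hinl, rfl, rfl, rfl, rfl⟩,
    rep_mk_iff.2 ⟨fun v => k (Graph.parEmb G H v), hk.comp (Graph.parEmb_injective G H), rfl, rfl,
      congrArg k hsrc, congrArg k htgt⟩,
    ?_, ?_, (Graph.map_edges_par G H k).symm⟩
  · refine Set.Subset.antisymm ?_ ?_
    · rintro _ (⟨v, rfl⟩ | ⟨v, rfl⟩) <;> exact ⟨_, rfl⟩
    · rintro _ ⟨v | v, rfl⟩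
      · exact Or.inl ⟨v, rfl⟩
      · exact Or.inr ⟨v.1, congrArg k (hinr v)⟩
  · refine Set.Subset.antisymm ?_ ?_
    · rintro _ ⟨⟨v, rfl⟩, ⟨w, hw⟩⟩
      have h1 : Graph.parEmb G H w = Sum.inl v := hk hw
      unfold Graph.parEmb at h1
      split_ifs at h1 with h2 h3
      · exact Or.inl (congrArg k h1.symm)
      · exact Or.inr (congrArg k h1.symm)
    · rintro _ (rfl | rfl)
      · exact ⟨⟨G.src, rfl⟩, ⟨H.src, congrArg k hsrc⟩⟩
      · exact ⟨⟨G.tgt, rfl⟩, ⟨H.tgt, congrArg k htgt⟩⟩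

theorem rep_bridge_iff {a : α} :
    Rep A E s t (GraphClass.bridge a) ↔ s ≠ t ∧ A = {s, t} ∧ E = {(s, a, t)} := by
  constructor
  · intro h
    refine ⟨h.src_ne_tgt, ?_⟩
    obtain ⟨f, hf, rfl, rfl, rfl, rfl⟩ := rep_mk_iff.1 h
    refine ⟨?_, by simp [Graph.bridge, mapEdge]⟩
    ext v
    simp only [Set.mem_range, Set.mem_insert_iff, Set.mem_singleton_iff]
    exact (Bool.exists_bool (p := fun b : Bool => f b = v)).trans
      (or_congr eq_comm eq_comm)
  · rintro ⟨hne, rfl, rfl⟩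
    refine rep_mk_iff.2 ⟨fun b => bif b then t else s, ?_, ?_, ?_, rfl, rfl⟩
    · exact Bool.injective_iff.2 hne
    · ext v
      simp only [Set.mem_range, Set.mem_insert_iff, Set.mem_singleton_iff]
      exact (Bool.exists_bool (p := fun b : Bool => (bif b then t else s) = v)).trans
        (or_congr eq_comm eq_comm)
    · simp [Graph.bridge, mapEdge]

end Realization

/-! ### Parallel composition as a commutative monoid with refinement -/

namespace GraphClass

variable {α : Type*}

/-- The graph with no vertices besides source and target and no edges; it is neutral for parallel
composition and is not an SP-graph. -/
def unit : GraphClass α := Quotient.mk (Graph.setoid α)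
  { V := Bool, finite_V := inferInstance, E := 0, src := false, tgt := true,
    src_ne_tgt := by decide }

theorem rep_unit_iff {W : Type} {A : Set W} {E : Multiset (W × α × W)} {s t : W} :
    Rep A E s t (unit : GraphClass α) ↔ s ≠ t ∧ A = {s, t} ∧ E = 0 := by
  constructor
  · intro h
    refine ⟨h.src_ne_tgt, ?_⟩
    obtain ⟨f, hf, rfl, rfl, rfl, rfl⟩ := rep_mk_iff.1 h
    refine ⟨?_, by simp⟩
    ext v
    simp only [Set.mem_range, Bool.exists_bool, Set.mem_insert_iff, Set.mem_singleton_iff]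
    tauto
  · rintro ⟨hne, rfl, rfl⟩
    refine rep_mk_iff.2 ⟨fun b => bif b then t else s, ?_, ?_, by simp, rfl, rfl⟩
    · intro a b
      cases a <;> cases b <;> simp [hne, hne.symm]
    · ext v
      simp only [Set.mem_range, Bool.exists_bool, Set.mem_insert_iff, Set.mem_singleton_iff,
        cond_false, cond_true]
      tauto

theorem par_comm (x y : GraphClass α) : par x y = par y x := by
  obtain ⟨W, A, E, s, t, h⟩ := Rep.exists_self (par x y)
  obtain ⟨A₁, A₂, E₁, E₂, h1, h2, rfl, hi, rfl⟩ := h.par_inv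
  have h3 := h2.par h1 (by rw [Set.inter_comm, hi])
  rw [Set.union_comm, add_comm] at h3
  exact h.unique h3

theorem par_assoc (x y z : GraphClass α) : par (par x y) z = par x (par y z) := by
  obtain ⟨W, A, E, s, t, h⟩ := Rep.exists_self (par (par x y) z)
  obtain ⟨A₁₂, A₃, E₁₂, E₃, h12, h3, rfl, hi, rfl⟩ := h.par_inv
  obtain ⟨A₁, A₂, E₁, E₂, h1, h2, rfl, hi', rfl⟩ := h12.par_inv
  have m := h1.src_mem
  have m' := h1.tgt_mem
  simp only [Set.ext_iff, Set.mem_inter_iff, Set.mem_union, Set.mem_insert_iff,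
    Set.mem_singleton_iff] at hi hi'
  have h4 := h1.par (h2.par h3 (by ext v; simp; grind)) (by ext v; simp; grind)
  rw [← Set.union_assoc, ← add_assoc] at h4
  exact h.unique h4

theorem ser_assoc (x y z : GraphClass α) : ser (ser x y) z = ser x (ser y z) := by
  obtain ⟨W, A, E, s, t, h⟩ := Rep.exists_self (ser (ser x y) z)
  obtain ⟨c, A₁₂, A₃, E₁₂, E₃, h12, h3, rfl, hi, rfl⟩ := h.ser_inv
  obtain ⟨d, A₁, A₂, E₁, E₂, h1, h2, rfl, hi', rfl⟩ := h12.ser_inv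
  have m := h2.tgt_mem
  have m' := h2.src_ne_tgt
  simp only [Set.ext_iff, Set.mem_inter_iff, Set.mem_union,
    Set.mem_singleton_iff] at hi hi'
  have h4 := h1.ser (h2.ser h3 (by ext v; simp; grind)) (by ext v; simp; grind)
  rw [← Set.union_assoc, ← add_assoc] at h4
  exact h.unique h4

theorem unit_par (x : GraphClass α) : par unit x = x := by
  obtain ⟨W, A, E, s, t, h⟩ := Rep.exists_self (par unit x)
  obtain ⟨A₁, A₂, E₁, E₂, h1, h2, rfl, hi, rfl⟩ := h.par_inv
  obtain ⟨-, rfl, rfl⟩ := rep_unit_iff.1 h1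
  rw [zero_add, Set.union_eq_self_of_subset_left (by rw [← hi]; exact Set.inter_subset_right)] at h
  exact h.unique h2

/-- Graphs up to isomorphism, with parallel composition as multiplication. -/
noncomputable instance instCommMonoid : CommMonoid (GraphClass α) where
  mul := par
  one := unit
  mul_assoc := par_assoc
  mul_comm := par_comm
  one_mul := unit_par
  mul_one x := (par_comm x unit).trans (unit_par x)

theorem mul_def (x y : GraphClass α) : x * y = par x y := rfl

/-- Riesz refinement for parallel composition: two decompositions of a graph into two parts have
a common refinement, cut out by the intersections of the parts. -/
theorem exists_refinement {x y z w : GraphClass α} (h : x * y = z * w) :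
    ∃ a b c d : GraphClass α, x = a * b ∧ y = c * d ∧ z = a * c ∧ w = b * d := by
  classical
  obtain ⟨W, A, E, s, t, h0⟩ := Rep.exists_self (x * y)
  obtain ⟨X, Y, EX, EY, hX, hY, hXYA, hXY, hE⟩ := h0.par_inv
  rw [h] at h0
  obtain ⟨Z, V, EZ, EV, hZ, hV, hZVA, hZV, hE'⟩ := h0.par_inv
  have hA := hXYA.trans hZVA.symm
  have hEE := hE.trans hE'.symm
  clear h0 h hXYA hZVA hE hE'
  have key : ∀ {P Q : Set W} {EP EQ F : Multiset (W × α × W)} {p q : GraphClass α},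
      Rep P EP s t p → Rep Q EQ s t q → F ≤ EP → F ≤ EQ → ∃ r, Rep (P ∩ Q) F s t r := by
    intro P Q EP EQ F p q hp hq h1 h2
    refine Rep.exists_of_finite (hp.finite.subset Set.inter_subset_left)
      ⟨hp.src_mem, hq.src_mem⟩ ⟨hp.tgt_mem, hq.tgt_mem⟩ hp.src_ne_tgt fun e he => ?_
    have h3 := hp.edge_mem (Multiset.mem_of_le h1 he)
    have h4 := hq.edge_mem (Multiset.mem_of_le h2 he)
    exact ⟨⟨h3.1, h4.1⟩, ⟨h3.2, h4.2⟩⟩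
  have hc : ∀ e, EX.count e + EY.count e = EZ.count e + EV.count e := fun e => by
    rw [← Multiset.count_add, hEE, Multiset.count_add]
  -- the multisets of edges `EX + EY = EZ + EV` have a common refinement as well
  obtain ⟨a, ha⟩ := key (F := EX ∩ EZ) hX hZ (Multiset.inter_le_left) (Multiset.inter_le_right)
  obtain ⟨b, hb⟩ := key (F := EX - EZ) hX hV (tsub_le_self) (by
    rw [Multiset.le_iff_count]; intro e; rw [Multiset.count_sub]; have := hc e; omega)
  obtain ⟨c, hcc⟩ := key (F := EZ - EX) hY hZ (by
    rw [Multiset.le_iff_count]; intro e; rw [Multiset.count_sub]; have := hc e; omega) tsub_le_self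
  obtain ⟨d, hd⟩ := key (F := EY - (EZ - EX)) hY hV tsub_le_self (by
    rw [Multiset.le_iff_count]; intro e; rw [Multiset.count_sub, Multiset.count_sub]
    have := hc e; omega)
  have m1 := hX.src_mem
  have m2 := hX.tgt_mem
  have m3 := hY.src_mem
  have m4 := hY.tgt_mem
  have m5 := hZ.src_mem
  have m6 := hZ.tgt_mem
  have m7 := hV.src_mem
  have m8 := hV.tgt_mem
  simp only [Set.ext_iff, Set.mem_inter_iff, Set.mem_union, Set.mem_insert_iff,
    Set.mem_singleton_iff] at hA hXY hZV
  refine ⟨a, b, c, d, hX.unique ?_, hY.unique ?_, hZ.unique ?_, hV.unique ?_⟩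
  · change Rep _ _ _ _ (par a b)
    convert ha.par hb ?_ using 1
    · ext v; simp; grind
    · ext e; simp only [Multiset.count_add, Multiset.count_sub, Multiset.count_inter]; omega
    · ext v; simp; grind
  · change Rep _ _ _ _ (par c d)
    convert hcc.par hd ?_ using 1
    · ext v; simp; grind
    · ext e; have := hc e; simp only [Multiset.count_add, Multiset.count_sub]; omega
    · ext v; simp; grind
  · change Rep _ _ _ _ (par a c)
    convert ha.par hcc ?_ using 1
    · ext v; simp; grind
    · ext e; simp only [Multiset.count_add, Multiset.count_sub, Multiset.count_inter]; omega
    · ext v; simp; grind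
  · change Rep _ _ _ _ (par b d)
    convert hb.par hd ?_ using 1
    · ext v; simp; grind
    · ext e; have := hc e; simp only [Multiset.count_add, Multiset.count_sub]; omega
    · ext v; simp; grind

end GraphClass

/-! ### Graphs all of whose vertices lie on paths from source to target -/

section Flow

variable {α : Type*} {W W' : Type} {A B : Set W} {E F : Multiset (W × α × W)} {s t c : W}
  {x y z : GraphClass α}

/-- There is a directed path from `u` to `v` with edges from `E`. -/
def Reach (E : Multiset (W × α × W)) : W → W → Prop :=
  Relation.ReflTransGen fun u v => ∃ a, (u, a, v) ∈ E

theorem Reach.mono {u v : W} (h : Reach E u v) (hEF : ∀ e ∈ E, e ∈ F) : Reach F u v :=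
  Relation.ReflTransGen.mono (fun _ _ ⟨a, ha⟩ => ⟨a, hEF _ ha⟩) _ _ h

theorem Reach.map {u v : W} (φ : W → W') (h : Reach E u v) :
    Reach (E.map (mapEdge φ)) (φ u) (φ v) :=
  Relation.ReflTransGen.lift φ
    (fun _ _ ⟨a, ha⟩ => ⟨a, Multiset.mem_map_of_mem (mapEdge φ) ha⟩) _ _ h

theorem Reach.single {e : W × α × W} (he : e ∈ E) : Reach E e.1 e.2.2 :=
  Relation.ReflTransGen.single ⟨e.2.1, he⟩

/-- Sets of vertices that are closed under edges are closed under paths. -/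
theorem Reach.mem_of_closed {U : Set W} {u v : W} (h : Reach E u v)
    (hU : ∀ e ∈ E, e.1 ∈ U → e.2.2 ∈ U) (hu : u ∈ U) : v ∈ U := by
  induction h with
  | refl => exact hu
  | tail _ h ih => obtain ⟨a, ha⟩ := h; exact hU _ ha ih

theorem Reach.mem_of_closed_back {U : Set W} {u v : W} (h : Reach E u v)
    (hU : ∀ e ∈ E, e.2.2 ∈ U → e.1 ∈ U) (hv : v ∈ U) : u ∈ U := by
  induction h using Relation.ReflTransGen.head_induction_on with
  | refl => exact hv
  | head h _ ih => obtain ⟨a, ha⟩ := h; exact hU _ ha ih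

theorem Reach.eq_of_no_out {u v : W} (h : Reach E u v) (hu : ∀ e ∈ E, e.1 ≠ u) : v = u :=
  h.mem_of_closed (U := {u}) (fun e he h => absurd h (hu e he)) rfl

theorem Reach.eq_of_no_in {u v : W} (h : Reach E u v) (hv : ∀ e ∈ E, e.2.2 ≠ v) : u = v :=
  h.mem_of_closed_back (U := {v}) (fun e he h => absurd h (hv e he)) rfl

/-- No edge leaves the target or enters the source, and every vertex lies on a directed path from
the source to the target. -/
structure FlowOn (A : Set W) (E : Multiset (W × α × W)) (s t : W) : Prop where
  no_out : ∀ e ∈ E, e.1 ≠ t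
  no_in : ∀ e ∈ E, e.2.2 ≠ s
  reach_src : ∀ v ∈ A, Reach E s v
  reach_tgt : ∀ v ∈ A, Reach E v t

/-- The property `FlowOn` for isomorphism classes; all SP-graphs have it. -/
def IsFlow (x : GraphClass α) : Prop :=
  ∀ ⦃W : Type⦄ ⦃A : Set W⦄ ⦃E : Multiset (W × α × W)⦄ ⦃s t : W⦄, Rep A E s t x → FlowOn A E s t

theorem FlowOn.isFlow (h : FlowOn A E s t) (hx : Rep A E s t x) : IsFlow x := by
  intro W' A' E' s' t' hx'
  obtain ⟨φ, hφ, rfl, rfl, rfl, rfl⟩ := hx.exists_map hx'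
  refine ⟨?_, ?_, ?_, ?_⟩
  · intro e he
    obtain ⟨e, he', rfl⟩ := Multiset.mem_map.1 he
    exact fun heq => h.no_out e he' (hφ (hx.edge_mem he').1 hx.tgt_mem heq)
  · intro e he
    obtain ⟨e, he', rfl⟩ := Multiset.mem_map.1 he
    exact fun heq => h.no_in e he' (hφ (hx.edge_mem he').2 hx.src_mem heq)
  · rintro _ ⟨v, hv, rfl⟩
    exact (h.reach_src v hv).map φ
  · rintro _ ⟨v, hv, rfl⟩
    exact (h.reach_tgt v hv).map φ

theorem isFlow_bridge (a : α) : IsFlow (GraphClass.bridge a) := by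
  intro W A E s t h
  obtain ⟨hne, rfl, rfl⟩ := rep_bridge_iff.1 h
  have h1 : Reach ({(s, a, t)} : Multiset (W × α × W)) s t :=
    Reach.single (e := (s, a, t)) (by simp)
  refine ⟨by simp [hne], by simp [hne.symm], ?_, ?_⟩
  · rintro v (rfl | rfl)
    exacts [Relation.ReflTransGen.refl, h1]
  · rintro v (rfl | rfl)
    exacts [h1, Relation.ReflTransGen.refl]

theorem IsFlow.ser (hx : IsFlow x) (hy : IsFlow y) : IsFlow (GraphClass.ser x y) := by
  intro W A E s t h
  obtain ⟨c, A₁, A₂, E₁, E₂, h1, h2, rfl, hi, rfl⟩ := h.ser_inv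
  have f1 := hx h1
  have f2 := hy h2
  have m1 : ∀ e ∈ E₁, e ∈ E₁ + E₂ := fun e he => Multiset.mem_add.2 (Or.inl he)
  have m2 : ∀ e ∈ E₂, e ∈ E₁ + E₂ := fun e he => Multiset.mem_add.2 (Or.inr he)
  have hc : ∀ v, v ∈ A₁ → v ∈ A₂ → v = c := fun v h h' => by
    have : v ∈ A₁ ∩ A₂ := ⟨h, h'⟩
    rwa [hi] at this
  refine ⟨?_, ?_, ?_, ?_⟩
  · intro e he heq
    rcases Multiset.mem_add.1 he with he | he
    · exact h2.src_ne_tgt (hc t (heq ▸ (h1.edge_mem he).1) h2.tgt_mem).symm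
    · exact f2.no_out e he heq
  · intro e he heq
    rcases Multiset.mem_add.1 he with he | he
    · exact f1.no_in e he heq
    · exact h1.src_ne_tgt (hc s h1.src_mem (heq ▸ (h2.edge_mem he).2))
  · rintro v (hv | hv)
    · exact (f1.reach_src v hv).mono m1
    · exact ((f1.reach_src c h1.tgt_mem).mono m1).trans ((f2.reach_src v hv).mono m2)
  · rintro v (hv | hv)
    · exact ((f1.reach_tgt v hv).mono m1).trans ((f2.reach_tgt c h2.src_mem).mono m2)
    · exact (f2.reach_tgt v hv).mono m2

theorem IsFlow.par (hx : IsFlow x) (hy : IsFlow y) : IsFlow (GraphClass.par x y) := by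
  intro W A E s t h
  obtain ⟨A₁, A₂, E₁, E₂, h1, h2, rfl, hi, rfl⟩ := h.par_inv
  have f1 := hx h1
  have f2 := hy h2
  have m1 : ∀ e ∈ E₁, e ∈ E₁ + E₂ := fun e he => Multiset.mem_add.2 (Or.inl he)
  have m2 : ∀ e ∈ E₂, e ∈ E₁ + E₂ := fun e he => Multiset.mem_add.2 (Or.inr he)
  refine ⟨?_, ?_, ?_, ?_⟩
  · intro e he
    rcases Multiset.mem_add.1 he with he | he
    exacts [f1.no_out e he, f2.no_out e he]
  · intro e he
    rcases Multiset.mem_add.1 he with he | he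
    exacts [f1.no_in e he, f2.no_in e he]
  · rintro v (hv | hv)
    exacts [(f1.reach_src v hv).mono m1, (f2.reach_src v hv).mono m2]
  · rintro v (hv | hv)
    exacts [(f1.reach_tgt v hv).mono m1, (f2.reach_tgt v hv).mono m2]

theorem IsFlow.ne_one (hx : IsFlow x) : x ≠ 1 := by
  rintro rfl
  obtain ⟨W, A, E, s, t, h⟩ := Rep.exists_self (1 : GraphClass α)
  obtain ⟨hne, rfl, rfl⟩ := GraphClass.rep_unit_iff.1 h
  exact hne (((hx h).reach_src t (by simp)).eq_of_no_out (by simp)).symm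

theorem GraphClass.IsSP.isFlow (hx : x.IsSP) : IsFlow x := by
  induction hx with
  | bridge a => exact isFlow_bridge a
  | ser _ _ h1 h2 => exact h1.ser h2
  | par _ _ h1 h2 => exact h1.par h2

end Flow

/-! ### Uniqueness of serial decompositions -/

section Levi

variable {α : Type*} {W : Type} {A₁ A₂ B₁ B₂ : Set W} {E₁ E₂ F₁ F₂ : Multiset (W × α × W)}
  {s t c d : W} {x₁ x₂ y₁ y₂ : GraphClass α}

/-- If the second cut vertex `d` lies in the first factor of the first decomposition, then the
first factor of the second decomposition is contained in that of the first one: the first factor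
of a serial composition is closed under predecessors. -/
theorem Rep.ser_left_le (hx₁ : Rep A₁ E₁ s c x₁) (hx₂ : Rep A₂ E₂ c t x₂)
    (hA : A₁ ∩ A₂ = {c}) (f₂ : IsFlow x₂)
    (hy₁ : Rep B₁ F₁ s d y₁) (g₁ : IsFlow y₁)
    (hE : E₁ + E₂ = F₁ + F₂) (hd : d ∈ A₁) : B₁ ⊆ A₁ ∧ F₁ ≤ E₁ := by
  classical
  have hmem : ∀ e, e ∈ F₁ → e ∈ E₁ ∨ e ∈ E₂ := fun e he => by
    rw [← Multiset.mem_add, hE]; exact Multiset.mem_add.2 (Or.inl he)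
  have h2 : ∀ e ∈ E₂, e.2.2 ∉ A₁ := fun e he h => by
    have : e.2.2 ∈ A₁ ∩ A₂ := ⟨h, (hx₂.edge_mem he).2⟩
    rw [hA] at this
    exact (f₂ hx₂).no_in e he this
  have hsub : B₁ ⊆ A₁ := fun v hv =>
    ((g₁ hy₁).reach_tgt v hv).mem_of_closed_back (fun e he h => by
      rcases hmem e he with h' | h'
      · exact (hx₁.edge_mem h').1
      · exact absurd h (h2 e h')) hd
  refine ⟨hsub, Multiset.le_iff_count.2 fun e => ?_⟩
  have hcount : E₁.count e + E₂.count e = F₁.count e + F₂.count e := by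
    rw [← Multiset.count_add, hE, Multiset.count_add]
  by_cases he : e ∈ E₂
  · have : e ∉ F₁ := fun h => h2 e he (hsub (hy₁.edge_mem h).2)
    rw [Multiset.count_eq_zero.2 this]
    exact Nat.zero_le _
  · rw [Multiset.count_eq_zero.2 he] at hcount
    omega

/-- The mirror image of `Rep.ser_left_le`. -/
theorem Rep.ser_right_le (hx₁ : Rep A₁ E₁ s c x₁) (hx₂ : Rep A₂ E₂ c t x₂)
    (hA : A₁ ∩ A₂ = {c}) (f₁ : IsFlow x₁)
    (hy₂ : Rep B₂ F₂ d t y₂) (g₂ : IsFlow y₂)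
    (hE : E₁ + E₂ = F₁ + F₂) (hd : d ∈ A₂) : B₂ ⊆ A₂ ∧ F₂ ≤ E₂ := by
  classical
  have hmem : ∀ e, e ∈ F₂ → e ∈ E₁ ∨ e ∈ E₂ := fun e he => by
    rw [← Multiset.mem_add, hE]; exact Multiset.mem_add.2 (Or.inr he)
  have h2 : ∀ e ∈ E₁, e.1 ∉ A₂ := fun e he h => by
    have : e.1 ∈ A₁ ∩ A₂ := ⟨(hx₁.edge_mem he).1, h⟩
    rw [hA] at this
    exact (f₁ hx₁).no_out e he this
  have hsub : B₂ ⊆ A₂ := fun v hv =>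
    ((g₂ hy₂).reach_src v hv).mem_of_closed (fun e he h => by
      rcases hmem e he with h' | h'
      · exact absurd h (h2 e h')
      · exact (hx₂.edge_mem h').2) hd
  refine ⟨hsub, Multiset.le_iff_count.2 fun e => ?_⟩
  have hcount : E₁.count e + E₂.count e = F₁.count e + F₂.count e := by
    rw [← Multiset.count_add, hE, Multiset.count_add]
  by_cases he : e ∈ E₁
  · have : e ∉ F₂ := fun h => h2 e he (hsub (hy₂.edge_mem h).1)
    rw [Multiset.count_eq_zero.2 this]
    exact Nat.zero_le _
  · rw [Multiset.count_eq_zero.2 he] at hcount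
    omega

/-- If `d` precedes `c`, the part between the two cut vertices is a factor on its own. -/
theorem Rep.exists_middle (hx₁ : Rep A₁ E₁ s c x₁) (hx₂ : Rep A₂ E₂ c t x₂)
    (hA : A₁ ∩ A₂ = {c}) (f₁ : IsFlow x₁) (f₂ : IsFlow x₂)
    (hy₁ : Rep B₁ F₁ s d y₁) (hy₂ : Rep B₂ F₂ d t y₂)
    (hB : B₁ ∩ B₂ = {d}) (g₁ : IsFlow y₁) (g₂ : IsFlow y₂)
    (hAB : A₁ ∪ A₂ = B₁ ∪ B₂) (hE : E₁ + E₂ = F₁ + F₂) (hd : d ∈ A₁) (hc : c ∈ B₂)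
    (hcd : d ≠ c) :
    ∃ k, IsFlow k ∧ x₁ = GraphClass.ser y₁ k ∧ y₂ = GraphClass.ser k x₂ := by
  classical
  obtain ⟨hs1, hle1⟩ := hx₁.ser_left_le hx₂ hA f₂ hy₁ g₁ hE hd
  obtain ⟨hs2, -⟩ := hy₁.ser_right_le hy₂ hB g₁ hx₂ f₂ hE.symm hc
  obtain ⟨K, rfl⟩ := Multiset.le_iff_exists_add.1 hle1
  have hF₂ : F₂ = K + E₂ := by
    rw [add_assoc] at hE
    exact (add_left_cancel hE).symm
  subst hF₂
  have mK1 : ∀ e ∈ K, e ∈ F₁ + K := fun e he => Multiset.mem_add.2 (Or.inr he)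
  have mK2 : ∀ e ∈ K, e ∈ K + E₂ := fun e he => Multiset.mem_add.2 (Or.inl he)
  have hA' : ∀ v, v ∈ A₁ → v ∈ A₂ → v = c := fun v h h' => by
    have : v ∈ A₁ ∩ A₂ := ⟨h, h'⟩
    rwa [hA] at this
  have hB' : ∀ v, v ∈ B₁ → v ∈ B₂ → v = d := fun v h h' => by
    have : v ∈ B₁ ∩ B₂ := ⟨h, h'⟩
    rwa [hB] at this
  have mem_K : ∀ e ∈ K, e.1 ∈ A₁ ∩ B₂ ∧ e.2.2 ∈ A₁ ∩ B₂ := fun e he =>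
    ⟨⟨(hx₁.edge_mem (mK1 e he)).1, (hy₂.edge_mem (mK2 e he)).1⟩,
      ⟨(hx₁.edge_mem (mK1 e he)).2, (hy₂.edge_mem (mK2 e he)).2⟩⟩
  have hdB := hy₂.src_mem
  have hdB1 := hy₁.tgt_mem
  have hcA := hx₁.tgt_mem
  have hcA2 := hx₂.src_mem
  obtain ⟨k, hk⟩ := Rep.exists_of_finite (s := d) (t := c)
    (hx₁.finite.subset (Set.inter_subset_left (t := B₂))) ⟨hd, hdB⟩ ⟨hcA, hc⟩ hcd mem_K
  have hflow : FlowOn (A₁ ∩ B₂) K d c := by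
    refine ⟨fun e he => (f₁ hx₁).no_out e (mK1 e he), fun e he => (g₂ hy₂).no_in e (mK2 e he),
      ?_, ?_⟩
    · rintro v ⟨hv, hv'⟩
      have h := (g₂ hy₂).reach_src v hv'
      clear hv'
      induction h with
      | refl => exact Relation.ReflTransGen.refl
      | @tail u w _ h ih =>
        obtain ⟨a, ha⟩ := h
        rcases Multiset.mem_add.1 ha with h' | h'
        · exact (ih (mem_K _ h').1.1).tail ⟨a, h'⟩
        · exact absurd (hA' w hv (hx₂.edge_mem h').2) ((f₂ hx₂).no_in _ h')
    · rintro v ⟨hv, hv'⟩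
      have h := (f₁ hx₁).reach_tgt v hv
      clear hv
      induction h using Relation.ReflTransGen.head_induction_on with
      | refl => exact Relation.ReflTransGen.refl
      | @head u w h _ ih =>
        obtain ⟨a, ha⟩ := h
        rcases Multiset.mem_add.1 ha with h' | h'
        · exact absurd (hB' u (hy₁.edge_mem h').1 hv') ((g₁ hy₁).no_out _ h')
        · exact (ih (mem_K _ h').2.2).head ⟨a, h'⟩
  simp only [Set.ext_iff, Set.mem_union] at hAB
  refine ⟨k, hflow.isFlow hk, ?_, ?_⟩
  · have h := hy₁.ser hk (by ext v; simp; grind)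
    have : B₁ ∪ A₁ ∩ B₂ = A₁ := by ext v; simp; grind
    rw [this] at h
    exact hx₁.unique h
  · have h := hk.ser hx₂ (by ext v; simp; grind)
    have : A₁ ∩ B₂ ∪ A₂ = B₂ := by ext v; simp; grind
    rw [this] at h
    exact hy₂.unique h

/-- Levi's lemma for serial composition: of two serial decompositions of a graph, one refines the
other. -/
theorem GraphClass.ser_eq_ser (f₁ : IsFlow x₁) (f₂ : IsFlow x₂) (g₁ : IsFlow y₁) (g₂ : IsFlow y₂)
    (h : GraphClass.ser x₁ x₂ = GraphClass.ser y₁ y₂) :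
    (x₁ = y₁ ∧ x₂ = y₂) ∨
    (∃ k, IsFlow k ∧ x₁ = GraphClass.ser y₁ k ∧ y₂ = GraphClass.ser k x₂) ∨
    (∃ k, IsFlow k ∧ y₁ = GraphClass.ser x₁ k ∧ x₂ = GraphClass.ser k y₂) := by
  obtain ⟨W, A, E, s, t, h0⟩ := Rep.exists_self (GraphClass.ser x₁ x₂)
  obtain ⟨c, A₁, A₂, E₁, E₂, hx₁, hx₂, hAA, hA, hEE⟩ := h0.ser_inv
  rw [h] at h0
  obtain ⟨d, B₁, B₂, F₁, F₂, hy₁, hy₂, hBB, hB, hFF⟩ := h0.ser_inv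
  have hAB := hAA.trans hBB.symm
  have hE := hEE.trans hFF.symm
  have hdm : d ∈ A₁ ∨ d ∈ A₂ := by
    have : d ∈ B₁ ∪ B₂ := Or.inl hy₁.tgt_mem
    rwa [← hAB] at this
  have hcm : c ∈ B₁ ∨ c ∈ B₂ := by
    have : c ∈ A₁ ∪ A₂ := Or.inl hx₁.tgt_mem
    rwa [hAB] at this
  have hA' := hA
  have hB' := hB
  simp only [Set.ext_iff, Set.mem_inter_iff, Set.mem_union, Set.mem_singleton_iff] at hAB hA' hB'
  have case1 : d ∈ A₁ → c ∈ B₁ → x₁ = y₁ ∧ x₂ = y₂ := by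
    intro hd hc
    obtain ⟨s1, l1⟩ := hx₁.ser_left_le hx₂ hA f₂ hy₁ g₁ hE hd
    obtain ⟨s2, l2⟩ := hy₁.ser_left_le hy₂ hB g₂ hx₁ f₁ hE.symm hc
    obtain rfl := Set.Subset.antisymm s1 s2
    obtain rfl := le_antisymm l1 l2
    obtain rfl : d = c := ((g₁ hy₁).reach_tgt c hc).eq_of_no_out (f₁ hx₁).no_out
    obtain rfl := add_left_cancel hE
    obtain rfl : A₂ = B₂ := by ext v; grind
    exact ⟨hx₁.unique hy₁, hx₂.unique hy₂⟩
  have case2 : d ∈ A₂ → c ∈ B₂ → x₁ = y₁ ∧ x₂ = y₂ := by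
    intro hd hc
    obtain ⟨s1, l1⟩ := hx₁.ser_right_le hx₂ hA f₁ hy₂ g₂ hE hd
    obtain ⟨s2, l2⟩ := hy₁.ser_right_le hy₂ hB g₁ hx₂ f₂ hE.symm hc
    obtain rfl := Set.Subset.antisymm s1 s2
    obtain rfl := le_antisymm l1 l2
    obtain rfl : d = c := ((g₂ hy₂).reach_src c hc).eq_of_no_in (f₂ hx₂).no_in
    obtain rfl := add_right_cancel hE
    obtain rfl : A₁ = B₁ := by ext v; grind
    exact ⟨hx₁.unique hy₁, hx₂.unique hy₂⟩
  by_cases hcd : d = c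
  · subst hcd
    exact Or.inl (case1 hx₁.tgt_mem hy₁.tgt_mem)
  · rcases hdm with hd | hd <;> rcases hcm with hc | hc
    · exact Or.inl (case1 hd hc)
    · exact Or.inr (Or.inl (hx₁.exists_middle hx₂ hA f₁ f₂ hy₁ hy₂ hB g₁ g₂
        (hAA.trans hBB.symm) hE hd hc hcd))
    · exact Or.inr (Or.inr (hy₁.exists_middle hy₂ hB g₁ g₂ hx₁ hx₂ hA f₁ f₂
        (hBB.trans hAA.symm) hE.symm hc hd (Ne.symm hcd)))
    · exact Or.inl (case2 hd hc)

end Levi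

/-! ### Irreducibility -/

namespace GraphClass

variable {α : Type*} {x y z w : GraphClass α}

theorem bridge_injective : Function.Injective (bridge : α → GraphClass α) := by
  intro a b h
  obtain ⟨W, A, E, s, t, h0⟩ := Rep.exists_self (bridge a)
  obtain ⟨-, -, rfl⟩ := rep_bridge_iff.1 h0
  rw [h] at h0
  obtain ⟨-, -, h1⟩ := rep_bridge_iff.1 h0
  simpa using h1

/-- The cut vertex of a serial composition is neither the source nor the target. -/
theorem bridge_ne_ser (a : α) : bridge a ≠ ser x y := by
  intro h
  obtain ⟨W, A, E, s, t, h0⟩ := Rep.exists_self (bridge a)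
  obtain ⟨-, rfl, -⟩ := rep_bridge_iff.1 h0
  rw [h] at h0
  obtain ⟨c, A₁, A₂, E₁, E₂, h1, h2, hA, hi, -⟩ := h0.ser_inv
  have hc : c ∈ ({s, t} : Set W) := hA ▸ Or.inl h1.tgt_mem
  rcases hc with rfl | hc
  · exact h1.src_ne_tgt rfl
  · exact h2.src_ne_tgt hc

theorem bridge_irreducible (a : α) (h : bridge a = x * y) : x = 1 ∨ y = 1 := by
  obtain ⟨W, A, E, s, t, h0⟩ := Rep.exists_self (bridge a)
  obtain ⟨hne, rfl, rfl⟩ := rep_bridge_iff.1 h0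
  rw [h] at h0
  obtain ⟨A₁, A₂, E₁, E₂, h1, h2, hA, hi, hE⟩ := h0.par_inv
  have hcard := congrArg Multiset.card hE
  rw [Multiset.card_add, Multiset.card_singleton] at hcard
  have key : ∀ {B : Set W} {F : Multiset (W × α × W)} {z : GraphClass α}, Rep B F s t z →
      B ⊆ {s, t} → F.card = 0 → z = 1 := by
    intro B F z hz hB hF
    rw [Multiset.card_eq_zero] at hF
    subst hF
    obtain rfl : B = {s, t} := Set.Subset.antisymm hB (by
      rintro v (rfl | rfl)
      exacts [hz.src_mem, hz.tgt_mem])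
    exact hz.unique (rep_unit_iff.2 ⟨hne, rfl, rfl⟩)
  rcases Nat.eq_zero_or_pos E₁.card with h' | h'
  · exact Or.inl (key h1 (hA ▸ Set.subset_union_left) h')
  · exact Or.inr (key h2 (hA ▸ Set.subset_union_right) (by omega))

/-- The part of a parallel composition that does not contain the cut vertex is trivial, because
every inner vertex is connected to the cut vertex without visiting the source or the target. -/
theorem ser_irreducible (fx : IsFlow x) (fy : IsFlow y) (h : ser x y = z * w) :
    z = 1 ∨ w = 1 := by
  obtain ⟨W, A, E, s, t, h0⟩ := Rep.exists_self (ser x y)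
  obtain ⟨c, A₁, A₂, E₁, E₂, h1, h2, hA, hi, hE⟩ := h0.ser_inv
  rw [h] at h0
  have f1 := fx h1
  have f2 := fy h2
  have hcs : c ≠ s := h1.src_ne_tgt.symm
  have hct : c ≠ t := h2.src_ne_tgt
  have hc12 : ∀ v, v ∈ A₁ → v ∈ A₂ → v = c := fun v h h' => by
    have : v ∈ A₁ ∩ A₂ := ⟨h, h'⟩
    rwa [hi] at this
  have ht1 : t ∉ A₁ := fun h => hct (hc12 t h h2.tgt_mem).symm
  have hs2 : s ∉ A₂ := fun h => hcs (hc12 s h1.src_mem h).symm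
  have key : ∀ {B C : Set W} {F K : Multiset (W × α × W)} {p q : GraphClass α},
      Rep B F s t p → Rep C K s t q → B ∩ C = {s, t} → B ∪ C = A → F + K = E → c ∈ B →
      q = 1 := by
    intro B C F K p q hp hq hBC hBCA hFK hcB
    have hm : ∀ v, v ∈ B → v ∈ C → v = s ∨ v = t := fun v h h' => by
      have : v ∈ B ∩ C := ⟨h, h'⟩
      rwa [hBC] at this
    have hcC : c ∉ C := fun h => (hm c hcB h).elim hcs hct
    have hmem : ∀ e, e ∈ E₁ ∨ e ∈ E₂ ↔ e ∈ F ∨ e ∈ K := fun e => by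
      rw [← Multiset.mem_add, hE, ← hFK, Multiset.mem_add]
    have hC : C = {s, t} := by
      refine Set.Subset.antisymm (fun v hv => ?_) ?_
      · -- a path between an inner vertex of `C` and the cut vertex `c` would have to leave `C`
        by_contra hst
        rw [Set.mem_insert_iff, Set.mem_singleton_iff, not_or] at hst
        have hvA : v ∈ A₁ ∪ A₂ := by rw [hA, ← hBCA]; exact Or.inr hv
        rcases hvA with hv1 | hv2
        · have := (f1.reach_tgt v hv1).mem_of_closed (U := {v | v ∈ C ∧ v ≠ s ∧ v ≠ t})
            (fun e he h => ?_) ⟨hv, hst⟩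
          · exact hcC this.1
          · rcases (hmem e).1 (Or.inl he) with h' | h'
            · exact absurd (hm e.1 (hp.edge_mem h').1 h.1) (not_or.2 h.2)
            · exact ⟨(hq.edge_mem h').2, f1.no_in e he, fun h => ht1 (h ▸ (h1.edge_mem he).2)⟩
        · have := (f2.reach_src v hv2).mem_of_closed_back (U := {v | v ∈ C ∧ v ≠ s ∧ v ≠ t})
            (fun e he h => ?_) ⟨hv, hst⟩
          · exact hcC this.1
          · rcases (hmem e).1 (Or.inr he) with h' | h'
            · exact absurd (hm e.2.2 (hp.edge_mem h').2 h.1) (not_or.2 h.2)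
            · exact ⟨(hq.edge_mem h').1, fun h => hs2 (h ▸ (h2.edge_mem he).1), f2.no_out e he⟩
      · rintro v (rfl | rfl)
        exacts [hq.src_mem, hq.tgt_mem]
    subst hC
    have hK : K = 0 := by
      refine Multiset.eq_zero_of_forall_notMem fun e he => ?_
      obtain ⟨m1, m2⟩ := hq.edge_mem he
      rcases (hmem e).2 (Or.inr he) with h' | h'
      · rcases m2 with m2 | m2
        · exact f1.no_in e h' m2
        · exact ht1 (m2 ▸ (h1.edge_mem h').2)
      · rcases m1 with m1 | m1
        · exact hs2 (m1 ▸ (h2.edge_mem h').1)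
        · exact f2.no_out e h' m1
    subst hK
    exact hq.unique (rep_unit_iff.2 ⟨hp.src_ne_tgt, rfl, rfl⟩)
  obtain ⟨B, C, F, K, hB, hC, hBC, hi', hFK⟩ := h0.par_inv
  have hc : c ∈ B ∪ C := by rw [hBC, ← hA]; exact Or.inl h1.tgt_mem
  rcases hc with hc | hc
  · exact Or.inr (key hB hC hi' hBC hFK hc)
  · exact Or.inl (key hC hB (by rw [Set.inter_comm, hi']) (by rw [Set.union_comm, hBC])
      (by rw [add_comm, hFK]) hc)

theorem ser_ne_par (fx : IsFlow x) (fy : IsFlow y) (fz : IsFlow z) (fw : IsFlow w) :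
    ser x y ≠ par z w := fun h =>
  (ser_irreducible fx fy (h.trans (mul_def z w).symm)).elim fz.ne_one fw.ne_one

theorem bridge_ne_par (a : α) (fz : IsFlow z) (fw : IsFlow w) : bridge a ≠ par z w := fun h =>
  (bridge_irreducible a (h.trans (mul_def z w).symm)).elim fz.ne_one fw.ne_one

/-- Serial factors of SP-graphs are SP-graphs. -/
theorem IsSP.of_ser (fx : IsFlow x) (fy : IsFlow y) (h : (GraphClass.ser x y).IsSP) :
    x.IsSP ∧ y.IsSP := by
  generalize hg : GraphClass.ser x y = g at h
  induction h generalizing x y with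
  | bridge a => exact absurd hg.symm (bridge_ne_ser a)
  | par h1 h2 => exact absurd hg (ser_ne_par fx fy h1.isFlow h2.isFlow)
  | @ser G H h1 h2 ih1 ih2 =>
    rcases ser_eq_ser fx fy h1.isFlow h2.isFlow hg with ⟨rfl, rfl⟩ | ⟨k, fk, rfl, rfl⟩ |
      ⟨k, fk, rfl, rfl⟩
    · exact ⟨h1, h2⟩
    · obtain ⟨hk, hy⟩ := ih2 fk fy rfl
      exact ⟨h1.ser hk, hy⟩
    · obtain ⟨hx, hk⟩ := ih1 fx fk rfl
      exact ⟨hx, hk.ser h2⟩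

end GraphClass

/-! ### The algebra of SP-graphs -/

namespace GraphClass

variable {α : Type*} {x y z : GraphClass α}

/-- The number of edges. -/
def size : GraphClass α → ℕ :=
  Quotient.lift (fun G : Graph α => G.E.card) (by
    rintro G H ⟨e, hE, -, -⟩
    rw [← hE, Multiset.card_map])

theorem size_bridge (a : α) : (bridge a).size = 1 := rfl

theorem size_ser (x y : GraphClass α) : (ser x y).size = x.size + y.size := by
  induction x using Quotient.inductionOn with | h G =>
  induction y using Quotient.inductionOn with | h H =>
  exact (Multiset.card_add _ _).trans
    (congrArg₂ _ (Multiset.card_map _ _) (Multiset.card_map _ _))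

theorem size_par (x y : GraphClass α) : (par x y).size = x.size + y.size := by
  induction x using Quotient.inductionOn with | h G =>
  induction y using Quotient.inductionOn with | h H =>
  exact (Multiset.card_add _ _).trans
    (congrArg₂ _ (Multiset.card_map _ _) (Multiset.card_map _ _))

theorem IsSP.size_pos (h : x.IsSP) : 0 < x.size := by
  induction h with
  | bridge a => rw [size_bridge]; exact one_pos
  | ser _ _ h1 h2 => rw [size_ser]; omega
  | par _ _ h1 h2 => rw [size_par]; omega

theorem eq_one_of_mul_eq_one (h : x * y = 1) : x = 1 ∧ y = 1 := by
  obtain ⟨W, A, E, s, t, h0⟩ := Rep.exists_self (1 : GraphClass α)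
  obtain ⟨hne, rfl, rfl⟩ := rep_unit_iff.1 h0
  rw [← h] at h0
  obtain ⟨A₁, A₂, E₁, E₂, h1, h2, hA, hi, hE⟩ := h0.par_inv
  rw [add_eq_zero] at hE
  obtain ⟨rfl, rfl⟩ := hE
  have key : ∀ {B : Set W} {z : GraphClass α}, Rep B 0 s t z → B ⊆ {s, t} → z = 1 := by
    intro B z hz hB
    obtain rfl : B = {s, t} := Set.Subset.antisymm hB (by
      rintro v (rfl | rfl)
      exacts [hz.src_mem, hz.tgt_mem])
    exact hz.unique (rep_unit_iff.2 ⟨hne, rfl, rfl⟩)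
  exact ⟨key h1 (hA ▸ Set.subset_union_left), key h2 (hA ▸ Set.subset_union_right)⟩

end GraphClass

namespace SPGraph

variable {α : Type*} {G H G₁ G₂ H₁ H₂ : SPGraph α}

/-- The underlying isomorphism class of graphs. -/
def toClass (G : SPGraph α) : GraphClass α := G.1

theorem isFlow (G : SPGraph α) : IsFlow G.1 := G.2.isFlow

theorem ser_assoc (G H K : SPGraph α) :
    SPAlgebra.ser α (SPAlgebra.ser α G H) K = SPAlgebra.ser α G (SPAlgebra.ser α H K) :=
  Subtype.ext (GraphClass.ser_assoc _ _ _)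

theorem bridge_injective : Function.Injective (SPAlgebra.bridge : α → SPGraph α) :=
  fun _ _ h => GraphClass.bridge_injective (congrArg Subtype.val h)

theorem bridge_ne_ser (a : α) : (SPAlgebra.bridge a : SPGraph α) ≠ SPAlgebra.ser α G H :=
  fun h => GraphClass.bridge_ne_ser a (congrArg Subtype.val h)

theorem bridge_ne_par (a : α) : (SPAlgebra.bridge a : SPGraph α) ≠ SPAlgebra.par α G H :=
  fun h => GraphClass.bridge_ne_par a G.isFlow H.isFlow (congrArg Subtype.val h)

theorem ser_ne_par : SPAlgebra.ser α G₁ G₂ ≠ SPAlgebra.par α H₁ H₂ :=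
  fun h => GraphClass.ser_ne_par G₁.isFlow G₂.isFlow H₁.isFlow H₂.isFlow (congrArg Subtype.val h)

theorem ser_eq_ser (h : SPAlgebra.ser α G₁ G₂ = SPAlgebra.ser α H₁ H₂) :
    (G₁ = H₁ ∧ G₂ = H₂) ∨
    (∃ K, G₁ = SPAlgebra.ser α H₁ K ∧ H₂ = SPAlgebra.ser α K G₂) ∨
    (∃ K, H₁ = SPAlgebra.ser α G₁ K ∧ G₂ = SPAlgebra.ser α K H₂) := by
  rcases GraphClass.ser_eq_ser G₁.isFlow G₂.isFlow H₁.isFlow H₂.isFlow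
    (congrArg Subtype.val h) with ⟨h1, h2⟩ | ⟨k, fk, h1, h2⟩ | ⟨k, fk, h1, h2⟩
  · exact Or.inl ⟨Subtype.ext h1, Subtype.ext h2⟩
  · have hk := (GraphClass.IsSP.of_ser H₁.isFlow fk (h1 ▸ G₁.2)).2
    exact Or.inr (Or.inl ⟨⟨k, hk⟩, Subtype.ext h1, Subtype.ext h2⟩)
  · have hk := (GraphClass.IsSP.of_ser G₁.isFlow fk (h1 ▸ H₁.2)).2
    exact Or.inr (Or.inr ⟨⟨k, hk⟩, Subtype.ext h1, Subtype.ext h2⟩)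

theorem cases_bridge_ser_par (G : SPGraph α) : (∃ a : α, G = SPAlgebra.bridge a) ∨
    (∃ G₁ G₂, G = SPAlgebra.ser α G₁ G₂) ∨ (∃ G₁ G₂, G = SPAlgebra.par α G₁ G₂) := by
  obtain ⟨x, hx⟩ := G
  cases hx with
  | bridge a => exact Or.inl ⟨a, rfl⟩
  | @ser x y h1 h2 => exact Or.inr (Or.inl ⟨⟨x, h1⟩, ⟨y, h2⟩, rfl⟩)
  | @par x y h1 h2 => exact Or.inr (Or.inr ⟨⟨x, h1⟩, ⟨y, h2⟩, rfl⟩)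

/-- P-graphs are exactly the parallel compositions. -/
theorem isPGraph_iff : G.IsPGraph ↔ ∃ G₁ G₂, G = SPAlgebra.par α G₁ G₂ := by
  constructor
  · rintro ⟨h1, h2⟩
    rcases G.cases_bridge_ser_par with h | h | h
    exacts [absurd h h2, absurd h h1, h]
  · rintro ⟨G₁, G₂, rfl⟩
    exact ⟨fun ⟨_, _, h⟩ => ser_ne_par h.symm, fun ⟨a, h⟩ => bridge_ne_par a h.symm⟩

theorem isPGraph_par : (SPAlgebra.par α G H).IsPGraph := isPGraph_iff.2 ⟨G, H, rfl⟩

theorem not_isPGraph_bridge (a : α) : ¬ (SPAlgebra.bridge a : SPGraph α).IsPGraph :=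
  fun h => h.2 ⟨a, rfl⟩

theorem not_isPGraph_ser : ¬ (SPAlgebra.ser α G H).IsPGraph := fun h => h.1 ⟨G, H, rfl⟩

/-- S-graphs are irreducible with respect to parallel composition, even in the monoid of all
graphs. -/
theorem eq_one_or_eq_one_of_not_isPGraph (h : ¬ G.IsPGraph) {x y : GraphClass α}
    (hG : G.1 = x * y) : x = 1 ∨ y = 1 := by
  rcases G.cases_bridge_ser_par with ⟨a, rfl⟩ | ⟨G₁, G₂, rfl⟩ | h'
  · exact GraphClass.bridge_irreducible a hG
  · exact GraphClass.ser_irreducible G₁.isFlow G₂.isFlow hG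
  · exact absurd (isPGraph_iff.2 h') h

end SPGraph

/-! ### Parallel compositions of graphs taken from given sets -/

section ParYields

variable {α : Type*} {N N' : Type*} {R : N → SPGraph α → Prop} {m n : N →₀ ℕ}
  {x y z : GraphClass α} {G : SPGraph α}

/-- `x` is a parallel composition of SP-graphs `G₁, …, Gₙ` with `R sᵢ Gᵢ`, where `m = s₁ ⋯ sₙ`.
For the empty monomial `m` this is the neutral graph. -/
def ParYields (R : N → SPGraph α → Prop) (m : N →₀ ℕ) (x : GraphClass α) : Prop :=
  ∃ L : Multiset (SPGraph α), Multiset.Rel R (Finsupp.toMultiset m) L ∧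
    (L.map SPGraph.toClass).prod = x

theorem parYields_zero : ParYields R 0 x ↔ x = 1 := by
  simp only [ParYields, map_zero, Multiset.rel_zero_left]
  constructor
  · rintro ⟨_, rfl, rfl⟩
    simp
  · rintro rfl
    exact ⟨0, rfl, by simp⟩

theorem parYields_single {s : N} :
    ParYields R (Finsupp.single s 1) x ↔ ∃ G, R s G ∧ G.1 = x := by
  simp only [ParYields, Finsupp.toMultiset_single, one_smul]
  constructor
  · rintro ⟨L, hL, rfl⟩
    rw [← Multiset.cons_zero, Multiset.rel_cons_left] at hL
    obtain ⟨G, L', hG, hL', rfl⟩ := hL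
    rw [Multiset.rel_zero_left] at hL'
    subst hL'
    exact ⟨G, hG, by simp [SPGraph.toClass]⟩
  · rintro ⟨G, hG, rfl⟩
    refine ⟨{G}, ?_, by simp [SPGraph.toClass]⟩
    rw [← Multiset.cons_zero, ← Multiset.cons_zero]
    exact Multiset.Rel.cons hG Multiset.Rel.zero

theorem parYields_add :
    ParYields R (m + n) x ↔ ∃ y z, ParYields R m y ∧ ParYields R n z ∧ x = y * z := by
  simp only [ParYields, map_add, Multiset.rel_add_left]
  constructor
  · rintro ⟨L, ⟨L₁, L₂, h1, h2, rfl⟩, rfl⟩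
    exact ⟨_, _, ⟨L₁, h1, rfl⟩, ⟨L₂, h2, rfl⟩, by simp⟩
  · rintro ⟨_, _, ⟨L₁, h1, rfl⟩, ⟨L₂, h2, rfl⟩, rfl⟩
    exact ⟨L₁ + L₂, ⟨L₁, L₂, h1, h2, rfl⟩, by simp⟩

theorem parYields_mapDomain {R : N' → SPGraph α → Prop} (f : N → N') :
    ParYields R (m.mapDomain f) x ↔ ParYields (fun s => R (f s)) m x := by
  simp only [ParYields, ← Finsupp.toMultiset_map, Multiset.rel_map_left]

theorem ParYields.eq_one_or_isSP (h : ParYields R m x) : (m = 0 ∧ x = 1) ∨ (m ≠ 0 ∧ x.IsSP) := by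
  induction m using Finsupp.induction_linear generalizing x with
  | zero => exact Or.inl ⟨rfl, parYields_zero.1 h⟩
  | add m n ihm ihn =>
    obtain ⟨y, z, hy, hz, rfl⟩ := parYields_add.1 h
    rcases ihm hy with ⟨rfl, rfl⟩ | ⟨h1, h2⟩ <;> rcases ihn hz with ⟨rfl, rfl⟩ | ⟨h3, h4⟩
    · exact Or.inl ⟨by simp, by simp⟩
    · exact Or.inr ⟨by simpa using h3, by simpa using h4⟩
    · exact Or.inr ⟨by simpa using h1, by simpa using h2⟩
    · refine Or.inr ⟨fun h => h1 ?_, h2.par h4⟩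
      exact (add_eq_zero.1 h).1
  | single s k =>
    induction k generalizing x with
    | zero => exact Or.inl ⟨by simp, parYields_zero.1 (by simpa using h)⟩
    | succ k ih =>
      rw [Finsupp.single_add] at h
      obtain ⟨y, z, hy, hz, rfl⟩ := parYields_add.1 h
      obtain ⟨G, -, rfl⟩ := parYields_single.1 hz
      refine Or.inr ⟨by simp, ?_⟩
      rcases ih hy with ⟨-, rfl⟩ | ⟨-, h2⟩
      · simpa using G.2
      · exact h2.par G.2

/-- If all components are irreducible, then every decomposition of their parallel composition
into two parts distributes the components among the two parts. -/
theorem ParYields.split (hR : ∀ s G, R s G → ¬ G.IsPGraph) (h : ParYields R m (x * y)) :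
    ∃ m₁ m₂, m = m₁ + m₂ ∧ ParYields R m₁ x ∧ ParYields R m₂ y := by
  have key : ∀ (M : Multiset N) (L : Multiset (SPGraph α)) (x y : GraphClass α),
      Multiset.Rel R M L → (L.map SPGraph.toClass).prod = x * y → ∃ M₁ M₂ L₁ L₂, M = M₁ + M₂ ∧
        Multiset.Rel R M₁ L₁ ∧ Multiset.Rel R M₂ L₂ ∧ (L₁.map SPGraph.toClass).prod = x ∧
        (L₂.map SPGraph.toClass).prod = y := by
    intro M L x y hL hprod
    induction hL generalizing x y with
    | zero =>
      obtain ⟨rfl, rfl⟩ := GraphClass.eq_one_of_mul_eq_one (x := x) (y := y)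
        (by rw [← hprod]; simp)
      exact ⟨0, 0, 0, 0, by simp, Multiset.Rel.zero, Multiset.Rel.zero, by simp, by simp⟩
    | @cons s G M L hs _ ih =>
      rw [Multiset.map_cons, Multiset.prod_cons] at hprod
      obtain ⟨a, b, c, d, h1, h2, rfl, rfl⟩ := GraphClass.exists_refinement hprod
      obtain ⟨M₁, M₂, L₁, L₂, rfl, r1, r2, rfl, rfl⟩ := ih c d h2
      -- `G` is irreducible, hence it lies in one of the two parts
      rcases SPGraph.eq_one_or_eq_one_of_not_isPGraph (hR s G hs) h1 with rfl | rfl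
      · refine ⟨M₁, s ::ₘ M₂, L₁, G ::ₘ L₂, by simp, r1, Multiset.Rel.cons hs r2, by simp, ?_⟩
        rw [Multiset.map_cons, Multiset.prod_cons, h1, one_mul]
      · refine ⟨s ::ₘ M₁, M₂, G ::ₘ L₁, L₂, by simp, Multiset.Rel.cons hs r1, r2, ?_, by simp⟩
        rw [Multiset.map_cons, Multiset.prod_cons, h1, mul_one]
  obtain ⟨L, hL, hprod⟩ := h
  obtain ⟨M₁, M₂, L₁, L₂, hM, r1, r2, p1, p2⟩ := key _ _ _ _ hL hprod
  classical
  refine ⟨M₁.toFinsupp, M₂.toFinsupp, ?_, ⟨L₁, by simpa using r1, p1⟩,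
    ⟨L₂, by simpa using r2, p2⟩⟩
  rw [← map_add, ← hM, Finsupp.toMultiset_toFinsupp]

end ParYields

/-! ### Terms -/

namespace Term

variable {α : Type*} {N : Type*} {t u : Term α N} {m n : N →₀ ℕ}

/-- The multiset of nonterminals of a parallel composition of nonterminals, with a junk value for
other terms. -/
noncomputable def parCount : Term α N → N →₀ ℕ
  | .nt x => Finsupp.single x 1
  | .label _ => 0
  | .ser _ _ => 0
  | .par t u => t.parCount + u.parCount

theorem ParOf.eq_parCount (h : t.ParOf m) : m = t.parCount := by
  induction h with
  | nt x => rfl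
  | par _ _ h1 h2 => rw [h1, h2]; rfl

theorem ParOf.degree_pos (h : t.ParOf m) : 0 < m.degree := by
  induction h with
  | nt x => simp
  | par _ _ h1 h2 => rw [map_add]; omega

theorem ParOf.exists_par (h : t.ParOf m) (hm : 2 ≤ m.degree) : ∃ u v, t = .par u v := by
  cases h with
  | nt x => simp at hm
  | par => exact ⟨_, _, rfl⟩

theorem hasValue_ser_iff {G : SPGraph α} : (Term.ser t u).HasValue G ↔
    ∃ G₁ G₂, t.HasValue G₁ ∧ u.HasValue G₂ ∧ G = SPAlgebra.ser α G₁ G₂ := by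
  constructor
  · intro h
    cases h with
    | ser h1 h2 => exact ⟨_, _, h1, h2, rfl⟩
  · rintro ⟨G₁, G₂, h1, h2, rfl⟩
    exact .ser h1 h2

theorem hasValue_par_iff {G : SPGraph α} : (Term.par t u).HasValue G ↔
    ∃ G₁ G₂, t.HasValue G₁ ∧ u.HasValue G₂ ∧ G = SPAlgebra.par α G₁ G₂ := by
  constructor
  · intro h
    cases h with
    | par h1 h2 => exact ⟨_, _, h1, h2, rfl⟩
  · rintro ⟨G₁, G₂, h1, h2, rfl⟩
    exact .par h1 h2

theorem AssocEq.hasValue_iff (h : t.AssocEq u) (G : SPGraph α) : t.HasValue G ↔ u.HasValue G := by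
  induction h generalizing G with
  | assoc t u v =>
    simp only [hasValue_ser_iff]
    constructor
    · rintro ⟨_, G₃, ⟨G₁, G₂, h1, h2, rfl⟩, h3, rfl⟩
      exact ⟨G₁, _, h1, ⟨G₂, G₃, h2, h3, rfl⟩, SPGraph.ser_assoc _ _ _⟩
    · rintro ⟨G₁, _, h1, ⟨G₂, G₃, h2, h3, rfl⟩, rfl⟩
      exact ⟨_, G₃, ⟨G₁, G₂, h1, h2, rfl⟩, h3, (SPGraph.ser_assoc _ _ _).symm⟩
  | refl => rfl
  | symm _ ih => exact (ih G).symm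
  | trans _ _ ih1 ih2 => exact (ih1 G).trans (ih2 G)
  | ser _ _ ih1 ih2 => simp only [hasValue_ser_iff, ih1, ih2]
  | par _ _ ih1 ih2 => simp only [hasValue_par_iff, ih1, ih2]

theorem AssocEq.eq_nt_iff (h : t.AssocEq u) (x : N) : t = .nt x ↔ u = .nt x := by
  induction h with
  | symm _ ih => exact ih.symm
  | trans _ _ ih1 ih2 => exact ih1.trans ih2
  | _ => simp

/-- `t.HasOpenValue G q`: up to associativity of `∘`, the term `t` is the serial composition of a
ground term with value `G` and of the nonterminal `q`. -/
inductive HasOpenValue : Term α N → SPGraph α → N → Prop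
  | base {t : Term α N} {G : SPGraph α} (q : N) :
      t.HasValue G → HasOpenValue (.ser t (.nt q)) G q
  | step {t u : Term α N} {G H : SPGraph α} {q : N} :
      t.HasValue G → HasOpenValue u H q → HasOpenValue (.ser t u) (SPAlgebra.ser α G H) q

theorem hasOpenValue_ser_iff {G : SPGraph α} {q : N} : (Term.ser t u).HasOpenValue G q ↔
    (u = .nt q ∧ t.HasValue G) ∨
      ∃ G₁ G₂, t.HasValue G₁ ∧ u.HasOpenValue G₂ q ∧ G = SPAlgebra.ser α G₁ G₂ := by
  constructor
  · intro h
    cases h with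
    | base _ h => exact Or.inl ⟨rfl, h⟩
    | step h1 h2 => exact Or.inr ⟨_, _, h1, h2, rfl⟩
  · rintro (⟨rfl, h⟩ | ⟨G₁, G₂, h1, h2, rfl⟩)
    exacts [.base q h, .step h1 h2]

/-- This replaces the associativity law in the definition of views by a property of the bracketing
at hand. -/
theorem AssocEq.hasOpenValue_iff (h : t.AssocEq u) (G : SPGraph α) (q : N) :
    t.HasOpenValue G q ↔ u.HasOpenValue G q := by
  induction h generalizing G with
  | assoc t u v =>
    constructor
    · intro h
      rcases hasOpenValue_ser_iff.1 h with ⟨rfl, h1⟩ | ⟨_, G₃, h1, h3, rfl⟩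
      · obtain ⟨G₁, G₂, k1, k2, rfl⟩ := hasValue_ser_iff.1 h1
        exact .step k1 (.base q k2)
      · obtain ⟨G₁, G₂, k1, k2, rfl⟩ := hasValue_ser_iff.1 h1
        rw [SPGraph.ser_assoc]
        exact .step k1 (.step k2 h3)
    · intro h
      rcases hasOpenValue_ser_iff.1 h with ⟨h0, h1⟩ | ⟨G₁, _, h1, h3, rfl⟩
      · exact absurd h0 (by simp)
      · rcases hasOpenValue_ser_iff.1 h3 with ⟨rfl, h2⟩ | ⟨G₂, G₃, k2, k3, rfl⟩
        · exact .base q (.ser h1 h2)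
        · rw [← SPGraph.ser_assoc]
          exact .step (.ser h1 k2) k3
  | refl => rfl
  | symm _ ih => exact (ih G).symm
  | trans _ _ ih1 ih2 => exact (ih1 G).trans (ih2 G)
  | ser ht hu _ ih2 => simp only [hasOpenValue_ser_iff, ht.hasValue_iff, hu.eq_nt_iff, ih2]
  | par => exact ⟨nofun, nofun⟩

end Term

/-! ### Big-step semantics of grammars -/

namespace Grammar

section General

variable {α : Type*} {N : Type*} {Γ : Grammar α N} {t u w : Term α N} {G : SPGraph α} {x : N}

/-- Big-step semantics: the term `t` derives a ground term with value `G`. -/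
inductive Yields (Γ : Grammar α N) : Term α N → SPGraph α → Prop
  | rule {x : N} {t : Term α N} {G : SPGraph α} :
      (x, t) ∈ Γ.rules → Yields Γ t G → Yields Γ (.nt x) G
  | label (a : α) : Yields Γ (.label a) (SPAlgebra.bridge a)
  | ser {t u : Term α N} {G H : SPGraph α} :
      Yields Γ t G → Yields Γ u H → Yields Γ (.ser t u) (SPAlgebra.ser α G H)
  | par {t u : Term α N} {G H : SPGraph α} :
      Yields Γ t G → Yields Γ u H → Yields Γ (.par t u) (SPAlgebra.par α G H)

theorem Derives.ser {t' u' : Term α N} (h1 : Γ.Derives t t') (h2 : Γ.Derives u u') :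
    Γ.Derives (.ser t u) (.ser t' u') :=
  (Relation.ReflTransGen.lift (fun t => Term.ser t u) (fun _ _ h => Step.ser_left u h) _ _ h1).trans
    (Relation.ReflTransGen.lift (fun u => Term.ser t' u) (fun _ _ h => Step.ser_right t' h) _ _ h2)

theorem Derives.par {t' u' : Term α N} (h1 : Γ.Derives t t') (h2 : Γ.Derives u u') :
    Γ.Derives (.par t u) (.par t' u') :=
  (Relation.ReflTransGen.lift (fun t => Term.par t u) (fun _ _ h => Step.par_left u h) _ _ h1).trans
    (Relation.ReflTransGen.lift (fun u => Term.par t' u) (fun _ _ h => Step.par_right t' h) _ _ h2)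

theorem Derives.of_rule (h : (x, t) ∈ Γ.rules) (h' : Γ.Derives t w) : Γ.Derives (.nt x) w :=
  Relation.ReflTransGen.head (Step.rule h) h'

theorem Derives.ser_inv (h : Γ.Derives (.ser t u) w) :
    ∃ t' u', w = .ser t' u' ∧ Γ.Derives t t' ∧ Γ.Derives u u' := by
  induction h with
  | refl => exact ⟨t, u, rfl, .refl, .refl⟩
  | tail _ h ih =>
    obtain ⟨t', u', rfl, h1, h2⟩ := ih
    cases h with
    | ser_left _ h => exact ⟨_, _, rfl, h1.tail h, h2⟩
    | ser_right _ h => exact ⟨_, _, rfl, h1, h2.tail h⟩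

theorem Derives.par_inv (h : Γ.Derives (.par t u) w) :
    ∃ t' u', w = .par t' u' ∧ Γ.Derives t t' ∧ Γ.Derives u u' := by
  induction h with
  | refl => exact ⟨t, u, rfl, .refl, .refl⟩
  | tail _ h ih =>
    obtain ⟨t', u', rfl, h1, h2⟩ := ih
    cases h with
    | par_left _ h => exact ⟨_, _, rfl, h1.tail h, h2⟩
    | par_right _ h => exact ⟨_, _, rfl, h1, h2.tail h⟩

theorem Derives.label_inv {a : α} (h : Γ.Derives (.label a) w) : w = .label a := by
  induction h with
  | refl => rfl
  | tail _ h ih => subst ih; cases h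

theorem Derives.nt_inv (h : Γ.Derives (.nt x) w) :
    w = .nt x ∨ ∃ t, (x, t) ∈ Γ.rules ∧ Γ.Derives t w := by
  rcases Relation.ReflTransGen.cases_head h with h | ⟨t, h1, h2⟩
  · exact Or.inl h.symm
  · cases h1 with
    | rule h => exact Or.inr ⟨t, h, h2⟩

theorem yields_iff : Γ.Yields t G ↔ ∃ w, Γ.Derives t w ∧ w.HasValue G := by
  constructor
  · intro h
    induction h with
    | rule h _ ih =>
      obtain ⟨w, h1, h2⟩ := ih
      exact ⟨w, .of_rule h h1, h2⟩
    | label a => exact ⟨_, .refl, .label a⟩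
    | ser _ _ ih1 ih2 =>
      obtain ⟨w, h1, h2⟩ := ih1
      obtain ⟨w', h1', h2'⟩ := ih2
      exact ⟨_, h1.ser h1', .ser h2 h2'⟩
    | par _ _ ih1 ih2 =>
      obtain ⟨w, h1, h2⟩ := ih1
      obtain ⟨w', h1', h2'⟩ := ih2
      exact ⟨_, h1.par h1', .par h2 h2'⟩
  · rintro ⟨w, h1, h2⟩
    induction h1 using Relation.ReflTransGen.head_induction_on with
    | refl =>
      induction h2 with
      | label a => exact .label a
      | ser _ _ ih1 ih2 => exact .ser ih1 ih2
      | par _ _ ih1 ih2 => exact .par ih1 ih2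
    | head h hd ih =>
      clear h2 hd
      induction h generalizing G with
      | rule h => exact .rule h ih
      | ser_left u _ ih' => cases ih with | ser h1 h2 => exact .ser (ih' h1) h2
      | ser_right t _ ih' => cases ih with | ser h1 h2 => exact .ser h1 (ih' h2)
      | par_left u _ ih' => cases ih with | par h1 h2 => exact .par (ih' h1) h2
      | par_right t _ ih' => cases ih with | par h1 h2 => exact .par h1 (ih' h2)

theorem generates_iff : Γ.Generates x G ↔ Γ.Yields (.nt x) G := yields_iff.symm

theorem yields_nt_iff : Γ.Yields (.nt x) G ↔ ∃ t, (x, t) ∈ Γ.rules ∧ Γ.Yields t G := by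
  constructor
  · intro h
    cases h with
    | rule h1 h2 => exact ⟨_, h1, h2⟩
  · rintro ⟨t, h1, h2⟩
    exact .rule h1 h2

/-- The bracketing and the order of the factors of a parallel composition do not matter. -/
theorem yields_iff_parYields {m : N →₀ ℕ} (h : t.ParOf m) :
    Γ.Yields t G ↔ ParYields (fun x G => Γ.Generates x G) m G.1 := by
  induction h generalizing G with
  | nt x =>
    simp only [parYields_single, generates_iff]
    constructor
    · exact fun h => ⟨G, h, rfl⟩
    · rintro ⟨G', h, h'⟩
      rwa [← Subtype.ext h']
  | par h1 h2 ih1 ih2 =>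
    rw [parYields_add]
    constructor
    · intro h
      cases h with
      | par h1 h2 => exact ⟨_, _, ih1.1 h1, ih2.1 h2, rfl⟩
    · rintro ⟨y, z, hy, hz, hG⟩
      have key : ∀ {k : N →₀ ℕ} {x : GraphClass α}, 0 < k.degree →
          ParYields (fun x G => Γ.Generates x G) k x → x.IsSP := by
        intro k x hk hx
        rcases hx.eq_one_or_isSP with ⟨rfl, -⟩ | ⟨-, h⟩
        · simp at hk
        · exact h
      have hG' : G = SPAlgebra.par α ⟨y, key h1.degree_pos hy⟩ ⟨z, key h2.degree_pos hz⟩ :=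
        Subtype.ext hG
      rw [hG']
      exact .par (ih1.2 hy) (ih2.2 hz)

end General

/-! ### Derivations in alternative grammars -/

section Alternative

variable {α : Type*} {P S : Type*} {Γ : Grammar α (P ⊕ S)} {p : P} {s : S} {q : P ⊕ S}
  {t w : Term α (P ⊕ S)} {G H : SPGraph α} {m n : S →₀ ℕ} {x : GraphClass α}

theorem IsAlternative.parOf_of_rule (hΓ : Γ.IsAlternative) (h : (Sum.inl p, t) ∈ Γ.rules) :
    (∃ s l, 1 ≤ l ∧ t.ParOf (Finsupp.single (Sum.inl p) 1 + Finsupp.single (Sum.inr s) l)) ∨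
      ∃ m : S →₀ ℕ, t.ParOf (m.mapDomain Sum.inr) := by
  rcases hΓ _ h with ⟨p', s, l, hl, h1, h2⟩ | ⟨p', m, hm, h1, h2⟩ | ⟨s, p', s', h1⟩ |
    ⟨s, p₁, p₂, h1⟩ | ⟨p', s, h1, h2⟩ | ⟨s, a, h1⟩
  · obtain rfl := Sum.inl.inj h1
    exact Or.inl ⟨s, l, hl, h2⟩
  · exact Or.inr ⟨m, h2⟩
  · simp at h1
  · simp at h1
  · simp only [Prod.mk.injEq] at h1
    obtain ⟨-, rfl⟩ := h1
    refine Or.inr ⟨Finsupp.single s 1, ?_⟩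
    rw [Finsupp.mapDomain_single]
    exact .nt _
  · simp at h1

theorem IsAlternative.par_or_bridge_of_rule (hΓ : Γ.IsAlternative)
    (h : (Sum.inl p, t) ∈ Γ.rules) :
    (∃ u v, t = .par u v) ∨ ∃ s, t = .nt (Sum.inr s) ∧ Γ.IsBridgeNonterminal s := by
  rcases hΓ _ h with ⟨p', s, l, hl, h1, h2⟩ | ⟨p', m, hm, h1, h2⟩ | ⟨s, p', s', h1⟩ |
    ⟨s, p₁, p₂, h1⟩ | ⟨p', s, h1, h2⟩ | ⟨s, a, h1⟩
  · refine Or.inl (h2.exists_par ?_)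
    rw [map_add, Finsupp.degree_single, Finsupp.degree_single]
    omega
  · refine Or.inl (h2.exists_par ?_)
    rwa [Finsupp.degree_mapDomain]
  · simp at h1
  · simp at h1
  · simp only [Prod.mk.injEq] at h1
    exact Or.inr ⟨s, h1.2, h2⟩
  · simp at h1

theorem IsAlternative.ser_or_label_of_rule (hΓ : Γ.IsAlternative)
    (h : (Sum.inr s, t) ∈ Γ.rules) :
    (∃ p q, t = .ser (.nt (Sum.inl p)) (.nt q)) ∨ ∃ a, t = .label a := by
  rcases hΓ _ h with ⟨p', s, l, hl, h1, h2⟩ | ⟨p', m, hm, h1, h2⟩ | ⟨s, p', s', h1⟩ |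
    ⟨s, p₁, p₂, h1⟩ | ⟨p', s, h1, h2⟩ | ⟨s, a, h1⟩
  · simp at h1
  · simp at h1
  · exact Or.inl ⟨_, _, (Prod.mk.inj h1).2⟩
  · exact Or.inl ⟨_, _, (Prod.mk.inj h1).2⟩
  · simp at h1
  · exact Or.inr ⟨_, (Prod.mk.inj h1).2⟩

theorem IsBridgeNonterminal.eq_label (h : Γ.IsBridgeNonterminal s)
    (ht : (Sum.inr s, t) ∈ Γ.rules) : ∃ a, t = .label a := by
  obtain ⟨a, -, h2⟩ := h
  rcases h2 _ ht (Or.inl rfl) with h | ⟨p, h⟩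
  · exact ⟨a, (Prod.mk.inj h).2⟩
  · simp at h

/-- Elements of `S` generate S-graphs only. -/
theorem IsAlternative.not_isPGraph (hΓ : Γ.IsAlternative) (h : Γ.Yields (.nt (Sum.inr s)) G) :
    ¬ G.IsPGraph := by
  obtain ⟨t, h1, h2⟩ := yields_nt_iff.1 h
  rcases hΓ.ser_or_label_of_rule h1 with ⟨p, q, rfl⟩ | ⟨a, rfl⟩
  · cases h2 with
    | ser => exact SPGraph.not_isPGraph_ser
  · cases h2 with
    | label => exact SPGraph.not_isPGraph_bridge a

/-- A nonterminal of the first kind generates an S-graph only through a rule `p → s`. -/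
theorem IsAlternative.exists_bridge_rule (hΓ : Γ.IsAlternative)
    (h : Γ.Yields (.nt (Sum.inl p)) G) (hG : ¬ G.IsPGraph) :
    ∃ (s : S) (a : α), (Sum.inl p, .nt (Sum.inr s)) ∈ Γ.rules ∧
      (Sum.inr s, .label a) ∈ Γ.rules ∧ G = SPAlgebra.bridge a := by
  obtain ⟨t, h1, h2⟩ := yields_nt_iff.1 h
  rcases hΓ.par_or_bridge_of_rule h1 with ⟨u, v, rfl⟩ | ⟨s, rfl, hs⟩
  · cases h2 with
    | par => exact absurd SPGraph.isPGraph_par hG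
  · obtain ⟨t, h3, h4⟩ := yields_nt_iff.1 h2
    obtain ⟨a, rfl⟩ := hs.eq_label h3
    cases h4 with
    | label => exact ⟨s, a, h1, h3, rfl⟩

/-- Nonterminals of the first kind generate atomic graphs only. -/
theorem IsAlternative.ne_ser (hΓ : Γ.IsAlternative) (h : Γ.Yields (.nt (Sum.inl p)) G)
    (G₁ G₂ : SPGraph α) : G ≠ SPAlgebra.ser α G₁ G₂ := by
  rintro rfl
  obtain ⟨s, a, -, -, h⟩ := hΓ.exists_bridge_rule h SPGraph.not_isPGraph_ser
  exact SPGraph.bridge_ne_ser a h.symm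

theorem IsAlternative.not_derives_ser (hΓ : Γ.IsAlternative) {u v : Term α (P ⊕ S)} :
    ¬ Γ.Derives (.nt (Sum.inl p)) (.ser u v) := by
  intro h
  rcases h.nt_inv with h | ⟨t, h1, h2⟩
  · simp at h
  · rcases hΓ.par_or_bridge_of_rule h1 with ⟨u, v, rfl⟩ | ⟨s, rfl, hs⟩
    · obtain ⟨_, _, h, -⟩ := h2.par_inv
      simp at h
    · rcases h2.nt_inv with h | ⟨t, h3, h4⟩
      · simp at h
      · obtain ⟨a, rfl⟩ := hs.eq_label h3
        simpa using h4.label_inv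

theorem IsAlternative.eq_of_derives_inr (hΓ : Γ.IsAlternative)
    (h : Γ.Derives (.nt (Sum.inr s)) (.nt q)) : q = Sum.inr s := by
  rcases h.nt_inv with h | ⟨t, h1, h2⟩
  · simpa using h
  · rcases hΓ.ser_or_label_of_rule h1 with ⟨p, q, rfl⟩ | ⟨a, rfl⟩
    · obtain ⟨_, _, h, -⟩ := h2.ser_inv
      simp at h
    · simpa using h2.label_inv

theorem IsAlternative.rule_of_derives_inl (hΓ : Γ.IsAlternative)
    (h : Γ.Derives (.nt (Sum.inl p)) (.nt q)) : q = Sum.inl p ∨ ∃ s, q = Sum.inr s ∧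
      (Sum.inl p, .nt (Sum.inr s)) ∈ Γ.rules ∧ Γ.IsBridgeNonterminal s := by
  rcases h.nt_inv with h | ⟨t, h1, h2⟩
  · exact Or.inl (by simpa using h)
  · rcases hΓ.par_or_bridge_of_rule h1 with ⟨u, v, rfl⟩ | ⟨s, rfl, hs⟩
    · obtain ⟨_, _, h, -⟩ := h2.par_inv
      simp at h
    · exact Or.inr ⟨s, hΓ.eq_of_derives_inr h2, h1, hs⟩

theorem IsAlternative.derives_ser_iff (hΓ : Γ.IsAlternative) :
    Γ.Derives (.nt (Sum.inr s)) (.ser (.nt (Sum.inl p)) (.nt q)) ↔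
      ∃ q₀, (Sum.inr s, .ser (.nt (Sum.inl p)) (.nt q₀)) ∈ Γ.rules ∧
        Γ.Derives (.nt q₀) (.nt q) := by
  constructor
  · intro h
    rcases h.nt_inv with h | ⟨t, h1, h2⟩
    · simp at h
    · rcases hΓ.ser_or_label_of_rule h1 with ⟨p', q', rfl⟩ | ⟨a, rfl⟩
      · obtain ⟨_, _, h, h3, h4⟩ := h2.ser_inv
        simp only [Term.ser.injEq] at h
        obtain ⟨rfl, rfl⟩ := h
        rcases hΓ.rule_of_derives_inl h3 with h | ⟨_, h, -⟩
        · obtain rfl := Sum.inl.inj h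
          exact ⟨q', h1, h4⟩
        · simp at h
      · simpa using h2.label_inv
  · rintro ⟨q₀, h1, h2⟩
    exact .of_rule h1 (Derives.ser .refl h2)

end Alternative

/-! ### Views of S-graphs -/

section SerView

variable {α : Type*} {P S : Type*} {Γ : Grammar α (P ⊕ S)} {p : P} {s s' : S} {q : P ⊕ S}
  {t w : Term α (P ⊕ S)} {G H K : SPGraph α} {v : Option (P ⊕ S)}

/-- Views of S-graphs for alternative grammars, read off from the rules along the derivation: every
derivation from `s` unfolds a right-branching chain of serial compositions. -/
inductive SerView (Γ : Grammar α (P ⊕ S)) : S → SPGraph α → Option (P ⊕ S) → Prop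
  | leaf {s : S} {a : α} : (Sum.inr s, .label a) ∈ Γ.rules →
      SerView Γ s (SPAlgebra.bridge a) none
  | base {s : S} {p : P} {q₀ q : P ⊕ S} {G : SPGraph α} :
      (Sum.inr s, .ser (.nt (Sum.inl p)) (.nt q₀)) ∈ Γ.rules →
      Γ.Derives (.nt q₀) (.nt q) → Γ.Yields (.nt (Sum.inl p)) G → SerView Γ s G (some q)
  | last {s : S} {p p' : P} {G H : SPGraph α} :
      (Sum.inr s, .ser (.nt (Sum.inl p)) (.nt (Sum.inl p'))) ∈ Γ.rules →
      Γ.Yields (.nt (Sum.inl p)) G → Γ.Yields (.nt (Sum.inl p')) H →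
      SerView Γ s (SPAlgebra.ser α G H) none
  | step {s s' : S} {p : P} {G H : SPGraph α} {v : Option (P ⊕ S)} :
      (Sum.inr s, .ser (.nt (Sum.inl p)) (.nt (Sum.inr s'))) ∈ Γ.rules →
      Γ.Yields (.nt (Sum.inl p)) G → SerView Γ s' H v →
      SerView Γ s (SPAlgebra.ser α G H) v

theorem SerView.isSerView (h : Γ.SerView s G v) : Γ.IsSerView G s v := by
  induction h with
  | leaf h => exact ⟨_, _, .of_rule h .refl, .refl _, .label _⟩
  | base h1 h2 h3 =>
    obtain ⟨w, h4, h5⟩ := yields_iff.1 h3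
    exact ⟨_, w, .of_rule h1 (h4.ser h2), .refl _, h5⟩
  | last h1 h2 h3 =>
    obtain ⟨w, h4, h5⟩ := yields_iff.1 h2
    obtain ⟨w', h4', h5'⟩ := yields_iff.1 h3
    exact ⟨_, _, .of_rule h1 (h4.ser h4'), .refl _, .ser h5 h5'⟩
  | @step s s' p G H v h1 h2 _ ih =>
    obtain ⟨w, h4, h5⟩ := yields_iff.1 h2
    cases v with
    | none =>
      obtain ⟨w', t, h6, h7, h8⟩ := ih
      exact ⟨_, _, .of_rule h1 (h4.ser h6), .ser (.refl _) h7, .ser h5 h8⟩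
    | some q =>
      obtain ⟨w', t, h6, h7, h8⟩ := ih
      exact ⟨_, _, .of_rule h1 (h4.ser h6),
        .trans (.ser (.refl w) h7) (.symm (.assoc w t _)), .ser h5 h8⟩

theorem IsAlternative.serView_none (hΓ : Γ.IsAlternative) (h : Γ.Yields (.nt (Sum.inr s)) G) :
    Γ.SerView s G none := by
  induction hn : G.1.size using Nat.strong_induction_on generalizing s G with
  | _ n ih =>
    obtain ⟨t, h1, h2⟩ := yields_nt_iff.1 h
    rcases hΓ.ser_or_label_of_rule h1 with ⟨p, q, rfl⟩ | ⟨a, rfl⟩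
    · cases h2 with
      | @ser _ _ G H hG hH =>
        rcases q with p' | s'
        · exact .last h1 hG hH
        · refine .step h1 hG (ih H.1.size ?_ hH rfl)
          have h3 := GraphClass.size_ser G.1 H.1
          have h4 := G.2.size_pos
          have h5 : (SPAlgebra.ser α G H).1.size = G.1.size + H.1.size := h3
          omega
    · cases h2 with
      | label => exact .leaf h1

/-- In a term derived from `s` the left factor of a serial composition is derived from an element of
`P` and is not itself serial, so that associativity only matters for the right factor. -/
theorem IsAlternative.serView_some (hΓ : Γ.IsAlternative) (h : w.HasOpenValue G q)
    (hw : Γ.Derives (.nt (Sum.inr s)) w) : Γ.SerView s G (some q) := by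
  have key : ∀ {s : S} {u v : Term α (P ⊕ S)}, Γ.Derives (.nt (Sum.inr s)) (.ser u v) →
      ∃ p q₀, (Sum.inr s, .ser (.nt (Sum.inl p)) (.nt q₀)) ∈ Γ.rules ∧
        Γ.Derives (.nt (Sum.inl p)) u ∧ Γ.Derives (.nt q₀) v := by
    intro s u v h
    rcases h.nt_inv with h | ⟨t, h1, h2⟩
    · simp at h
    · rcases hΓ.ser_or_label_of_rule h1 with ⟨p', q', rfl⟩ | ⟨a, rfl⟩
      · obtain ⟨_, _, h, h3, h4⟩ := h2.ser_inv
        simp only [Term.ser.injEq] at h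
        obtain ⟨rfl, rfl⟩ := h
        exact ⟨p', q', h1, h3, h4⟩
      · simpa using h2.label_inv
  induction h generalizing s with
  | base q h =>
    obtain ⟨p, q₀, h1, h2, h3⟩ := key hw
    exact .base h1 h3 (yields_iff.2 ⟨_, h2, h⟩)
  | step h h' ih =>
    obtain ⟨p, q₀, h1, h2, h3⟩ := key hw
    rcases q₀ with p' | s'
    · cases h' with
      | base => exact absurd h3 hΓ.not_derives_ser
      | step => exact absurd h3 hΓ.not_derives_ser
    · exact .step h1 (yields_iff.2 ⟨_, h2, h⟩) (ih h3)

theorem IsAlternative.isSerView_iff (hΓ : Γ.IsAlternative) :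
    Γ.IsSerView G s v ↔ Γ.SerView s G v := by
  refine ⟨fun h => ?_, SerView.isSerView⟩
  cases v with
  | none =>
    obtain ⟨w, t, h1, h2, h3⟩ := h
    exact hΓ.serView_none (yields_iff.2 ⟨w, h1, (h2.hasValue_iff G).2 h3⟩)
  | some q =>
    obtain ⟨w, t, h1, h2, h3⟩ := h
    exact hΓ.serView_some ((h2.hasOpenValue_iff G q).2 (.base q h3)) h1

theorem IsAlternative.serView_none_iff (hΓ : Γ.IsAlternative) :
    Γ.SerView s G none ↔ Γ.Yields (.nt (Sum.inr s)) G := by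
  refine ⟨fun h => ?_, hΓ.serView_none⟩
  obtain ⟨w, t, h1, h2, h3⟩ := h.isSerView
  exact yields_iff.2 ⟨w, h1, (h2.hasValue_iff G).2 h3⟩

/-- Views of a serial composition arise by composing views of the factors. -/
theorem IsAlternative.serView_ser_iff (hΓ : Γ.IsAlternative) :
    Γ.SerView s (SPAlgebra.ser α G H) v ↔
      (∃ s', Γ.SerView s G (some (Sum.inr s')) ∧ Γ.SerView s' H v) ∨
      (v = none ∧ ∃ p, Γ.SerView s G (some (Sum.inl p)) ∧ Γ.Yields (.nt (Sum.inl p)) H) := by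
  constructor
  · intro h
    generalize hK : SPAlgebra.ser α G H = K at h
    induction h generalizing G with
    | leaf => exact absurd hK.symm (SPGraph.bridge_ne_ser _)
    | base _ _ h => exact absurd hK.symm (hΓ.ne_ser h _ _)
    | last h1 h2 h3 =>
      rcases SPGraph.ser_eq_ser hK with ⟨rfl, rfl⟩ | ⟨K, -, h⟩ | ⟨K, h, -⟩
      · exact Or.inr ⟨rfl, _, .base h1 .refl h2, h3⟩
      · exact absurd h (hΓ.ne_ser h3 _ _)
      · exact absurd h (hΓ.ne_ser h2 _ _)
    | step h1 h2 h3 ih =>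
      rcases SPGraph.ser_eq_ser hK with ⟨rfl, rfl⟩ | ⟨K, rfl, h⟩ | ⟨K, h, -⟩
      · exact Or.inl ⟨_, .base h1 .refl h2, h3⟩
      · rcases ih h.symm with ⟨s', h4, h5⟩ | ⟨rfl, p', h4, h5⟩
        · exact Or.inl ⟨s', .step h1 h2 h4, h5⟩
        · exact Or.inr ⟨rfl, p', .step h1 h2 h4, h5⟩
      · exact absurd h (hΓ.ne_ser h2 _ _)
  · rintro (⟨s', h, h'⟩ | ⟨rfl, p, h, h'⟩)
    · generalize hv : some (Sum.inr s') = v' at h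
      induction h with
      | leaf => simp at hv
      | last => simp at hv
      | @base s p q₀ q G h1 h2 h3 =>
        obtain rfl := Option.some.inj hv
        rcases q₀ with p' | s₀
        · rcases hΓ.rule_of_derives_inl h2 with h | ⟨s₁, h, h4, h5⟩
          · simp at h
          · obtain rfl := Sum.inr.inj h
            -- the bridge nonterminal `s'` only generates a bridge, so that `H` is one
            cases h' with
            | leaf h6 => exact .last h1 h3 (.rule h4 (.rule h6 (.label _)))
            | base h6 => obtain ⟨a, h⟩ := h5.eq_label h6; simp at h
            | last h6 => obtain ⟨a, h⟩ := h5.eq_label h6; simp at h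
            | step h6 => obtain ⟨a, h⟩ := h5.eq_label h6; simp at h
        · obtain rfl := Sum.inr.inj (hΓ.eq_of_derives_inr h2)
          exact .step h1 h3 h'
      | step h1 h2 _ ih =>
        rw [SPGraph.ser_assoc]
        exact .step h1 h2 (ih hv)
    · generalize hv : some (Sum.inl p) = v' at h
      induction h with
      | leaf => simp at hv
      | last => simp at hv
      | @base s p₁ q₀ q G h1 h2 h3 =>
        obtain rfl := Option.some.inj hv
        rcases q₀ with p' | s₀
        · rcases hΓ.rule_of_derives_inl h2 with h | ⟨s₁, h, -⟩
          · obtain rfl := Sum.inl.inj h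
            exact .last h1 h3 h'
          · simp at h
        · simpa using hΓ.eq_of_derives_inr h2
      | step h1 h2 _ ih =>
        rw [SPGraph.ser_assoc]
        exact .step h1 h2 (ih hv)

/-- A view that is open at `p` can be continued along a rule `p → s'`. -/
theorem SerView.extend (h : Γ.SerView s G (some (Sum.inl p)))
    (hp : (Sum.inl p, .nt (Sum.inr s')) ∈ Γ.rules) : Γ.SerView s G (some (Sum.inr s')) := by
  generalize hv : some (Sum.inl p) = v at h
  induction h with
  | leaf => simp at hv
  | last => simp at hv
  | base h1 h2 h3 =>
    obtain rfl := Option.some.inj hv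
    exact .base h1 (h2.tail (.rule hp)) h3
  | step h1 h2 _ ih => exact .step h1 h2 (ih hv)

end SerView

/-! ### Views of P-graphs in normal grammars -/

section ParView

variable {α : Type*} {P S : Type*} {Γ : Grammar α (P ⊕ S)} {p : P} {s : S}
  {G H : SPGraph α} {m n k : S →₀ ℕ} {l : ℕ}

theorem isParView_iff :
    Γ.IsParView G m ↔ ParYields (fun s G => Γ.Generates (Sum.inr s) G) m G.1 := by
  constructor
  · intro h
    induction h with
    | single h => exact parYields_single.2 ⟨_, h, rfl⟩
    | par _ _ ih1 ih2 => exact parYields_add.2 ⟨_, _, ih1, ih2, rfl⟩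
  · intro h
    have hadd : ∀ {m n : S →₀ ℕ} {G : SPGraph α},
        (∀ G, ParYields (fun s G => Γ.Generates (Sum.inr s) G) m G.1 → Γ.IsParView G m) →
        (∀ G, ParYields (fun s G => Γ.Generates (Sum.inr s) G) n G.1 → Γ.IsParView G n) →
        ParYields (fun s G => Γ.Generates (Sum.inr s) G) (m + n) G.1 →
        Γ.IsParView G (m + n) := by
      intro m n G ihm ihn h
      obtain ⟨y, z, hy, hz, hG⟩ := parYields_add.1 h
      rcases hy.eq_one_or_isSP with ⟨rfl, rfl⟩ | ⟨-, h2⟩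
      · rw [zero_add]
        refine ihn G ?_
        rwa [hG, one_mul]
      · rcases hz.eq_one_or_isSP with ⟨rfl, rfl⟩ | ⟨-, h4⟩
        · rw [add_zero]
          refine ihm G ?_
          rwa [hG, mul_one]
        · have : G = SPAlgebra.par α ⟨y, h2⟩ ⟨z, h4⟩ := Subtype.ext hG
          rw [this]
          exact .par (ihm ⟨y, h2⟩ hy) (ihn ⟨z, h4⟩ hz)
    have hzero : ∀ G, ParYields (fun s G => Γ.Generates (Sum.inr s) G) (0 : S →₀ ℕ) G.1 →
        Γ.IsParView G 0 := fun G h =>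
      absurd (parYields_zero.1 h) G.isFlow.ne_one
    induction m using Finsupp.induction_linear generalizing G with
    | zero => exact hzero G h
    | add m n ihm ihn => exact hadd (fun G => ihm) (fun G => ihn) h
    | single s l =>
      induction l generalizing G with
      | zero => rw [Finsupp.single_zero] at h ⊢; exact hzero G h
      | succ l ih =>
        rw [Finsupp.single_add] at h ⊢
        refine hadd (fun G => ih) (fun G h => ?_) h
        obtain ⟨G', h1, h2⟩ := parYields_single.1 h
        rw [← Subtype.ext h2]
        exact .single h1

/-- Views of a parallel composition are the products of views of the components. -/
theorem IsAlternative.isParView_par_iff (hΓ : Γ.IsAlternative) :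
    Γ.IsParView (SPAlgebra.par α G H) m ↔
      ∃ m₁ m₂, m₁ + m₂ = m ∧ Γ.IsParView G m₁ ∧ Γ.IsParView H m₂ := by
  constructor
  · intro h
    obtain ⟨m₁, m₂, h1, h2, h3⟩ := ParYields.split (x := G.1) (y := H.1)
      (fun s G h => hΓ.not_isPGraph (generates_iff.1 h)) (isParView_iff.1 h)
    exact ⟨m₁, m₂, h1.symm, isParView_iff.2 h2, isParView_iff.2 h3⟩
  · rintro ⟨m₁, m₂, rfl, h1, h2⟩
    exact .par h1 h2

/-- An S-graph only has views of degree one. -/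
theorem isParView_of_not_isPGraph (hG : ¬ G.IsPGraph) :
    Γ.IsParView G m ↔ ∃ s, Γ.Generates (Sum.inr s) G ∧ m = Finsupp.single s 1 := by
  constructor
  · intro h
    cases h with
    | single h => exact ⟨_, h, rfl⟩
    | par => exact absurd SPGraph.isPGraph_par hG
  · rintro ⟨s, h, rfl⟩
    exact .single h

theorem RuleB.ne_zero (h : Γ.RuleB p m) : m ≠ 0 := by
  rintro rfl
  obtain ⟨t, -, ht⟩ := h
  simpa using ht.degree_pos

/-- There are finitely many rules, so that `bound` is a genuine supremum. -/
theorem RuleB.lt_bound (h : Γ.RuleB p m) (s : S) : m s < Γ.bound p s := by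
  refine Nat.lt_succ_of_le (le_csSup ?_ ⟨m, h, rfl⟩)
  refine Set.Finite.bddAbove ((Γ.finite_rules.image
    fun r => r.2.parCount (Sum.inr s)).subset ?_)
  rintro _ ⟨m, ⟨t, h1, h2⟩, rfl⟩
  refine ⟨_, h1, ?_⟩
  change t.parCount _ = _
  rw [← h2.eq_parCount, Finsupp.mapDomain_apply Sum.inr_injective]

theorem IsNormal.period_eq (hN : Γ.IsNormal) (h : Γ.RuleA p s l) : Γ.period p s = l :=
  hN.1 p s _ _ (Nat.sInf_mem (s := {l | Γ.RuleA p s l}) ⟨l, h⟩) h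

theorem IsNormal.isReduced_of_ruleB (hN : Γ.IsNormal) (h : Γ.RuleB p m) : Γ.IsReduced p m := by
  refine fun s => ⟨fun _ => h.lt_bound s, fun hs => ?_⟩
  have : m s = 0 := by
    by_contra h0
    exact (hN.2 p m h s h0).2 hs
  rw [this]
  exact period_pos hs

/-- The graphs generated by `p` are determined by their views: after a rule of type (B), the rules
of type (A) multiply the view by powers `s ^ period`, which do not change its normal form. -/
theorem yields_inl_iff (hΓ : Γ.IsAlternative) (hN : Γ.IsNormal) :
    Γ.Yields (.nt (Sum.inl p)) G ↔ ∃ m ∈ Γ.parProfile p G, Γ.RuleB p m := by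
  constructor
  · intro h
    induction hn : G.1.size using Nat.strong_induction_on generalizing G with
    | _ i ih =>
      obtain ⟨t, h1, h2⟩ := yields_nt_iff.1 h
      rcases hΓ.parOf_of_rule h1 with ⟨s, l, hl, ht⟩ | ⟨m, ht⟩
      · have hA : Γ.RuleA p s l := ⟨hl, t, h1, ht⟩
        obtain ⟨y, z, hy, hz, hG⟩ := parYields_add.1 ((yields_iff_parYields ht).1 h2)
        obtain ⟨G₁, hG₁, rfl⟩ := parYields_single.1 hy
        rw [← Finsupp.mapDomain_single, parYields_mapDomain] at hz
        rcases hz.eq_one_or_isSP with ⟨h0, -⟩ | ⟨-, hz'⟩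
        · have := Finsupp.single_eq_zero.1 h0
          omega
        · have hsize : G.1.size = G₁.1.size + z.size := by
            rw [hG]; exact GraphClass.size_par _ _
          have := hz'.size_pos
          obtain ⟨m₀, ⟨m, ⟨hm1, hm2⟩, hr, hm3⟩, hB⟩ :=
            ih G₁.1.size (by omega) (generates_iff.1 hG₁) rfl
          refine ⟨m₀, ⟨m + Finsupp.single s l, ⟨?_, ?_⟩, hr, fun s' => ⟨fun hs' => ?_,
            fun hs' => ?_⟩⟩, hB⟩
          · have : G = SPAlgebra.par α G₁ ⟨z, hz'⟩ := Subtype.ext hG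
            rw [this]
            exact .par hm1 (isParView_iff.2 hz)
          · intro s' hs'
            by_cases hss : s = s'
            · subst hss
              exact Or.inr ⟨l, hA⟩
            · refine hm2 s' ?_
              rwa [Finsupp.add_apply, Finsupp.single_eq_of_ne' hss, add_zero] at hs'
          · refine ((hm3 s').1 hs').trans ?_
            by_cases hss : s = s'
            · subst hss
              rw [Finsupp.add_apply, Finsupp.single_eq_same, hN.period_eq hA]
              exact (Nat.add_modEq_right).symm
            · rw [Finsupp.add_apply, Finsupp.single_eq_of_ne' hss, add_zero]
          · have hss : s ≠ s' := by
              rintro rfl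
              exact hs' ⟨l, hA⟩
            rw [Finsupp.add_apply, Finsupp.single_eq_of_ne' hss, add_zero, (hm3 s').2 hs']
      · have hB : Γ.RuleB p m := ⟨t, h1, ht⟩
        refine ⟨m, ⟨m, ⟨isParView_iff.2 ?_, fun s hs => Or.inl ⟨m, hB, hs⟩⟩,
          hN.isReduced_of_ruleB hB, fun s => ⟨fun _ => rfl, fun _ => rfl⟩⟩, hB⟩
        have := (yields_iff_parYields ht).1 h2
        rwa [parYields_mapDomain] at this
  · rintro ⟨m₀, ⟨m, ⟨hm1, -⟩, -, hm3⟩, hB⟩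
    have hper : ∀ s, Γ.Periodic p s → m₀ s = 0 := fun s hs => by
      by_contra h0
      exact (hN.2 p m₀ hB s h0).2 hs
    induction hd : m.degree using Nat.strong_induction_on generalizing G m with
    | _ i ih =>
      -- if `m ≠ m₀`, a whole period of some periodic nonterminal can be split off from `m`
      by_cases hm : m = m₀
      · subst hm
        obtain ⟨t, h1, ht⟩ := hB
        refine .rule h1 ((yields_iff_parYields ht).2 ?_)
        rw [parYields_mapDomain]
        exact isParView_iff.1 hm1
      · obtain ⟨s, hs⟩ : ∃ s, m s ≠ m₀ s := by
          by_contra! h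
          exact hm (Finsupp.ext h)
        have hsp : Γ.Periodic p s := by
          by_contra h
          exact hs ((hm3 s).2 h).symm
        have hA : Γ.RuleA p s (Γ.period p s) := Nat.sInf_mem (s := {l | Γ.RuleA p s l}) hsp
        have hle : Γ.period p s ≤ m s := by
          have h1 := (hm3 s).1 hsp
          rw [hper s hsp] at h1 hs
          exact Nat.le_of_dvd (Nat.pos_of_ne_zero hs) ((Nat.modEq_zero_iff_dvd).1 h1.symm)
        obtain ⟨n, rfl⟩ : ∃ n, m = n + Finsupp.single s (Γ.period p s) :=
          ⟨m - Finsupp.single s (Γ.period p s),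
            (tsub_add_cancel_of_le (Finsupp.single_le_iff.2 hle)).symm⟩
        have hn3 : ∀ s', (Γ.Periodic p s' → m₀ s' ≡ n s' [MOD Γ.period p s']) ∧
            (¬ Γ.Periodic p s' → m₀ s' = n s') := by
          intro s'
          by_cases hss : s = s'
          · subst hss
            refine ⟨fun h => ((hm3 s).1 h).trans ?_, fun h => absurd hsp h⟩
            rw [Finsupp.add_apply, Finsupp.single_eq_same]
            exact Nat.add_modEq_right
          · have := hm3 s'
            rwa [Finsupp.add_apply, Finsupp.single_eq_of_ne' hss, add_zero] at this
        have hn0 : n ≠ 0 := by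
          rintro rfl
          refine hB.ne_zero (Finsupp.ext fun s' => ?_)
          by_cases h : Γ.Periodic p s'
          · exact hper s' h
          · exact (hn3 s').2 h
        obtain ⟨y, z, hy, hz, hG⟩ := parYields_add.1 (isParView_iff.1 hm1)
        rcases hy.eq_one_or_isSP with ⟨h0, -⟩ | ⟨-, hy'⟩
        · exact absurd h0 hn0
        · have hdeg : n.degree < i := by
            rw [← hd, map_add, Finsupp.degree_single]
            have := hA.1
            omega
          have h1 := ih n.degree hdeg (G := ⟨y, hy'⟩) n (isParView_iff.2 hy) hn3 rfl
          obtain ⟨-, t, h2, ht⟩ := hA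
          refine .rule h2 ((yields_iff_parYields ht).2 (parYields_add.2 ⟨y, z, ?_, ?_, hG⟩))
          · exact parYields_single.2 ⟨⟨y, hy'⟩, generates_iff.2 h1, rfl⟩
          · rw [← Finsupp.mapDomain_single, parYields_mapDomain]
            exact hz

theorem IsAlternative.parProfile_par (hΓ : Γ.IsAlternative) (hN : Γ.IsNormal) :
    Γ.parProfile p (SPAlgebra.par α G H) =
      Γ.nf p (Set.image2 (· + ·) (Γ.parProfile p G) (Γ.parProfile p H)) := by
  have hcomm : ∀ T U : Set (S →₀ ℕ), Set.image2 (· + ·) T U = Set.image2 (· + ·) U T :=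
    fun T U => Set.image2_comm fun a b => add_comm a b
  unfold parProfile
  rw [← nf_image2_add hN, hcomm, ← nf_image2_add hN, hcomm]
  congr 1
  ext m
  constructor
  · rintro ⟨h1, h2⟩
    obtain ⟨m₁, m₂, rfl, h3, h4⟩ := hΓ.isParView_par_iff.1 h1
    exact ⟨m₁, ⟨h3, fun s hs => h2 s (by rw [Finsupp.add_apply]; omega)⟩,
      m₂, ⟨h4, fun s hs => h2 s (by rw [Finsupp.add_apply]; omega)⟩, rfl⟩
  · rintro ⟨m₁, ⟨h1, h2⟩, m₂, ⟨h3, h4⟩, rfl⟩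
    refine ⟨.par h1 h3, fun s hs => ?_⟩
    simp only [Finsupp.add_apply] at hs
    rcases Nat.eq_zero_or_pos (m₁ s) with h | h
    · exact h4 s (by omega)
    · exact h2 s (by omega)

end ParView

/-! ### Profiles form an algebra, and taking profiles is a homomorphism -/

section Profile

variable {α : Type*} {P S : Type*} {Γ : Grammar α (P ⊕ S)} {p : P} {s : S}
  {G H : SPGraph α}

theorem profile_of_isPGraph (h : G.IsPGraph) :
    Γ.profile G = Sum.inl fun p => Γ.parProfile p G := if_pos h

theorem profile_of_not_isPGraph (h : ¬ G.IsPGraph) :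
    Γ.profile G = Sum.inr (Γ.serProfile G) := if_neg h

theorem IsAlternative.serProfile_eq (hΓ : Γ.IsAlternative) (G : SPGraph α) :
    Γ.serProfile G = {v | Γ.SerView v.1 G v.2} :=
  Set.ext fun _ => hΓ.isSerView_iff

/-- The conversion of profiles recovers the parallel views also for S-graphs. -/
theorem IsAlternative.toPar_profile (hΓ : Γ.IsAlternative) (G : SPGraph α) :
    Γ.toPar (Γ.profile G) = fun p => Γ.parProfile p G := by
  by_cases hG : G.IsPGraph
  · rw [profile_of_isPGraph hG]
    rfl
  · rw [profile_of_not_isPGraph hG]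
    funext p
    change Γ.nf p _ = Γ.nf p _
    congr 1
    ext m
    simp only [Set.mem_ofPred_eq, isParView_of_not_isPGraph hG, hΓ.serProfile_eq,
      hΓ.serView_none_iff, generates_iff]
    constructor
    · rintro ⟨s, h1, h2, rfl⟩
      refine ⟨⟨s, h1, rfl⟩, fun s' hs' => ?_⟩
      by_cases hss : s = s'
      · rwa [← hss]
      · exact absurd (Finsupp.single_eq_of_ne' hss) hs'
    · rintro ⟨⟨s, h1, rfl⟩, h2⟩
      exact ⟨s, h1, h2 s (by simp), rfl⟩

/-- The conversion of profiles recovers the serial views also for P-graphs; these have no view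
with `⊥`. -/
theorem toSer_profile (hΓ : Γ.IsAlternative) (hN : Γ.IsNormal) (G : SPGraph α) :
    Γ.toSer (Γ.profile G) = {v | Γ.SerView v.1 G v.2} := by
  by_cases hG : G.IsPGraph
  · rw [profile_of_isPGraph hG]
    ext ⟨s, v⟩
    simp only [toSer, Set.mem_ofPred_eq, ← yields_inl_iff hΓ hN, hΓ.derives_ser_iff]
    constructor
    · rintro ⟨p, q, rfl, ⟨q₀, h1, h2⟩, h3⟩
      exact .base h1 h2 h3
    · intro h
      cases h with
      | leaf => exact absurd hG (SPGraph.not_isPGraph_bridge _)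
      | base h1 h2 h3 => exact ⟨_, _, rfl, ⟨_, h1, h2⟩, h3⟩
      | last => exact absurd hG SPGraph.not_isPGraph_ser
      | step => exact absurd hG SPGraph.not_isPGraph_ser
  · rw [profile_of_not_isPGraph hG]
    exact hΓ.serProfile_eq G

theorem profile_bridge (hΓ : Γ.IsAlternative) (a : α) :
    Γ.profile (SPAlgebra.bridge a) = Γ.profileBridge a := by
  rw [profile_of_not_isPGraph (SPGraph.not_isPGraph_bridge a), hΓ.serProfile_eq, profileBridge]
  congr 1
  ext ⟨s, v⟩
  simp only [Set.mem_ofPred_eq, Set.mem_union, hΓ.derives_ser_iff]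
  constructor
  · intro h
    generalize hG : (SPAlgebra.bridge a : SPGraph α) = G at h
    cases h with
    | leaf h => rw [SPGraph.bridge_injective hG]; exact Or.inl ⟨rfl, h⟩
    | base h1 h2 h3 =>
      obtain ⟨s', b, h4, h5, h6⟩ := hΓ.exists_bridge_rule h3
        (hG ▸ SPGraph.not_isPGraph_bridge a)
      rw [SPGraph.bridge_injective (hG.trans h6)]
      exact Or.inr ⟨_, _, s', rfl, ⟨_, h1, h2⟩, h4, h5⟩
    | last => exact absurd hG (SPGraph.bridge_ne_ser a)
    | step => exact absurd hG (SPGraph.bridge_ne_ser a)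
  · rintro (⟨rfl, h⟩ | ⟨p, q, s', rfl, ⟨q₀, h1, h2⟩, h3, h4⟩)
    · exact .leaf h
    · exact .base h1 h2 (.rule h3 (.rule h4 (.label a)))

theorem profile_par (hΓ : Γ.IsAlternative) (hN : Γ.IsNormal) (G H : SPGraph α) :
    Γ.profile (SPAlgebra.par α G H) = Γ.profilePar (Γ.profile G) (Γ.profile H) := by
  rw [profile_of_isPGraph SPGraph.isPGraph_par, profilePar, hΓ.toPar_profile, hΓ.toPar_profile]
  congr 1
  funext p
  exact hΓ.parProfile_par hN

theorem profile_ser (hΓ : Γ.IsAlternative) (hN : Γ.IsNormal) (G H : SPGraph α) :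
    Γ.profile (SPAlgebra.ser α G H) = Γ.profileSer (Γ.profile G) (Γ.profile H) := by
  rw [profile_of_not_isPGraph SPGraph.not_isPGraph_ser, hΓ.serProfile_eq, profileSer,
    toSer_profile hΓ hN, toSer_profile hΓ hN]
  congr 1
  ext ⟨s, v⟩
  simp only [Set.mem_ofPred_eq, Set.mem_union, hΓ.serView_ser_iff]
  constructor
  · rintro (h | ⟨rfl, p, h1, h2⟩)
    · exact Or.inl h
    · by_cases hH : H.IsPGraph
      · exact Or.inr ⟨rfl, p, _, h1, profile_of_isPGraph hH, (yields_inl_iff hΓ hN).1 h2⟩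
      · -- an S-graph generated by `p` comes from a rule `p → s'`
        obtain ⟨s', a, h3, h4, rfl⟩ := hΓ.exists_bridge_rule h2 hH
        exact Or.inl ⟨s', h1.extend h3, .leaf h4⟩
  · rintro (h | ⟨rfl, p, t, h1, h2, h3⟩)
    · exact Or.inl h
    · by_cases hH : H.IsPGraph
      · rw [profile_of_isPGraph hH] at h2
        obtain rfl := Sum.inl.inj h2
        exact Or.inr ⟨rfl, p, h1, (yields_inl_iff hΓ hN).2 h3⟩
      · rw [profile_of_not_isPGraph hH] at h2
        simp at h2

/-- Whether a nonterminal generates `G` can be read off from the profile of `G`. -/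
theorem generates_of_profile_eq (hΓ : Γ.IsAlternative) (hN : Γ.IsNormal)
    (h : Γ.profile G = Γ.profile H) {x : P ⊕ S} (hG : Γ.Generates x G) : Γ.Generates x H := by
  rw [generates_iff] at hG ⊢
  rcases x with p | s
  · rw [yields_inl_iff hΓ hN] at hG ⊢
    have h1 := congrArg (fun x => Γ.toPar x p) h
    simp only [hΓ.toPar_profile] at h1
    rwa [← h1]
  · rw [← hΓ.serView_none_iff] at hG ⊢
    have h1 := congrArg Γ.toSer h
    rw [toSer_profile hΓ hN, toSer_profile hΓ hN] at h1
    exact (Set.ext_iff.1 h1 (s, none)).1 hG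

/-- Reduced monomials in the variables of the term algebra of `p` have exponents below the bounds
and periods. -/
theorem finite_isReduced [Finite S] (Γ : Grammar α (P ⊕ S)) (p : P) :
    {m : S →₀ ℕ | Γ.IsReduced p m ∧ ∀ s, m s ≠ 0 → Γ.IsVar p s}.Finite := by
  refine Set.Finite.of_finite_image (f := fun m : S →₀ ℕ => (m : S → ℕ)) (Set.Finite.subset
    (Set.Finite.pi (t := fun s => Set.Iic (max (Γ.bound p s) (Γ.period p s)))
      fun s => Set.finite_Iic _) ?_) DFunLike.coe_injective.injOn
  rintro _ ⟨m, ⟨h1, h2⟩, rfl⟩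
  refine Set.mem_univ_pi.2 fun s => ?_
  by_cases h0 : m s = 0
  · simp [h0]
  · rcases h2 s h0 with h | h
    · exact (((h1 s).1 h).le.trans (le_max_left _ _))
    · exact (((h1 s).2 h).le.trans (le_max_right _ _))

theorem parProfile_subset (p : P) (G : SPGraph α) :
    Γ.parProfile p G ⊆ {m : S →₀ ℕ | Γ.IsReduced p m ∧ ∀ s, m s ≠ 0 → Γ.IsVar p s} := by
  rintro m ⟨m', ⟨-, h1⟩, hr, h2⟩
  refine ⟨hr, fun s hs => ?_⟩
  by_cases h : Γ.Periodic p s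
  · exact Or.inr h
  · exact h1 s (by rwa [← (h2 s).2 h])

theorem finite_range_profile [Finite P] [Finite S] (Γ : Grammar α (P ⊕ S)) :
    (Set.range Γ.profile).Finite := by
  have h1 : (Set.univ.pi fun p => {T : Set (S →₀ ℕ) |
      T ⊆ {m | Γ.IsReduced p m ∧ ∀ s, m s ≠ 0 → Γ.IsVar p s}}).Finite :=
    Set.Finite.pi fun p => (Γ.finite_isReduced p).finite_subsets
  have h2 : (Set.univ : Set (Set (S × Option (P ⊕ S)))).Finite := Set.finite_univ
  refine ((h1.image Sum.inl).union (h2.image Sum.inr)).subset ?_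
  rintro _ ⟨G, rfl⟩
  by_cases hG : G.IsPGraph
  · rw [profile_of_isPGraph hG]
    exact Or.inl ⟨_, Set.mem_univ_pi.2 fun p => parProfile_subset p G, rfl⟩
  · rw [profile_of_not_isPGraph hG]
    exact Or.inr ⟨_, Set.mem_univ _, rfl⟩

/-- The algebra of the profiles of all SP-graphs. -/
noncomputable def profileSubalgebra (hΓ : Γ.IsAlternative) (hN : Γ.IsNormal) :
    SPSubalgebra α Γ.Profile where
  carrier := Set.range Γ.profile
  bridge_mem a := ⟨_, profile_bridge hΓ a⟩
  ser_mem := by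
    rintro _ ⟨G, rfl⟩ _ ⟨H, rfl⟩
    exact ⟨_, profile_ser hΓ hN G H⟩
  par_mem := by
    rintro _ ⟨G, rfl⟩ _ ⟨H, rfl⟩
    exact ⟨_, profile_par hΓ hN G H⟩

/-- Taking profiles, as a homomorphism. -/
noncomputable def profileHom (hΓ : Γ.IsAlternative) (hN : Γ.IsNormal) :
    SPHom α (SPGraph α) (profileSubalgebra hΓ hN).carrier where
  toFun G := ⟨Γ.profile G, G, rfl⟩
  map_bridge a := Subtype.ext (profile_bridge hΓ a)
  map_ser G H := Subtype.ext (profile_ser hΓ hN G H)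
  map_par G H := Subtype.ext (profile_par hΓ hN G H)

theorem recognizedBy_profileHom [Finite P] [Finite S] (hΓ : Γ.IsAlternative) (hN : Γ.IsNormal) :
    RecognizedBy Γ.lang (profileHom hΓ hN) ((profileHom hΓ hN).toFun '' Γ.lang) := by
  refine ⟨Γ.finite_range_profile, Set.Subset.antisymm (Set.subset_preimage_image _ _) ?_⟩
  rintro H ⟨G, ⟨x, hx, hG⟩, h⟩
  exact ⟨x, hx, generates_of_profile_eq hΓ hN (congrArg Subtype.val h) hG⟩

end Profile

end Grammar

/-! ### From regular to alternative grammars in normal form -/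

namespace Term

variable {α : Type*} {N N' : Type*} {t : Term α N} {m : N →₀ ℕ} {x : N}

/-- Renaming of nonterminals. -/
def map (f : N → N') : Term α N → Term α N'
  | .nt x => .nt (f x)
  | .label a => .label a
  | .ser t u => .ser (t.map f) (u.map f)
  | .par t u => .par (t.map f) (u.map f)

theorem ParOf.map (h : t.ParOf m) (f : N → N') : (t.map f).ParOf (m.mapDomain f) := by
  induction h with
  | nt x => rw [Finsupp.mapDomain_single]; exact .nt _
  | par _ _ h1 h2 => rw [Finsupp.mapDomain_add]; exact .par h1 h2

theorem ParOf.occurs (h : t.ParOf m) (hx : m x ≠ 0) : t.Occurs x := by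
  induction h with
  | nt y =>
    by_contra hxy
    exact hx (Finsupp.single_eq_of_ne hxy)
  | @par t u m n _ _ h1 h2 =>
    by_cases hm : m x = 0
    · exact Or.inr (h2 (by rwa [Finsupp.add_apply, hm, zero_add] at hx))
    · exact Or.inl (h1 hm)

theorem Occurs.of_map {f : N → N'} {y : N'} (h : (t.map f).Occurs y) : ∃ x, f x = y := by
  induction t with
  | nt x => exact ⟨x, Eq.symm h⟩
  | label a => exact h.elim
  | ser t u h1 h2 => exact h.elim h1 h2
  | par t u h1 h2 => exact h.elim h1 h2

end Term

namespace Grammar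

section Copies

variable {α : Type u} {P : Type v} {S : Type w}

/-- Nonterminals of the alternative grammar: copies of the elements of `S`, one for each rule of `Γ`
and a further one, together with a nonterminal generating the `a`-bridge for each label `a`. -/
abbrev CopyNT (Γ : Grammar α (P ⊕ S)) : Type (max u v w) := (S × Option Γ.rules) ⊕ α

variable {Γ : Grammar α (P ⊕ S)} {p : P} {s : S} {l : ℕ} {t : Term α (P ⊕ S)} {G : SPGraph α}
  {i : Option Γ.rules}

/-- The copy of a nonterminal with index `i`; elements of `P` are not copied. -/
def copyNT (i : Option Γ.rules) : P ⊕ S → P ⊕ Γ.CopyNT :=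
  Sum.map id fun s => Sum.inl (s, i)

/-- The rules of the alternative grammar. Each rule `p → t` uses its own copies of the elements of
`S`, so that a copy is periodic for `p` through at most one rule and is then not bounded. -/
inductive CopyRule (Γ : Grammar α (P ⊕ S)) :
    (P ⊕ Γ.CopyNT) × Term α (P ⊕ Γ.CopyNT) → Prop
  | parRule (r : Γ.rules) (p : P) : r.1.1 = Sum.inl p → (∀ a, r.1.2 ≠ .label a) →
      CopyRule Γ (Sum.inl p, r.1.2.map (copyNT (some r)))
  | serRule (s : S) (t : Term α (P ⊕ S)) (i : Option Γ.rules) : (Sum.inr s, t) ∈ Γ.rules →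
      CopyRule Γ (Sum.inr (Sum.inl (s, i)), t.map (copyNT none))
  | chain (p : P) (a : α) : (Sum.inl p, .label a) ∈ Γ.rules →
      CopyRule Γ (Sum.inl p, .nt (Sum.inr (Sum.inr a)))
  | bridge (a : α) : CopyRule Γ (Sum.inr (Sum.inr a), .label a)

theorem finite_copyRule [Finite α] [Finite P] (Γ : Grammar α (P ⊕ S)) :
    {r | Γ.CopyRule r}.Finite := by
  have := Γ.finite_rules.to_subtype
  have h1 := Set.finite_range fun r : Γ.rules =>
    ((copyNT none r.1.1, r.1.2.map (copyNT (some r))) :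
      (P ⊕ Γ.CopyNT) × Term α (P ⊕ Γ.CopyNT))
  have h2 := Set.finite_range fun r : Γ.rules × Option Γ.rules =>
    ((copyNT r.2 r.1.1.1, r.1.1.2.map (copyNT none)) :
      (P ⊕ Γ.CopyNT) × Term α (P ⊕ Γ.CopyNT))
  have h3 := Set.finite_range fun r : P × α =>
    ((Sum.inl r.1, .nt (Sum.inr (Sum.inr r.2))) : (P ⊕ Γ.CopyNT) × Term α (P ⊕ Γ.CopyNT))
  have h4 := Set.finite_range fun a : α =>
    ((Sum.inr (Sum.inr a), .label a) : (P ⊕ Γ.CopyNT) × Term α (P ⊕ Γ.CopyNT))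
  refine (((h1.union h2).union h3).union h4).subset ?_
  rintro _ (⟨r, p, h, -⟩ | ⟨s, t, i, h⟩ | ⟨p, a, -⟩ | ⟨a⟩)
  · exact Or.inl (Or.inl (Or.inl ⟨r, by simp only [h]; rfl⟩))
  · exact Or.inl (Or.inl (Or.inr ⟨(⟨_, h⟩, i), rfl⟩))
  · exact Or.inl (Or.inr ⟨(p, a), rfl⟩)
  · exact Or.inr ⟨a, rfl⟩

variable [Finite α] [Finite P]

/-- The alternative grammar in normal form associated with a regular grammar. -/
def toAlternative (Γ : Grammar α (P ⊕ S)) : Grammar α (P ⊕ Γ.CopyNT) where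
  rules := {r | Γ.CopyRule r}
  finite_rules := Γ.finite_copyRule
  initial := copyNT none '' Γ.initial

theorem Yields.copy (h : Γ.Yields t G) (i : Option Γ.rules) :
    Γ.toAlternative.Yields (t.map (copyNT i)) G := by
  induction h generalizing i with
  | label a => exact .label a
  | ser _ _ ih1 ih2 => exact .ser (ih1 i) (ih2 i)
  | par _ _ ih1 ih2 => exact .par (ih1 i) (ih2 i)
  | @rule x t G h h' ih =>
    rcases x with p | s
    · -- a rule `p → a` is simulated by `p → s` and `s → a`
      by_cases ht : ∃ a, t = .label a
      · obtain ⟨a, rfl⟩ := ht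
        cases h' with
        | label => exact .rule (CopyRule.chain p a h) (.rule (CopyRule.bridge a) (.label a))
      · exact .rule (CopyRule.parRule ⟨_, h⟩ p rfl fun a ha => ht ⟨a, ha⟩) (ih _)
    · exact .rule (CopyRule.serRule s t i h) (ih none)

/-- Erasing the indices turns derivations of the alternative grammar into derivations of `Γ`. The
second part is needed for the rules `p → a` of `Γ`, which have been split into two steps. -/
theorem Yields.of_copy {t' : Term α (P ⊕ Γ.CopyNT)} (h : Γ.toAlternative.Yields t' G) :
    (∀ t i, t' = t.map (copyNT i) → Γ.Yields t G) ∧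
      (∀ a, t' = .nt (Sum.inr (Sum.inr a)) → G = SPAlgebra.bridge a) := by
  induction h with
  | label a =>
    refine ⟨fun t i ht => ?_, fun _ h => by simp at h⟩
    cases t <;> simp only [Term.map, reduceCtorEq, Term.label.injEq] at ht
    subst ht
    exact .label _
  | ser _ _ ih1 ih2 =>
    refine ⟨fun t i ht => ?_, fun _ h => by simp at h⟩
    cases t <;> simp only [Term.map, reduceCtorEq, Term.ser.injEq] at ht
    exact .ser (ih1.1 _ i ht.1) (ih2.1 _ i ht.2)
  | par _ _ ih1 ih2 =>
    refine ⟨fun t i ht => ?_, fun _ h => by simp at h⟩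
    cases t <;> simp only [Term.map, reduceCtorEq, Term.par.injEq] at ht
    exact .par (ih1.1 _ i ht.1) (ih2.1 _ i ht.2)
  | @rule x t' G h h' ih =>
    constructor
    · intro t i ht
      cases t <;> simp only [Term.map, reduceCtorEq, Term.nt.injEq] at ht
      rename_i y
      subst ht
      generalize hx : copyNT i y = x at h
      cases h with
      | parRule r p hr _ =>
        rcases y with p' | s'
        · obtain rfl : p' = p := Sum.inl.inj hx
          refine .rule ?_ (ih.1 _ _ rfl)
          rw [← hr]
          exact r.2
        · simp [copyNT] at hx
      | serRule s t j hr =>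
        rcases y with p' | s'
        · simp [copyNT] at hx
        · obtain rfl : s' = s := congrArg Prod.fst (Sum.inl.inj (Sum.inr.inj hx))
          exact .rule hr (ih.1 _ _ rfl)
      | chain p a hr =>
        rcases y with p' | s'
        · obtain rfl : p' = p := Sum.inl.inj hx
          rw [ih.2 a rfl]
          exact .rule hr (.label a)
        · simp [copyNT] at hx
      | bridge a => rcases y with p' | s' <;> simp [copyNT] at hx
    · intro a ha
      obtain rfl := Term.nt.inj ha
      cases h with
      | bridge =>
        cases h' with
        | label => rfl

theorem toAlternative_lang : Γ.toAlternative.lang = Γ.lang := by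
  ext G
  constructor
  · rintro ⟨_, ⟨x, hx, rfl⟩, h⟩
    exact ⟨x, hx, generates_iff.2 ((generates_iff.1 h).of_copy.1 (.nt x) none rfl)⟩
  · rintro ⟨x, hx, h⟩
    exact ⟨_, ⟨x, hx, rfl⟩, generates_iff.2 ((generates_iff.1 h).copy none)⟩

theorem isBridgeNonterminal_copy (a : α) : Γ.toAlternative.IsBridgeNonterminal (Sum.inr a) := by
  have hmap : ∀ (t : Term α (P ⊕ S)) (i : Option Γ.rules),
      ¬ (t.map (copyNT i)).Occurs (Sum.inr (Sum.inr a)) := by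
    intro t i h
    obtain ⟨x, hx⟩ := h.of_map
    rcases x with p | s <;> simp [copyNT] at hx
  refine ⟨a, CopyRule.bridge a, ?_⟩
  rintro _ (⟨r, p, -, -⟩ | ⟨s, t, i, -⟩ | ⟨p, b, -⟩ | ⟨b⟩) (h | h)
  · simp at h
  · exact absurd h (hmap _ _)
  · simp at h
  · exact absurd h (hmap _ _)
  · simp at h
  · obtain rfl : a = b := Sum.inr.inj (Sum.inr.inj h)
    exact Or.inr ⟨p, rfl⟩
  · obtain rfl : b = a := Sum.inr.inj (Sum.inr.inj h)
    exact Or.inl rfl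
  · exact h.elim

theorem IsRegular.toAlternative_isAlternative (hΓ : Γ.IsRegular) :
    IsAlternative (toAlternative Γ) := by
  rintro _ (⟨r, p, hr, hl⟩ | ⟨s, t, i, h⟩ | ⟨p, a, h⟩ | ⟨a⟩)
  · rcases hΓ _ r.2 with ⟨p', s, l, hl, h1, h2⟩ | ⟨p', m, hm, h1, h2⟩ | ⟨s, p', s', h1⟩ |
      ⟨s, p₁, p₂, h1⟩ | ⟨p', a, h1⟩ | ⟨s, a, h1⟩
    · obtain rfl : p' = p := Sum.inl.inj (h1.symm.trans hr)
      refine Or.inl ⟨p', Sum.inl (s, some r), l, hl, rfl, ?_⟩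
      have := h2.map (copyNT (some r))
      rwa [Finsupp.mapDomain_add, Finsupp.mapDomain_single, Finsupp.mapDomain_single] at this
    · refine Or.inr (Or.inl ⟨p, m.mapDomain fun s => Sum.inl (s, some r), ?_, rfl, ?_⟩)
      · rwa [Finsupp.degree_mapDomain]
      · have := h2.map (copyNT (some r))
        rw [← Finsupp.mapDomain_comp] at this ⊢
        exact this
    · rw [h1] at hr; simp at hr
    · rw [h1] at hr; simp at hr
    · exact absurd (congrArg Prod.snd h1) (hl a)
    · rw [h1] at hr; simp at hr
  · rcases hΓ _ h with ⟨p', s, l, hl, h1, h2⟩ | ⟨p', m, hm, h1, h2⟩ | ⟨s, p', s', h1⟩ |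
      ⟨s, p₁, p₂, h1⟩ | ⟨p', a, h1⟩ | ⟨s, a, h1⟩
    · simp at h1
    · simp at h1
    · obtain rfl := (Prod.mk.inj h1).2
      exact Or.inr (Or.inr (Or.inl ⟨_, _, _, rfl⟩))
    · obtain rfl := (Prod.mk.inj h1).2
      exact Or.inr (Or.inr (Or.inr (Or.inl ⟨_, _, _, rfl⟩)))
    · simp at h1
    · obtain rfl := (Prod.mk.inj h1).2
      exact Or.inr (Or.inr (Or.inr (Or.inr (Or.inr ⟨_, _, rfl⟩))))
  · exact Or.inr (Or.inr (Or.inr (Or.inr (Or.inl ⟨p, _, rfl, isBridgeNonterminal_copy a⟩))))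
  · exact Or.inr (Or.inr (Or.inr (Or.inr (Or.inr ⟨_, a, rfl⟩))))

/-- A copy is periodic only through the rule of type (A) whose index it carries. -/
theorem ruleA_toAlternative {s' : Γ.CopyNT} (h : Γ.toAlternative.RuleA p s' l) :
    ∃ (r : Γ.rules) (s : S), s' = Sum.inl (s, some r) ∧
      (r.1.2.map (copyNT (some r))).ParOf
        (Finsupp.single (Sum.inl p) 1 + Finsupp.single (Sum.inr s') l) := by
  obtain ⟨hl, t', hr, ht⟩ := h
  generalize hx : Sum.inl p = x at hr
  cases hr with
  | parRule r p' =>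
    refine ⟨r, ?_⟩
    obtain ⟨y, hy⟩ := (ht.occurs (x := Sum.inr s') (by simp; omega)).of_map
    rcases y with p'' | s
    · simp [copyNT] at hy
    · exact ⟨s, (Sum.inr.inj hy).symm, hx ▸ ht⟩
  | serRule => simp at hx
  | chain p' a =>
    -- `p` does not occur on the right-hand side
    have h1 := DFunLike.congr_fun ht.eq_parCount (Sum.inl p)
    simp [Term.parCount] at h1
  | bridge => simp at hx

theorem toAlternative_isNormal : Γ.toAlternative.IsNormal := by
  constructor
  · intro p s' l l' h h'
    obtain ⟨r, s, rfl, h1⟩ := ruleA_toAlternative h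
    obtain ⟨r', s', hs, h2⟩ := ruleA_toAlternative h'
    obtain rfl : r = r' := Option.some.inj (congrArg Prod.snd (Sum.inl.inj hs))
    have h3 := DFunLike.congr_fun (h1.eq_parCount.trans h2.eq_parCount.symm)
      (Sum.inr (Sum.inl (s, some r)))
    simpa using h3
  · intro p m h s' hs'
    refine ⟨⟨m, h, hs'⟩, ?_⟩
    rintro ⟨l, hA⟩
    obtain ⟨r, s, rfl, h1⟩ := ruleA_toAlternative hA
    obtain ⟨t', hr, ht⟩ := h
    have hm : (m.mapDomain Sum.inr : P ⊕ Γ.CopyNT →₀ ℕ) (Sum.inr (Sum.inl (s, some r))) ≠ 0 := by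
      rwa [Finsupp.mapDomain_apply Sum.inr_injective]
    have hocc := ht.occurs hm
    generalize hx : Sum.inl p = x at hr
    cases hr with
    | parRule r' p' =>
      obtain ⟨y, hy⟩ := hocc.of_map
      rcases y with p'' | s''
      · simp [copyNT] at hy
      · -- both rules are the same, but only one of them contains `p` on the right-hand side
        obtain rfl : r' = r := Option.some.inj (congrArg Prod.snd (Sum.inl.inj (Sum.inr.inj hy)))
        have h3 := DFunLike.congr_fun (ht.eq_parCount.trans h1.eq_parCount.symm) (Sum.inl p)
        have h4 : (m.mapDomain Sum.inr : P ⊕ Γ.CopyNT →₀ ℕ) (Sum.inl p) = 0 :=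
          Finsupp.mapDomain_of_notMem_range _ _ (by simp)
        simp [h4] at h3
    | serRule => simp at hx
    | chain p' a =>
      have : (Sum.inr (Sum.inl (s, some r)) : P ⊕ Γ.CopyNT) = Sum.inr (Sum.inr a) := hocc
      simp at this
    | bridge => simp at hx

end Copies

end Grammar

end SPG

theorem mainTheorem1 {α P S : Type u} [Finite α] [Finite P] [Finite S]
    (Γ : SPG.Grammar α (P ⊕ S)) :
    (Γ.IsAlternative → Γ.IsNormal →
      ∃ (A : SPG.SPSubalgebra α Γ.Profile) (h : SPG.SPHom α (SPG.SPGraph α) A.carrier),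
        A.carrier = Set.range Γ.profile ∧
        (∀ G, (h.toFun G : Γ.Profile) = Γ.profile G) ∧
        SPG.RecognizedBy Γ.lang h (h.toFun '' Γ.lang) ∧
        SPG.Recognizable α Γ.lang) ∧
    (Γ.IsRegular →
      (∃ (S' : Type u) (_ : Finite S') (Γ' : SPG.Grammar α (P ⊕ S')),
        Γ'.IsAlternative ∧ Γ'.IsNormal ∧ Γ'.lang = Γ.lang) ∧
      SPG.Recognizable α Γ.lang) := by
  refine ⟨fun hΓ hN => ⟨SPG.Grammar.profileSubalgebra hΓ hN, SPG.Grammar.profileHom hΓ hN, rfl,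
    fun _ => rfl, SPG.Grammar.recognizedBy_profileHom hΓ hN,
    _, _, _, _, SPG.Grammar.recognizedBy_profileHom hΓ hN⟩, fun hΓ => ?_⟩
  have hfin : Finite Γ.CopyNT := by
    have := Γ.finite_rules.to_subtype
    infer_instance
  have hA := hΓ.toAlternative_isAlternative
  have hN := SPG.Grammar.toAlternative_isNormal (Γ := Γ)
  refine ⟨⟨Γ.CopyNT, hfin, Γ.toAlternative, hA, hN, SPG.Grammar.toAlternative_lang⟩, ?_⟩
  rw [← SPG.Grammar.toAlternative_lang]
  exact ⟨_, _, _, _, SPG.Grammar.recognizedBy_profileHom hA hN⟩
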